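/- Let $\mathbb F\in\{\mathbb R,\mathbb C,\mathbb H\}$, $d=\dim_{\mathbb R}\mathbb F\in\{1,2,4\}$, and let $p\ge q\ge 1$ be integers, with $p>q$ if $\mathbb F=\mathbb R$. Let $G=SU(p+q,\mathbb F)$ be the group of unitary $(p+q)\times(p+q)$ matrices over $\mathbb F$ of determinant one and $K=S(U(q,\mathbb F)\times U(p,\mathbb F))$ its subgroup of block diagonal matrices. Put $$P_+=\{\lambda\in(2\mathbb Z)^q:\ \lambda_1\ge\dots\ge\lambda_q\ge 0\},\qquad A_0=\{x\in\mathbb R^q:\ \tfrac{\pi}{2}\ge x_1\ge\dots\ge x_q\ge 0\},$$ and for $x\in\mathbb R^q$, with $\underline x=\mathrm{diag}(x_1,\dots,x_q)$, $$a_x=\begin{pmatrix}\cos\underline x&-\sin\underline x&0\\ \sin\underline x&\cos\underline x&0\\ 0&0&I_{p-q}\end{pmatrix}\in G.$$ Order $P_+$ by the dominance order: $\mu\preceq\lambda$ iff $\lambda-\mu$ is a sum of positive roots $2e_i,\,4e_i,\,2(e_i\pm e_j)$ $(i<j)$. For $\lambda\in P_+$ let $R_\lambda^p$ be the Heckman--Opdam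 (Jacobi) polynomial of type $BC_q$ with multiplicities $k_1=d(p-q)/2$, $k_2=(d-1)/2$, $k_3=d/2$ on the roots $\pm2e_i$, $\pm4e_i$, $2(\pm e_i\pm e_j)$, normalized by $R_\lambda^p(0)=1$: it is the linear combination of the orbit sums $\sum_{w}e^{i\langle w\mu,x\rangle}$ ($w$ running through the hyperoctahedral group), $\mu\preceq\lambda$, which is orthogonal to the orbit sums of all $\mu\preceq\lambda$, $\mu\ne\lambda$, in $L^2\big(A_0,\prod_i|2\sin x_i|^{2k_1}|2\sin 2x_i|^{2k_2}\prod_{i<j}|4\sin(x_i-x_j)\sin(x_i+x_j)|^{2k_3}\,dx\big)$. For each $\tau\in P_+$ let $(\pi_\tau,H_\tau)$ be a spherical representation of $G$ associated with $\tau$, that is, an irreducible unitary representation whose restriction to $K$ contains the trivial representation exactly once and whose spherical function is given by $\langle u_\tau,\pi_\tau(a_x)u_\tau\rangle=R_\tau^p(x)$ for $x\in A_0$, where $u_\tau\in H_\tau$ is a $K$-invariant vector with $\|u_\tau\|=1$. For $\lambda,\mu,\tau\in P_+$ let $c_{\lambda,\mu,\tau}=\sum_k\|p_k(u_\lambda\otimes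 u_\mu)\|^2$, where $H_\lambda\otimes H_\mu=\bigoplus_k\widetilde H_k$ is an orthogonal decomposition into irreducible subrepresentations with orthogonal projections $p_k$ and the sum runs over those $k$ for which $\widetilde H_k$ is equivalent to $\pi_\tau$ (that is, $c_{\lambda,\mu,\tau}$ is the squared norm of the projection of $u_\lambda\otimes u_\mu$ to the $\pi_\tau$-isotypic component). Let $*$ be the bilinear convolution of measures on the discrete set $P_+$ with $\delta_\lambda*\delta_\mu=\sum_{\tau\in P_+}c_{\lambda,\mu,\tau}\delta_\tau$, and let $\delta_\lambda^{(n)}$ be the $n$-fold convolution power of $\delta_\lambda$, with $\delta_\lambda^{(0)}=\delta_0$ and $\delta_\lambda^{(n+1)}=\delta_\lambda^{(n)}*\delta_\lambda$. Let $\lambda\in P_+$, $\lambda\neq0$, let $n\in\mathbb N_0$, and let $H_\lambda^{\otimes n}=\bigoplus_{i}H_i$ be any orthogonal decomposition of the $n$-th tensor power $(\pi_\lambda^{\otimes n},H_\lambda^{\otimes n})$ into finitely many irreducible subrepresentations (counted with multiplicities), with orthogonal projections $p_i:H_\lambda^{\otimes n}\to H_i$. Then every component $H_i$ with $p_i(u_\lambda^{\otimes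 n})\ne0$ is equivalent to $\pi_{\tau_i}$ for exactly one $\tau_i\in P_+$, and $$\delta_\lambda^{(n)}=\sum_{i:\ p_i(u_\lambda^{\otimes n})\neq0}\big\|p_i\big(u_\lambda^{\otimes n}\big)\big\|^2\,\delta_{\tau_i}.$$ -/

import Mathlib

open MeasureTheory
open scoped TensorProduct

noncomputable section

/-! ### The fields, the groups `SU(p+q, 𝔽)` and `S(U(q, 𝔽) × U(p, 𝔽))`, and the torus elements -/

/-- The three (skew) fields `ℝ`, `ℂ`, `ℍ`. -/
inductive BaseField where
  | real
  | complex
  | quaternion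

namespace BaseField

/-- The underlying (skew) field. -/
@[reducible] def Carrier : BaseField → Type
  | real => ℝ
  | complex => ℂ
  | quaternion => Quaternion ℝ

/-- `d = dim_ℝ 𝔽`. -/
def dim : BaseField → ℕ
  | real => 1
  | complex => 2
  | quaternion => 4

instance (𝔽 : BaseField) : NormedDivisionRing 𝔽.Carrier :=
  match 𝔽 with
  | real => inferInstanceAs (NormedDivisionRing ℝ)
  | complex => inferInstanceAs (NormedDivisionRing ℂ)
  | quaternion => inferInstanceAs (NormedDivisionRing (Quaternion ℝ))

instance (𝔽 : BaseField) : StarRing 𝔽.Carrier :=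
  match 𝔽 with
  | real => inferInstanceAs (StarRing ℝ)
  | complex => inferInstanceAs (StarRing ℂ)
  | quaternion => inferInstanceAs (StarRing (Quaternion ℝ))

instance (𝔽 : BaseField) : NormedAlgebra ℝ 𝔽.Carrier :=
  match 𝔽 with
  | real => inferInstanceAs (NormedAlgebra ℝ ℝ)
  | complex => inferInstanceAs (NormedAlgebra ℝ ℂ)
  | quaternion => inferInstanceAs (NormedAlgebra ℝ (Quaternion ℝ))

/-- The condition `det g = 1`. For unitary quaternionic matrices the (Dieudonné) determinant is
automatically `1`, so that there is no condition. -/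
def DetOne {m : Type} [Fintype m] [DecidableEq m] :
    (𝔽 : BaseField) → Matrix m m 𝔽.Carrier → Prop
  | real, g => Matrix.det (R := ℝ) g = 1
  | complex, g => Matrix.det (R := ℂ) g = 1
  | quaternion, _ => True

/-- The group `SU(m, 𝔽)` of unitary matrices of determinant one:
`SO(m)`, `SU(m)` and `Sp(m)` for `𝔽 = ℝ, ℂ, ℍ`. -/
def SU (𝔽 : BaseField) (m : Type) [Fintype m] [DecidableEq m] :
    Subgroup (unitary (Matrix m m 𝔽.Carrier)) where
  carrier := {g | 𝔽.DetOne (g : Matrix m m 𝔽.Carrier)}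
  one_mem' := by
    cases 𝔽
    · exact Matrix.det_one (R := ℝ)
    · exact Matrix.det_one (R := ℂ)
    · trivial
  mul_mem' := by
    intro a b ha hb
    cases 𝔽
    · exact (Matrix.det_mul (R := ℝ) a.1 b.1).trans (by
        rw [show Matrix.det (R := ℝ) a.1 = 1 from ha, show Matrix.det (R := ℝ) b.1 = 1 from hb,
          one_mul])
    · exact (Matrix.det_mul (R := ℂ) a.1 b.1).trans (by
        rw [show Matrix.det (R := ℂ) a.1 = 1 from ha, show Matrix.det (R := ℂ) b.1 = 1 from hb,
          one_mul])
    · trivial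
  inv_mem' := by
    intro a ha
    cases 𝔽
    · exact (Matrix.det_conjTranspose (R := ℝ) a.1).trans (by
        rw [show Matrix.det (R := ℝ) a.1 = 1 from ha, star_one])
    · exact (Matrix.det_conjTranspose (R := ℂ) a.1).trans (by
        rw [show Matrix.det (R := ℂ) a.1 = 1 from ha, star_one])
    · trivial

end BaseField

/-- `G = SU(p+q, 𝔽)`; rows and columns are indexed by the `q` first and the `p` last indices. -/
abbrev GrassmannG (𝔽 : BaseField) (p q : ℕ) : Type := 𝔽.SU (Fin q ⊕ Fin p)

/-- The matrix of an element of `G`. -/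
def GrassmannG.mat {𝔽 : BaseField} {p q : ℕ} (g : GrassmannG 𝔽 p q) :
    Matrix (Fin q ⊕ Fin p) (Fin q ⊕ Fin p) 𝔽.Carrier := g.1.1

/-- `K = S(U(q, 𝔽) × U(p, 𝔽))`, the subgroup of block diagonal matrices in `G`. -/
def GrassmannK (𝔽 : BaseField) (p q : ℕ) : Subgroup (GrassmannG 𝔽 p q) where
  carrier := {g | g.mat.toBlocks₁₂ = 0 ∧ g.mat.toBlocks₂₁ = 0}
  one_mem' := by
    constructor <;> ext i j <;> simp [GrassmannG.mat, Matrix.toBlocks₁₂, Matrix.toBlocks₂₁]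
  mul_mem' := by
    rintro a b ⟨ha, ha'⟩ ⟨hb, hb'⟩
    have key : (a * b).mat = Matrix.fromBlocks (a.mat.toBlocks₁₁ * b.mat.toBlocks₁₁) 0 0
        (a.mat.toBlocks₂₂ * b.mat.toBlocks₂₂) := by
      have h1 : (a * b).mat = a.mat * b.mat := rfl
      rw [h1, ← Matrix.fromBlocks_toBlocks a.mat, ← Matrix.fromBlocks_toBlocks b.mat, ha, ha',
        hb, hb', Matrix.fromBlocks_multiply]
      simp
    simp [key]
  inv_mem' := by
    rintro a ⟨ha, ha'⟩
    have h1 : a⁻¹.mat = a.mat.conjTranspose := rfl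
    constructor
    · ext i j
      have := congrFun (congrFun ha' j) i
      simp only [Matrix.toBlocks₂₁, Matrix.of_apply, Matrix.zero_apply] at this
      simp [h1, Matrix.toBlocks₁₂, Matrix.conjTranspose_apply, this]
    · ext i j
      have := congrFun (congrFun ha j) i
      simp only [Matrix.toBlocks₁₂, Matrix.of_apply, Matrix.zero_apply] at this
      simp [h1, Matrix.toBlocks₂₁, Matrix.conjTranspose_apply, this]

/-- The real matrix
`[[cos x, -sin x, 0], [sin x, cos x, 0], [0, 0, I_{p-q}]]` (for `q ≤ p`), where `cos x`, `sin x`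
denote the diagonal matrices with entries `cos x_i`, `sin x_i`. -/
def torusMatrix (p q : ℕ) (x : Fin q → ℝ) : Matrix (Fin q ⊕ Fin p) (Fin q ⊕ Fin p) ℝ :=
  Matrix.of fun
    | .inl i, .inl j => if i = j then Real.cos (x i) else 0
    | .inl i, .inr j => if (i : ℕ) = j then -Real.sin (x i) else 0
    | .inr i, .inl j => if (i : ℕ) = j then Real.sin (x j) else 0
    | .inr i, .inr j => if i = j then (if h : (i : ℕ) < q then Real.cos (x ⟨i, h⟩) else 1) else 0

/-- The closed fundamental alcove `A₀ = {π/2 ≥ x₁ ≥ ⋯ ≥ x_q ≥ 0}`. -/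
def alcove (q : ℕ) : Set (Fin q → ℝ) :=
  {x | (∀ i, 0 ≤ x i ∧ x i ≤ Real.pi / 2) ∧ Antitone x}

/-! ### Dominant weights and Heckman-Opdam (Jacobi) polynomials of type `BC` -/

/-- `P₊ = {λ ∈ (2ℤ)^q : λ₁ ≥ ⋯ ≥ λ_q ≥ 0}`. -/
def PPlus (q : ℕ) : Type :=
  {lam : Fin q → ℤ // (∀ i, Even (lam i)) ∧ Antitone lam ∧ ∀ i, 0 ≤ lam i}

namespace PPlus

instance (q : ℕ) : Zero (PPlus q) := ⟨⟨0, by simp, fun _ _ _ => le_rfl, by simp⟩⟩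

/-- `P₊` is a discrete space. -/
instance (q : ℕ) : MeasurableSpace (PPlus q) := ⊤

/-- The dominance order: `μ ≼ λ` if and only if `λ - μ` is a sum of positive roots of
`R = {±2e_i, ±4e_i, ±2e_i±2e_j}`. The simple roots are `2(e_k - e_{k+1})` (`k < q`) and `2e_q`, and
the coefficient of the `k`-th one in `λ - μ` is half of the `k`-th partial sum of `λ - μ`
(an integer because all entries are even). -/
def Dominated {q : ℕ} (μ lam : PPlus q) : Prop :=
  ∀ k : Fin q, ∑ i ∈ Finset.Iic k, μ.1 i ≤ ∑ i ∈ Finset.Iic k, lam.1 i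

/-- The sum of `e^{i⟨wμ, x⟩}` over the elements `w` of the Weyl group of type `BC_q` (permutations
and sign changes), divided by `2^q`. Up to a positive constant this is the monomial symmetric
function (orbit sum) belonging to `μ`. -/
def orbitSum {q : ℕ} (μ : PPlus q) (x : Fin q → ℝ) : ℝ :=
  ∑ σ : Equiv.Perm (Fin q), ∏ j, Real.cos ((μ.1 (σ j) : ℝ) * x j)

end PPlus

/-- The Heckman-Opdam weight function `∏_{α ∈ R₊} |e^{i⟨α,x⟩/2} - e^{-i⟨α,x⟩/2}|^{2 k_α}` for the
positive roots `2e_i`, `4e_i`, `2(e_i ± e_j)` (`i < j`) with multiplicities `k₁`, `k₂`, `k₃`. -/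
def hoWeight {q : ℕ} (k₁ k₂ k₃ : ℝ) (x : Fin q → ℝ) : ℝ :=
  (∏ i, |2 * Real.sin (x i)| ^ (2 * k₁) * |2 * Real.sin (2 * x i)| ^ (2 * k₂)) *
    ∏ i, ∏ j ∈ Finset.Ioi i,
      |2 * Real.sin (x i - x j)| ^ (2 * k₃) * |2 * Real.sin (x i + x j)| ^ (2 * k₃)

/-- `R` is the Heckman-Opdam polynomial of type `BC_q` with index `λ` and multiplicities
`(k₁, k₂, k₃)`, normalized by `R(0) = 1`: it is a linear combination of the orbit sums of the
`μ ≼ λ`, orthogonal to the orbit sums of all `μ ≺ λ`. -/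
structure IsJacobiPoly {q : ℕ} (k₁ k₂ k₃ : ℝ) (lam : PPlus q) (R : (Fin q → ℝ) → ℝ) : Prop where
  mem_span : R ∈ Submodule.span ℝ {f | ∃ μ : PPlus q, μ.Dominated lam ∧ f = μ.orbitSum}
  orthogonal : ∀ μ : PPlus q, μ.Dominated lam → μ ≠ lam →
    ∫ x in alcove q, R x * μ.orbitSum x * hoWeight k₁ k₂ k₃ x = 0
  map_zero : R 0 = 1

/-! ### Unitary representations -/

/-- A (continuous) finite-dimensional unitary representation of a topological group. The groups
considered here are compact, so that all irreducible unitary representations are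
finite-dimensional. -/
structure UnitaryRep (G : Type) [Group G] [TopologicalSpace G] where
  H : Type
  [normedAddCommGroup : NormedAddCommGroup H]
  [innerProductSpace : InnerProductSpace ℂ H]
  [finiteDimensional : FiniteDimensional ℂ H]
  ρ : G →* (H ≃ₗᵢ[ℂ] H)
  continuous_apply : ∀ v, Continuous fun g => ρ g v

attribute [instance] UnitaryRep.normedAddCommGroup UnitaryRep.innerProductSpace
  UnitaryRep.finiteDimensional

namespace UnitaryRep

variable {G : Type} [Group G] [TopologicalSpace G]

/-- The subspace `W` is invariant. -/
def Invariant (V : UnitaryRep G) (W : Submodule ℂ V.H) : Prop :=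
  ∀ g, ∀ v ∈ W, V.ρ g v ∈ W

/-- The subspace `W` is an irreducible subrepresentation. -/
def IrreducibleSub (V : UnitaryRep G) (W : Submodule ℂ V.H) : Prop :=
  V.Invariant W ∧ W ≠ ⊥ ∧ ∀ U ≤ W, V.Invariant U → U = ⊥ ∨ U = W

/-- The representation `V` is irreducible. -/
def Irreducible (V : UnitaryRep G) : Prop := V.IrreducibleSub ⊤

/-- The subrepresentation `W` of `V` is (unitarily) equivalent to the representation `V'`. -/
def EquivSub (V : UnitaryRep G) (W : Submodule ℂ V.H) (V' : UnitaryRep G) : Prop :=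
  ∃ f : V'.H →ₗᵢ[ℂ] V.H, (∀ g v, f (V'.ρ g v) = V.ρ g (f v)) ∧ LinearMap.range f.toLinearMap = W

/-- The isotypic component of type `V'` of `V`: the span of all subrepresentations equivalent to
`V'`. For irreducible `V'` it is the sum of all those components of any given orthogonal
decomposition of `V` into irreducible subrepresentations that are equivalent to `V'`. -/
def isotypic (V V' : UnitaryRep G) : Submodule ℂ V.H :=
  sSup {W | V.EquivSub W V'}

/-- The subspace of the vectors that are invariant under the subgroup `K`. -/
def fixed (V : UnitaryRep G) (K : Subgroup G) : Submodule ℂ V.H where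
  carrier := {v | ∀ k ∈ K, V.ρ k v = v}
  zero_mem' := by simp
  add_mem' := by
    intro a b ha hb k hk
    rw [map_add, ha k hk, hb k hk]
  smul_mem' := by
    intro c a ha k hk
    rw [map_smul, ha k hk]

/-- The family `W` is an orthogonal decomposition of `V` into irreducible subrepresentations. -/
structure IsDecomposition (V : UnitaryRep G) {ι : Type*} (W : ι → Submodule ℂ V.H) : Prop where
  irreducible : ∀ i, V.IrreducibleSub (W i)
  orthogonal : ∀ i j, i ≠ j → W i ⟂ W j
  iSup_eq_top : ⨆ i, W i = ⊤

/-- The trivial one-dimensional representation. -/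
def trivial (G : Type) [Group G] [TopologicalSpace G] : UnitaryRep G where
  H := ℂ
  ρ := 1
  continuous_apply := fun _ => continuous_const

/-- The tensor product of two unitary representations, on the tensor product of Hilbert spaces. -/
def tensor (V W : UnitaryRep G) : UnitaryRep G where
  H := V.H ⊗[ℂ] W.H
  ρ :=
    { toFun := fun g => TensorProduct.congrIsometry (V.ρ g) (W.ρ g)
      map_one' := by
        apply LinearIsometryEquiv.toLinearEquiv_injective
        apply LinearEquiv.toLinearMap_injective
        apply TensorProduct.ext'
        intro x y
        simp
      map_mul' := by
        intro g h
        apply LinearIsometryEquiv.toLinearEquiv_injective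
        apply LinearEquiv.toLinearMap_injective
        apply TensorProduct.ext'
        intro x y
        simp }
  continuous_apply := by
    intro v
    induction v using TensorProduct.induction_on with
    | zero => simpa using continuous_const
    | tmul x y =>
      have h : Continuous fun g => TensorProduct.mkL ℂ V.H W.H (V.ρ g x) (W.ρ g y) :=
        ((TensorProduct.mkL ℂ V.H W.H).continuous.comp (V.continuous_apply x)).clm_apply
          (W.continuous_apply y)
      simpa using h
    | add x y hx hy => simpa [Pi.add_def] using hx.add hy

/-- The tensor powers `V^{⊗ n}`. -/
def tpow (V : UnitaryRep G) : ℕ → UnitaryRep G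
  | 0 => trivial G
  | n + 1 => (V.tpow n).tensor V

/-- The vector `u^{⊗ n} ∈ V^{⊗ n}`. -/
def vpow (V : UnitaryRep G) (u : V.H) : (n : ℕ) → (V.tpow n).H
  | 0 => (1 : ℂ)
  | n + 1 => (V.vpow u n) ⊗ₜ[ℂ] u

end UnitaryRep

/-! ### The spherical representations and the convolution on `P₊` -/

/-- A spherical representation `(π_λ, H_λ)` of `G = SU(p+q, 𝔽)` associated with `λ ∈ P₊`: an
irreducible unitary representation whose restriction to `K` contains the trivial representation
exactly once, together with a `K`-invariant unit vector `u_λ`, such that the spherical function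
`φ_λ(g) = ⟨u_λ, π_λ(g) u_λ⟩` is given on the matrices `a_x`, `x ∈ A₀`, by the Jacobi polynomial
`R_λ^p(x)` with multiplicities `(d(p-q)/2, (d-1)/2, d/2)`. -/
structure SphericalRep (𝔽 : BaseField) (p q : ℕ) (lam : PPlus q) where
  rep : UnitaryRep (GrassmannG 𝔽 p q)
  irreducible : rep.Irreducible
  finrank_fixed : Module.finrank ℂ (rep.fixed (GrassmannK 𝔽 p q)) = 1
  u : rep.H
  u_mem : u ∈ rep.fixed (GrassmannK 𝔽 p q)
  norm_u : ‖u‖ = 1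
  spherical : ∃ R : (Fin q → ℝ) → ℝ,
    IsJacobiPoly ((𝔽.dim : ℝ) * ((p : ℝ) - q) / 2) (((𝔽.dim : ℝ) - 1) / 2) ((𝔽.dim : ℝ) / 2) lam R ∧
    ∀ x ∈ alcove q, ∀ g : GrassmannG 𝔽 p q,
      g.mat = (torusMatrix p q x).map (algebraMap ℝ 𝔽.Carrier) →
        inner ℂ u (rep.ρ g u) = (R x : ℂ)

section Convolution

variable {𝔽 : BaseField} {p q : ℕ} (S : (lam : PPlus q) → SphericalRep 𝔽 p q lam)

/-- The coefficient `c_{λ,μ,τ} = ∑_k ‖p_k(u_λ ⊗ u_μ)‖²`, where the sum is over those components of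
an orthogonal decomposition of `π_λ ⊗ π_μ` into irreducible representations that are equivalent to
`π_τ`; equivalently, the squared norm of the projection of `u_λ ⊗ u_μ` to the isotypic
component. -/
def convCoeff (lam μ τ : PPlus q) : ℝ :=
  ‖(((S lam).rep.tensor (S μ).rep).isotypic (S τ).rep).starProjection
    ((S lam).u ⊗ₜ[ℂ] (S μ).u : (S lam).rep.H ⊗[ℂ] (S μ).rep.H)‖ ^ 2

/-- `δ_λ * δ_μ = ∑_τ c_{λ,μ,τ} δ_τ`. -/
def pointConv (lam μ : PPlus q) : Measure (PPlus q) :=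
  Measure.sum fun τ => ENNReal.ofReal (convCoeff S lam μ τ) • Measure.dirac τ

/-- The bilinear extension `ν * ν' = ∑_{λ,μ} ν({λ}) ν'({μ}) δ_λ * δ_μ` of the convolution to
measures. -/
def conv (ν ν' : Measure (PPlus q)) : Measure (PPlus q) :=
  ν.bind fun lam => ν'.bind fun μ => pointConv S lam μ

/-- The convolution powers `δ_λ^{(n)}`; the neutral element `δ_0` is the power for `n = 0`. -/
def convPow (lam : PPlus q) : ℕ → Measure (PPlus q)
  | 0 => Measure.dirac 0
  | n + 1 => conv S (convPow lam n) (Measure.dirac lam)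

end Convolution

end

/-! Both measures have the same mass at every `τ`: the squared norm of the projection of `u_λ^{⊗n}`
to the `π_τ`-isotypic component of `H_λ^{⊗n}`. For the measure built from an orthogonal
decomposition this holds because the isotypic projection is the sum of the projections to the
components equivalent to `π_τ` (`sum_smul_dirac_singleton`). For the convolution power it is proved
by induction on `n` (`convPow_singleton`).

In the induction step, decompose `V = H_λ^{⊗n}` into irreducibles `W i` and let `v = u_λ^{⊗n}`. The
projection `v_i` of `v` to `W i` is `K`-invariant; if it is nonzero, then `W i` is equivalent to
some `π_σ`, and under the equivalence `v_i` is a multiple of `u_σ` because `K`-invariants are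
one-dimensional. Hence the isotypic projection of `v_i ⊗ u_λ` has squared norm `‖v_i‖² c_{σ,λ,τ}`.
Isotypic projections commute with the isometric inclusions `W i ⊗ H_λ → V ⊗ H_λ`, so these
projections are mutually orthogonal and the squared norms add up to the mass of the convolution. The
case `n = 0` rests on `R_0 = 1`, which makes `π_0` trivial.

The substantial input is that every irreducible representation with a nonzero `K`-invariant vector
`v` is some `π_τ` (`exists_equivSub_top`). Otherwise Schur orthogonality makes `φ(g) = ⟨v, π(g)v⟩`
orthogonal to all spherical functions of the given family. By `G = K A₀ K` a bi-`K`-invariant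
function is determined by its values on the alcove. There the spherical functions are the Jacobi
polynomials, which span all orbit sums by triangularity, and the orbit sums are uniformly dense by
Stone-Weierstrass. So the complex conjugate of `φ` is a uniform limit of functions orthogonal to
`φ`, which forces `∫ |φ|² = 0`, a contradiction.

Uniqueness of `τ` holds because equivalent spherical representations have the same spherical
function, and a Jacobi polynomial determines its leading weight (`eq_of_eqOn`). The decomposition `G
= K A₀ K` is obtained uniformly over `ℝ`, `ℂ`, `ℍ` by maximizing the real part of a trace over
compact unitary groups. -/

set_option linter.unusedSectionVars false

noncomputable section

/-! ### Norm, conjugation and real part on `ℝ`, `ℂ`, `ℍ` -/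

/-- The common features of `ℝ`, `ℂ` and `ℍ` that the matrix decompositions below depend on. -/
class HurwitzField (F : Type) [NormedDivisionRing F] [StarRing F] [NormedAlgebra ℝ F] where
  finite : FiniteDimensional ℝ F
  re : F →ₗ[ℝ] ℝ
  re_mul_comm : ∀ a b : F, re (a * b) = re (b * a)
  re_star : ∀ a : F, re (star a) = re a
  re_algebraMap : ∀ r : ℝ, re (algebraMap ℝ F r) = r
  star_algebraMap : ∀ r : ℝ, star (algebraMap ℝ F r) = algebraMap ℝ F r
  star_mul_self : ∀ a : F, star a * a = algebraMap ℝ F (‖a‖ ^ 2)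

namespace BaseField

instance hurwitzField (𝔽 : BaseField) : HurwitzField 𝔽.Carrier where
  finite := by
    cases 𝔽
    · exact inferInstanceAs (FiniteDimensional ℝ ℝ)
    · exact inferInstanceAs (FiniteDimensional ℝ ℂ)
    · exact inferInstanceAs (FiniteDimensional ℝ (Quaternion ℝ))
  re := match 𝔽 with
    | real => LinearMap.id
    | complex => Complex.reLm
    | quaternion => QuaternionAlgebra.reₗ (-1) 0 (-1)
  re_mul_comm := by
    cases 𝔽
    · exact fun a b => mul_comm (G := ℝ) a b
    · exact fun a b => congrArg Complex.re (mul_comm (G := ℂ) a b)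
    · intro a b
      change (((a : Quaternion ℝ) * (b : Quaternion ℝ) : Quaternion ℝ)).re =
        (((b : Quaternion ℝ) * (a : Quaternion ℝ) : Quaternion ℝ)).re
      simp only [Quaternion.re_mul]
      ring
  re_star := by
    cases 𝔽
    · exact fun a => rfl
    · exact fun a => rfl
    · intro a
      exact Quaternion.re_star (a : Quaternion ℝ)
  re_algebraMap := by
    cases 𝔽
    · exact fun r => rfl
    · exact fun r => rfl
    · exact fun r => rfl
  star_algebraMap := by
    cases 𝔽
    · exact fun r => rfl
    · exact fun r => Complex.conj_ofReal r
    · exact fun r => Quaternion.star_coe r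
  star_mul_self := by
    cases 𝔽
    · intro a
      change (a : ℝ) * a = ‖(a : ℝ)‖ ^ 2
      rw [Real.norm_eq_abs, sq_abs, sq]
    · intro a
      exact (Complex.conj_mul' (a : ℂ)).trans (Complex.ofReal_pow _ 2).symm
    · intro a
      refine (Quaternion.star_mul_self (a : Quaternion ℝ)).trans ?_
      rw [Quaternion.normSq_eq_norm_mul_self, ← sq]
      rfl

end BaseField

namespace HurwitzField

variable {F : Type} [NormedDivisionRing F] [StarRing F] [NormedAlgebra ℝ F] [HurwitzField F]

instance : FiniteDimensional ℝ F := finite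

instance : ProperSpace F := FiniteDimensional.proper ℝ F

instance : StarModule ℝ F where
  star_smul r a := by
    rw [Algebra.smul_def, star_mul, star_algebraMap, ← Algebra.commutes, ← Algebra.smul_def]
    simp

theorem norm_star (a : F) : ‖star a‖ = ‖a‖ := by
  rcases eq_or_ne a 0 with rfl | ha
  · simp
  · have h := congrArg norm (star_mul_self a)
    rw [norm_mul, norm_algebraMap'] at h
    have h' : ‖a‖ ≠ 0 := norm_ne_zero_iff.2 ha
    rw [Real.norm_of_nonneg (by positivity), sq] at h
    exact mul_right_cancel₀ h' h

instance : NormedStarGroup F := ⟨fun a => (norm_star a).le⟩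

theorem mul_star_self (a : F) : a * star a = algebraMap ℝ F (‖a‖ ^ 2) := by
  have := star_mul_self (star a)
  rwa [star_star, norm_star] at this

theorem re_star_mul_self (a : F) : re (star a * a) = ‖a‖ ^ 2 := by
  rw [star_mul_self, re_algebraMap]

theorem continuous_re : Continuous (re : F → ℝ) := LinearMap.continuous_of_finiteDimensional _

/-- An element whose real part cannot be increased by multiplication with units is real and
nonnegative. -/
theorem eq_norm_of_re_mul_le {z : F} (h : ∀ u : F, star u * u = 1 → re (u * z) ≤ re z) :
    z = algebraMap ℝ F ‖z‖ := by
  rcases eq_or_ne z 0 with rfl | hz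
  · simp
  have hz' : ‖z‖ ≠ 0 := norm_ne_zero_iff.2 hz
  -- The unit `star z / ‖z‖` sends `z` to `‖z‖`, so `‖z‖ ≤ re z`; then `|z - ‖z‖|² = 2‖z‖² - 2‖z‖ re
  -- z` cannot be positive.
  have h1 := h (‖z‖⁻¹ • star z) (by
    rw [star_smul, star_star, smul_mul_smul_comm, mul_star_self, Algebra.smul_def, ← map_mul]
    rw [show (star ‖z‖⁻¹ * ‖z‖⁻¹ * ‖z‖ ^ 2 : ℝ) = 1 by simp; field_simp, map_one])
  rw [smul_mul_assoc, map_smul, re_star_mul_self, smul_eq_mul, sq, inv_mul_cancel_left₀ hz'] at h1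
  have h2 : ‖z - algebraMap ℝ F ‖z‖‖ ^ 2 = 2 * ‖z‖ ^ 2 - 2 * ‖z‖ * re z := by
    rw [← re_star_mul_self, star_sub, star_algebraMap, sub_mul, mul_sub, mul_sub, star_mul_self,
      ← Algebra.commutes, ← map_mul, ← Algebra.smul_def, ← Algebra.smul_def]
    simp only [map_sub, re_algebraMap, map_smul, re_star, smul_eq_mul]
    ring
  have h3 : ‖z - algebraMap ℝ F ‖z‖‖ ^ 2 ≤ 0 := by
    rw [h2]
    nlinarith [norm_nonneg z]
  have h4 : ‖z - algebraMap ℝ F ‖z‖‖ = 0 := by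
    nlinarith [norm_nonneg (z - algebraMap ℝ F ‖z‖)]
  exact sub_eq_zero.1 (norm_eq_zero.1 h4)

end HurwitzField

open HurwitzField Matrix

/-! ### Unitary matrices and maximization of the real trace -/

section MatrixDecomposition

variable {F : Type} [NormedDivisionRing F] [StarRing F] [NormedAlgebra ℝ F] [HurwitzField F] {m n : Type} [Fintype m] [Fintype n]

/-- The real part of the trace. -/
def reTrace (M : Matrix m m F) : ℝ := re M.trace

theorem reTrace_mul_comm (M : Matrix m n F) (N : Matrix n m F) :
    reTrace (M * N) = reTrace (N * M) := by
  simp only [reTrace, trace, diag_apply, mul_apply, map_sum]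
  rw [Finset.sum_comm]
  simp_rw [re_mul_comm]

theorem continuous_reTrace : Continuous (reTrace : Matrix m m F → ℝ) :=
  continuous_re.comp (by fun_prop)

theorem conjTranspose_mul_self_apply_self (M : Matrix m n F) (j : n) :
    (Mᴴ * M) j j = algebraMap ℝ F (∑ i, ‖M i j‖ ^ 2) := by
  simp only [mul_apply, conjTranspose_apply, star_mul_self, map_sum]

variable [DecidableEq m]

theorem isCompact_unitary : IsCompact (unitary (Matrix m m F) : Set (Matrix m m F)) := by
  have hc : IsClosed (unitary (Matrix m m F) : Set (Matrix m m F)) := by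
    have : (unitary (Matrix m m F) : Set (Matrix m m F)) =
        {A | star A * A = 1} ∩ {A | A * star A = 1} := by
      ext A
      simp [Unitary.mem_iff]
    rw [this]
    exact (isClosed_eq (by fun_prop) continuous_const).inter
      (isClosed_eq (by fun_prop) continuous_const)
  have hK : IsCompact (Set.univ.pi fun _ : m => Set.univ.pi fun _ : m =>
      Metric.closedBall (0 : F) 1) :=
    isCompact_univ_pi fun _ => isCompact_univ_pi fun _ => isCompact_closedBall _ _
  refine hK.of_isClosed_subset hc ?_
  suffices h : ∀ A : Matrix m m F, A ∈ unitary (Matrix m m F) → ∀ i j, ‖A i j‖ ≤ 1 from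
    fun A hA i _ j _ => mem_closedBall_zero_iff.2 (h A hA i j)
  intro A hA i j
  have h1 := conjTranspose_mul_self_apply_self A j
  rw [show Aᴴ * A = 1 from (Unitary.mem_iff.1 hA).1, one_apply_eq,
    ← map_one (algebraMap ℝ F)] at h1
  have h2 := (algebraMap ℝ F).injective h1
  have h3 : ‖A i j‖ ^ 2 ≤ 1 := by
    rw [h2]
    exact Finset.single_le_sum (f := fun i => ‖A i j‖ ^ 2) (fun _ _ => by positivity)
      (Finset.mem_univ i)
  simpa using abs_le_one_iff_mul_self_le_one.2 (by nlinarith : ‖A i j‖ * ‖A i j‖ ≤ 1)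

/-- Square matrices over a division ring form a Dedekind-finite ring, so a left inverse is also a
right inverse. -/
theorem mem_unitary_of_conjTranspose_mul {A : Matrix m m F} (h : Aᴴ * A = 1) :
    A ∈ unitary (Matrix m m F) :=
  Unitary.mem_iff.2 ⟨h, mul_eq_one_comm.1 h⟩

theorem diagonal_update_mem_unitary (i : m) {u : F} (hu : star u * u = 1) :
    diagonal (Function.update (fun _ => 1) i u) ∈ unitary (Matrix m m F) := by
  apply mem_unitary_of_conjTranspose_mul
  rw [diagonal_conjTranspose, diagonal_mul_diagonal, ← diagonal_one]
  congr 1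
  ext j
  rcases eq_or_ne j i with rfl | h
  · simp [hu]
  · simp [h]

/-- A unitary matrix that acts as a rotation in the plane of the coordinates `i` and `j`. -/
def planeRotation (i j : m) (c s : ℝ) (b : F) : Matrix m m F :=
  1 + single i i (algebraMap ℝ F (c - 1)) + single j j (algebraMap ℝ F (c - 1)) +
    single i j (s • b) - single j i (s • star b)

theorem planeRotation_mem_unitary {i j : m} (hij : i ≠ j) {c s : ℝ} (hcs : c ^ 2 + s ^ 2 = 1)
    {b : F} (hb : star b * b = 1) : planeRotation i j c s b ∈ unitary (Matrix m m F) := by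
  have hb' : b * star b = 1 := mul_eq_one_comm.1 hb
  have key : ∀ r : ℝ, ∀ x : F, algebraMap ℝ F r * x = r • x := fun r x =>
    (Algebra.smul_def r x).symm
  have key' : ∀ r : ℝ, ∀ x : F, x * algebraMap ℝ F r = r • x := fun r x => by
    rw [← Algebra.commutes, key]
  have h1 : (planeRotation i j c s b)ᴴ = 1 + single i i (algebraMap ℝ F (c - 1)) +
      single j j (algebraMap ℝ F (c - 1)) + single j i (s • star b) - single i j (s • b) := by
    simp only [planeRotation, conjTranspose_add, conjTranspose_sub, conjTranspose_one,
      conjTranspose_single, HurwitzField.star_algebraMap, star_smul, star_trivial, star_star]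
  apply mem_unitary_of_conjTranspose_mul
  have h3 : ∀ (i : m) (x : ℝ) (y : F), single i i (x • y) = x • (single i i y : Matrix m m F) :=
    fun i x y => (smul_single x i i y).symm
  rw [h1, planeRotation]
  simp only [add_mul, sub_mul, mul_add, mul_sub, one_mul, mul_one, single_mul_single_same,
    single_mul_single_of_ne _ _ _ _ hij, single_mul_single_of_ne _ _ _ _ hij.symm,
    smul_mul_smul_comm, hb, hb', key, key', smul_smul, mul_comm (c - 1) s,
    add_zero, sub_zero]
  simp only [h3, Algebra.algebraMap_eq_smul_one]
  -- This is `s² = 1 - c²` written in powers of `c - 1`, the form in which the other coefficients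
  -- appear.
  rw [show s * s = -((c - 1) * (c - 1)) - (c - 1) - (c - 1) by linear_combination hcs]
  module

/-- First-order bookkeeping for the maximization argument: it shows how much a plane rotation can
gain from a failure of `M` to be Hermitian in the entries `i`, `j`. -/
theorem reTrace_planeRotation_mul (i j : m) (c s : ℝ) (b : F) (M : Matrix m m F) :
    reTrace (planeRotation i j c s b * M) = reTrace M + (c - 1) * (re (M i i) + re (M j j)) +
      s * (re (b * M j i) - re (star b * M i j)) := by
  have h : ∀ (r : ℝ) (x : F), re (algebraMap ℝ F r * x) = r * re x := fun r x => by
    rw [← Algebra.smul_def, LinearMap.map_smul, smul_eq_mul]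
  simp only [reTrace, planeRotation, Matrix.add_mul, Matrix.sub_mul, Matrix.one_mul, trace_add,
    trace_sub, trace_single_mul, LinearMap.map_add, LinearMap.map_sub, smul_eq_mul,
    smul_mul_assoc, LinearMap.map_smul, h]
  ring

/-- Testing the maximum against unitary matrices that multiply a single row by a unit changes only
one summand of the trace. -/
theorem diag_eq_norm_of_reTrace_mul_le {M : Matrix m m F}
    (h : ∀ k ∈ unitary (Matrix m m F), reTrace (k * M) ≤ reTrace M) (i : m) :
    M i i = algebraMap ℝ F ‖M i i‖ := by
  apply eq_norm_of_re_mul_le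
  intro u hu
  have h1 := h _ (diagonal_update_mem_unitary i hu)
  simp only [reTrace, trace, diag_apply, diagonal_mul, map_sum] at h1
  rw [Finset.sum_eq_add_sum_sdiff_singleton_of_mem (Finset.mem_univ i),
    Finset.sum_eq_add_sum_sdiff_singleton_of_mem (Finset.mem_univ i)] at h1
  rw [Finset.sum_congr rfl (g := fun j => re (M j j)) fun j hj => by
    rw [Function.update_of_ne (by simpa using hj), one_mul]] at h1
  rw [Function.update_self] at h1
  linarith

/-- A square matrix that maximizes the real part of the trace in its orbit under the unitary
group is Hermitian. -/
theorem isHermitian_of_reTrace_mul_le {M : Matrix m m F}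
    (h : ∀ k ∈ unitary (Matrix m m F), reTrace (k * M) ≤ reTrace M) : M.IsHermitian := by
  have hdiag := diag_eq_norm_of_reTrace_mul_le h
  have hoff : ∀ i j, i ≠ j → star (M i j) = M j i := by
    intro i j hij
    by_contra hne
    set N : F := M j i - star (M i j) with hN
    have hN0 : ‖N‖ ≠ 0 := norm_ne_zero_iff.2 (sub_ne_zero.2 (Ne.symm hne))
    -- This phase makes the linear gain in `s` equal to `‖N‖`, its largest possible value.
    set b : F := ‖N‖⁻¹ • star N with hb
    have hb1 : star b * b = 1 := by
      rw [hb, star_smul, star_star, smul_mul_smul_comm, mul_star_self, Algebra.smul_def, ← map_mul,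
        show (star ‖N‖⁻¹ * ‖N‖⁻¹ * ‖N‖ ^ 2 : ℝ) = 1 by simp; field_simp, map_one]
    have h1 : re (b * M j i) - re (star b * M i j) = ‖N‖ := by
      have : re (star b * M i j) = re (b * star (M i j)) := by
        rw [← re_star, star_mul, star_star, re_mul_comm]
      rw [this, ← map_sub, ← mul_sub, ← hN, hb, smul_mul_assoc, map_smul, re_star_mul_self,
        smul_eq_mul]
      field_simp
    set α := re (M i i) + re (M j j)
    have hr : 0 < α ^ 2 + ‖N‖ ^ 2 := by positivity
    set r := Real.sqrt (α ^ 2 + ‖N‖ ^ 2)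
    have hr0 : 0 < r := Real.sqrt_pos.2 hr
    have hrr : r ^ 2 = α ^ 2 + ‖N‖ ^ 2 := Real.sq_sqrt hr.le
    -- The unit vector `(c, s)` is chosen parallel to `(α, ‖N‖)`; the trace then grows by `r - α`,
    -- which is positive as `N ≠ 0`.
    have h2 := h _ (planeRotation_mem_unitary hij (c := α / r) (s := ‖N‖ / r) (by
      field_simp; exact hrr.symm) hb1)
    rw [reTrace_planeRotation_mul, h1] at h2
    have h3 : r ≤ α := by
      have : (α / r - 1) * α + ‖N‖ / r * ‖N‖ = r - α := by
        field_simp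
        linear_combination -hrr
      linarith
    have : 0 < ‖N‖ ^ 2 := by positivity
    nlinarith
  ext i j
  rw [conjTranspose_apply]
  rcases eq_or_ne i j with rfl | hij
  · rw [hdiag i, star_algebraMap]
  · exact hoff j i hij.symm

end MatrixDecomposition
end

noncomputable section
open HurwitzField Matrix

/-! ### Singular values and rectangular diagonal forms -/

section MatrixDecomposition

variable {F : Type} [NormedDivisionRing F] [StarRing F] [NormedAlgebra ℝ F] [HurwitzField F]
  {m n : Type} [Fintype m] [Fintype n] [DecidableEq m]

/-- The diagonal matrix with real entries `a`. -/
abbrev realDiagonal (F : Type) [NormedDivisionRing F] [NormedAlgebra ℝ F] (a : m → ℝ) :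
    Matrix m m F := diagonal fun i => algebraMap ℝ F (a i)

theorem realDiagonal_apply_self (a : m → ℝ) (i : m) :
    realDiagonal F a i i = algebraMap ℝ F (a i) := diagonal_apply_eq _ i

theorem realDiagonal_apply_ne (a : m → ℝ) {i j : m} (h : i ≠ j) : realDiagonal F a i j = 0 :=
  diagonal_apply_ne _ h

theorem realDiagonal_mul_apply (a : m → ℝ) (M : Matrix m n F) (i : m) (j : n) :
    (realDiagonal F a * M) i j = a i • M i j := by
  rw [diagonal_mul, Algebra.smul_def]

theorem mul_realDiagonal_apply (a : m → ℝ) (M : Matrix n m F) (i : n) (j : m) :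
    (M * realDiagonal F a) i j = a j • M i j := by
  rw [mul_diagonal, ← Algebra.commutes, Algebra.smul_def]

/-- Singular value decomposition over `ℝ`, `ℂ` and `ℍ`. -/
theorem exists_unitary_mul_mul_eq_realDiagonal {q : ℕ} (A : Matrix (Fin q) (Fin q) F) :
    ∃ k ∈ unitary (Matrix (Fin q) (Fin q) F), ∃ k' ∈ unitary (Matrix (Fin q) (Fin q) F),
      ∃ a : Fin q → ℝ, Monotone a ∧ (∀ i, 0 ≤ a i) ∧ k * A * k' = realDiagonal F a := by
  -- Distinct positive weights: at a maximum of `re tr (c k A k')` both `B c` and `c B` are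
  -- Hermitian for `B = k A k'`, and distinctness of the `c i ^ 2` then removes the off-diagonal
  -- entries of `B`.
  set c : Fin q → ℝ := fun i => (i : ℝ) + 1 with hc
  have hc0 : ∀ i, 0 < c i := fun i => by positivity
  have hcinj : ∀ i j, c i ^ 2 = c j ^ 2 → i = j := by
    intro i j h
    have := (sq_eq_sq₀ (hc0 i).le (hc0 j).le).1 h
    exact Fin.ext (by simpa [hc] using this)
  obtain ⟨⟨k, k'⟩, ⟨hk, hk'⟩, hmax⟩ :=
    ((isCompact_unitary (F := F) (m := Fin q)).prod
      (isCompact_unitary (F := F) (m := Fin q))).exists_isMaxOn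
      ⟨(1, 1), one_mem _, one_mem _⟩
      (f := fun x => reTrace (realDiagonal F c * (x.1 * A * x.2)))
      (continuous_reTrace.comp (by fun_prop)).continuousOn
  set B := k * A * k' with hB
  have h1 : (B * realDiagonal F c).IsHermitian ∧
      ∀ i, (B * realDiagonal F c) i i = algebraMap ℝ F ‖(B * realDiagonal F c) i i‖ := by
    have : ∀ u ∈ unitary (Matrix (Fin q) (Fin q) F),
        reTrace (u * (B * realDiagonal F c)) ≤ reTrace (B * realDiagonal F c) := by
      intro u hu
      have := hmax (show (u * k, k') ∈ _ from ⟨mul_mem hu hk, hk'⟩)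
      simp only [Set.mem_ofPred_eq] at this
      rw [reTrace_mul_comm, ← hB, reTrace_mul_comm _ B] at this
      simpa [hB, mul_assoc] using this
    exact ⟨isHermitian_of_reTrace_mul_le this, diag_eq_norm_of_reTrace_mul_le this⟩
  have h2 : (realDiagonal F c * B).IsHermitian := by
    apply isHermitian_of_reTrace_mul_le
    intro u hu
    have := hmax (show (k, k' * u) ∈ _ from ⟨hk, mul_mem hk' hu⟩)
    simp only [Set.mem_ofPred_eq] at this
    rw [reTrace_mul_comm u]
    simpa [hB, mul_assoc] using this
  have hdiag : B = realDiagonal F fun i => ‖B i i‖ := by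
    ext i j
    rcases eq_or_ne i j with rfl | hij
    · rw [realDiagonal_apply_self]
      have := h1.2 i
      rw [mul_realDiagonal_apply, norm_smul, Real.norm_of_nonneg (hc0 i).le, map_mul,
        ← Algebra.smul_def] at this
      exact smul_right_injective F (hc0 i).ne' this
    · rw [realDiagonal_apply_ne _ hij]
      have e1 := h1.1.apply i j
      have e2 := h2.apply i j
      rw [mul_realDiagonal_apply, mul_realDiagonal_apply, star_smul, star_trivial] at e1
      rw [realDiagonal_mul_apply, realDiagonal_mul_apply, star_smul, star_trivial] at e2
      by_contra hne
      apply hij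
      apply hcinj
      -- The two Hermitian conditions say `c i • star (B j i) = c j • B i j` and `c j • star (B j i)
      -- = c i • B i j`; eliminate `star (B j i)`.
      have : (c i ^ 2 - c j ^ 2) • B i j = 0 := by
        rw [sub_smul, sq, sq, mul_smul, mul_smul, ← e1, ← e2, smul_comm, sub_self]
      rcases smul_eq_zero.1 this with h | h
      · linarith
      · exact absurd h hne
  set a : Fin q → ℝ := fun i => ‖B i i‖
  set σ := Tuple.sort a
  have hsub : ∀ k ∈ unitary (Matrix (Fin q) (Fin q) F), k.submatrix σ id ∈
      unitary (Matrix (Fin q) (Fin q) F) := by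
    intro k hk
    apply mem_unitary_of_conjTranspose_mul
    rw [conjTranspose_submatrix, submatrix_mul_equiv]
    rw [show kᴴ * k = 1 from (Unitary.mem_iff.1 hk).1]
    simp
  refine ⟨k.submatrix σ id, hsub k hk, k'.submatrix id σ, ?_, a ∘ σ, Tuple.monotone_sort a,
    fun i => norm_nonneg _, ?_⟩
  · have := Unitary.star_mem (hsub _ (Unitary.star_mem hk'))
    rwa [star_eq_conjTranspose, conjTranspose_submatrix, star_eq_conjTranspose,
      conjTranspose_conjTranspose] at this
  · have : k.submatrix σ id * A * k'.submatrix id σ = B.submatrix σ σ := by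
      rw [hB]
      rfl
    rw [this, hdiag, submatrix_diagonal _ _ σ.injective]
    rfl

/-- A Hermitian matrix with nonnegative diagonal and diagonal square is diagonal if the nonzero
entries of the square are distinct. -/
theorem eq_realDiagonal_of_mul_self {M : Matrix m m F} (hM : M.IsHermitian)
    (hd : ∀ i, M i i = algebraMap ℝ F ‖M i i‖) {t : m → ℝ} (ht : ∀ i, 0 ≤ t i)
    (hM2 : M * M = realDiagonal F fun i => t i ^ 2) (hinj : ∀ i j, i ≠ j → t i = t j → t j = 0) :
    M = realDiagonal F t := by
  have hcol : ∀ j, ∑ i, ‖M i j‖ ^ 2 = t j ^ 2 := by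
    intro j
    have := conjTranspose_mul_self_apply_self M j
    rw [hM.eq, hM2, realDiagonal_apply_self] at this
    exact ((algebraMap ℝ F).injective this).symm
  have hoff : ∀ i j, i ≠ j → M i j = 0 := by
    intro i j hij
    by_contra hne
    -- `M` commutes with its square, which is diagonal.
    have h1 : (t i ^ 2 - t j ^ 2) • M i j = 0 := by
      rw [sub_smul, ← realDiagonal_mul_apply (fun i => t i ^ 2) M,
        ← mul_realDiagonal_apply (fun i => t i ^ 2) M, ← hM2, mul_assoc, sub_self]
    have h2 : t i = t j := by
      rcases smul_eq_zero.1 h1 with h | h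
      · exact (sq_eq_sq₀ (ht i) (ht j)).1 (by linarith)
      · exact absurd h hne
    -- For equal `t i` and `t j` both vanish by `hinj`, so the whole `j`-th column of `M` has norm
    -- zero.
    have h3 := hcol j
    rw [hinj i j hij h2] at h3
    have h4 := (Finset.sum_eq_zero_iff_of_nonneg (fun _ _ => by positivity)).1
      (h3.trans (by simp)) i (Finset.mem_univ i)
    exact hne (by simpa using h4)
  ext i j
  rcases eq_or_ne i j with rfl | hij
  · rw [realDiagonal_apply_self, hd]
    congr 1
    have := hcol i
    rw [Finset.sum_eq_single i (fun j _ hj => by simp [hoff j i hj]) (by simp)] at this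
    exact (sq_eq_sq₀ (norm_nonneg _) (ht i)).1 this
  · rw [realDiagonal_apply_ne _ hij, hoff i j hij]

/-- A matrix with orthogonal columns of decreasing norms `s` can be moved to the rectangular
diagonal matrix with entries `s` by a unitary matrix. -/
theorem exists_unitary_mul_eq_of_orthogonal_columns {p q : ℕ} (hqp : q ≤ p)
    (C : Matrix (Fin p) (Fin q) F) {s : Fin q → ℝ} (hs : Antitone s) (hs0 : ∀ i, 0 ≤ s i)
    (hC : Cᴴ * C = realDiagonal F fun i => s i ^ 2) :
    ∃ k ∈ unitary (Matrix (Fin p) (Fin p) F),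
      k * C = of fun (i : Fin p) (j : Fin q) => if (j : ℕ) = i then algebraMap ℝ F (s j) else 0 := by
  -- Strictly decreasing positive weights make the products `c j * s j` distinct as long as they are
  -- nonzero, even when some of the `s j` coincide.
  set c : Fin q → ℝ := fun i => q - i with hc
  have hc0 : ∀ i, 0 < c i := fun i => by simp [hc]
  set J : Matrix (Fin q) (Fin p) F :=
    of fun (j : Fin q) (i : Fin p) => if (j : ℕ) = i then algebraMap ℝ F (c j) else 0 with hJ
  have hmul : ∀ (X : Matrix (Fin p) (Fin q) F) (i : Fin p) (l : Fin p),
      (X * J) i l = if h : (l : ℕ) < q then c ⟨l, h⟩ • X i ⟨l, h⟩ else 0 := by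
    intro X i l
    rw [mul_apply]
    split_ifs with h
    · rw [Finset.sum_eq_single ⟨l, h⟩]
      · simp [hJ, ← Algebra.commutes, Algebra.smul_def]
      · intro j _ hj
        rw [hJ, of_apply, if_neg (fun h => hj (Fin.ext h)), mul_zero]
      · simp
    · refine Finset.sum_eq_zero fun j _ => ?_
      rw [hJ, of_apply, if_neg (fun h' : (j : ℕ) = l => h (h' ▸ j.2)), mul_zero]
  -- At the maximum `M = k * C * J` is Hermitian with nonnegative diagonal, and `M² = Mᴴ M = Jᴴ Cᴴ C
  -- J` is an explicit diagonal matrix; this determines `M`, and dividing its first `q` columns by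
  -- the weights recovers `k * C`.
  obtain ⟨k, hk, hmax⟩ := (isCompact_unitary (F := F) (m := Fin p)).exists_isMaxOn
      ⟨1, one_mem _⟩ (f := fun x => reTrace (x * (C * J)))
      (continuous_reTrace.comp (by fun_prop)).continuousOn
  have hle : ∀ u ∈ unitary (Matrix (Fin p) (Fin p) F),
      reTrace (u * (k * C * J)) ≤ reTrace (k * C * J) := by
    intro u hu
    have := hmax (show u * k ∈ _ from mul_mem hu hk)
    simpa [Matrix.mul_assoc] using this
  set t : Fin p → ℝ := fun l => if h : (l : ℕ) < q then c ⟨l, h⟩ * s ⟨l, h⟩ else 0 with ht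
  have hM := isHermitian_of_reTrace_mul_le hle
  have hM2 : (k * C * J) * (k * C * J) = realDiagonal F fun i => t i ^ 2 := by
    nth_rewrite 1 [← hM.eq]
    rw [conjTranspose_mul, conjTranspose_mul]
    have : Jᴴ * (Cᴴ * kᴴ) * (k * C * J) = Jᴴ * ((Cᴴ * C) * J) := by
      simp only [Matrix.mul_assoc]
      rw [← Matrix.mul_assoc kᴴ k, show kᴴ * k = 1 from (Unitary.mem_iff.1 hk).1, Matrix.one_mul]
    rw [this, hC]
    ext i l
    rw [← conjTranspose_conjTranspose (realDiagonal F _ * J), ← conjTranspose_mul,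
      conjTranspose_apply, hmul]
    simp only [ht]
    rcases eq_or_ne i l with rfl | hil
    · rw [realDiagonal_apply_self]
      split_ifs with h
      · rw [conjTranspose_apply, realDiagonal_mul_apply, hJ, of_apply, if_pos rfl, star_smul,
          star_star, star_trivial, Algebra.smul_def, Algebra.smul_def,
          ← map_mul, ← map_mul]
        ring_nf
      · simp
    · rw [realDiagonal_apply_ne _ hil]
      split_ifs with h
      · rw [conjTranspose_apply, realDiagonal_mul_apply, hJ, of_apply,
          if_neg (fun h' => hil (Fin.ext h'))]
        simp
      · simp
  have key := eq_realDiagonal_of_mul_self hM (diag_eq_norm_of_reTrace_mul_le hle)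
    (t := t) (fun i => by
      simp only [ht]
      split_ifs with h
      · exact mul_nonneg (hc0 _).le (hs0 _)
      · exact le_rfl) hM2 (by
    have hlt : ∀ i j : Fin p, i < j → t i = t j → t j = 0 := by
      intro i j hij h
      by_contra hne
      have hj : (j : ℕ) < q := by
        by_contra hj
        exact hne (by simp [ht, hj])
      have hi : (i : ℕ) < q := lt_trans hij hj
      simp only [ht, hi, hj, dif_pos] at h hne
      have h1 : s ⟨j, hj⟩ ≤ s ⟨i, hi⟩ := hs (Fin.mk_le_mk.2 (Fin.lt_def.1 hij).le)
      have h2 : c ⟨j, hj⟩ < c ⟨i, hi⟩ := by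
        have : ((i : ℕ) : ℝ) < (j : ℕ) := by exact_mod_cast hij
        simp only [hc]
        linarith
      have h3 : 0 < s ⟨j, hj⟩ := lt_of_le_of_ne (hs0 _) fun h => hne (by rw [← h, mul_zero])
      nlinarith [hc0 ⟨j, hj⟩, hc0 ⟨i, hi⟩]
    intro i j hij h
    rcases lt_or_gt_of_ne hij with h' | h'
    · exact hlt i j h' h
    · rw [← h]
      exact hlt j i h' h.symm)
  refine ⟨k, hk, ?_⟩
  ext i j
  have h1 := congrFun (congrFun key i) (Fin.castLE hqp j)
  rw [hmul, dif_pos (by simp)] at h1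
  simp only [Fin.val_castLE, Fin.eta] at h1
  apply smul_right_injective F (hc0 j).ne'
  simp only
  rw [h1, of_apply]
  split_ifs with h
  · have : i = Fin.castLE hqp j := Fin.ext h.symm
    rw [← this, realDiagonal_apply_self, Algebra.smul_def, ← map_mul]
    congr 1
    simp only [ht]
    rw [dif_pos (by rw [← h]; exact j.2)]
    simp only [← h]
  · rw [realDiagonal_apply_ne, smul_zero]
    exact fun h' => h (by rw [h']; rfl)

end MatrixDecomposition
end

noncomputable section
open HurwitzField Matrix

/-! ### The torus elements and the decomposition of the full unitary group -/

section Torus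

variable {p q : ℕ}

theorem torusMatrix_inl_sum (hqp : q ≤ p) (x : Fin q → ℝ) (i : Fin q) (f : Fin q ⊕ Fin p → ℝ) :
    ∑ k, torusMatrix p q x (.inl i) k * f k =
      Real.cos (x i) * f (.inl i) - Real.sin (x i) * f (.inr (Fin.castLE hqp i)) := by
  rw [Fintype.sum_sum_type, Finset.sum_eq_single i, Finset.sum_eq_single (Fin.castLE hqp i)]
  · simp [torusMatrix, sub_eq_add_neg]
  · intro k _ hk
    have : (i : ℕ) ≠ k := fun h => hk (Fin.ext h.symm)
    simp [torusMatrix, this]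
  · simp
  · intro k _ hk
    simp [torusMatrix, hk.symm]
  · simp

theorem torusMatrix_inr_sum_of_lt (x : Fin q → ℝ) (i : Fin p) (h : (i : ℕ) < q)
    (f : Fin q ⊕ Fin p → ℝ) :
    ∑ k, torusMatrix p q x (.inr i) k * f k =
      Real.sin (x ⟨i, h⟩) * f (.inl ⟨i, h⟩) + Real.cos (x ⟨i, h⟩) * f (.inr i) := by
  rw [Fintype.sum_sum_type, Finset.sum_eq_single ⟨i, h⟩, Finset.sum_eq_single i]
  · simp [torusMatrix, h]
  · intro k _ hk
    simp [torusMatrix, hk.symm]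
  · simp
  · intro k _ hk
    have : (i : ℕ) ≠ k := fun h => hk (Fin.ext h.symm)
    simp [torusMatrix, this]
  · simp

theorem torusMatrix_inr_sum_of_not_lt (x : Fin q → ℝ) (i : Fin p) (h : ¬ (i : ℕ) < q)
    (f : Fin q ⊕ Fin p → ℝ) : ∑ k, torusMatrix p q x (.inr i) k * f k = f (.inr i) := by
  rw [Fintype.sum_sum_type, Finset.sum_eq_zero, Finset.sum_eq_single i]
  · simp [torusMatrix, h]
  · intro k _ hk
    simp [torusMatrix, hk.symm]
  · simp
  · intro k _
    have : (i : ℕ) ≠ k := fun h' => h (h' ▸ k.2)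
    simp [torusMatrix, this]

theorem torusMatrix_mul (hqp : q ≤ p) (x y : Fin q → ℝ) :
    torusMatrix p q x * torusMatrix p q y = torusMatrix p q (x + y) := by
  ext i j
  rw [mul_apply]
  rcases i with i | i
  · rw [torusMatrix_inl_sum hqp]
    rcases j with j | j
    · rcases eq_or_ne i j with rfl | h
      · simp [torusMatrix, Real.cos_add]
      · have : (i : ℕ) ≠ j := fun h' => h (Fin.ext h')
        simp [torusMatrix, h, this]
    · rcases eq_or_ne (i : ℕ) j with h | h
      · have h' : Fin.castLE hqp i = j := Fin.ext h
        have h'' : (j : ℕ) < q := h ▸ i.2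
        have h3 : (⟨j, h''⟩ : Fin q) = i := Fin.ext h.symm
        simp [torusMatrix, h, h', h'', h3, Real.sin_add]
        ring
      · have h' : Fin.castLE hqp i ≠ j := fun h' => h (by rw [← h']; rfl)
        simp [torusMatrix, h, h']
  · by_cases hi : (i : ℕ) < q
    · rw [torusMatrix_inr_sum_of_lt _ _ hi]
      rcases j with j | j
      · rcases eq_or_ne (i : ℕ) j with h | h
        · have h' : (⟨i, hi⟩ : Fin q) = j := Fin.ext h
          simp [torusMatrix, h, Real.sin_add]
        · have h' : (⟨i, hi⟩ : Fin q) ≠ j := fun h' => h (congrArg Fin.val h')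
          simp [torusMatrix, h, h']
      · rcases eq_or_ne i j with rfl | h
        · simp [torusMatrix, hi, Real.cos_add]
          ring
        · have h' : (i : ℕ) ≠ j := fun h' => h (Fin.ext h')
          simp [torusMatrix, h, h']
    · rw [torusMatrix_inr_sum_of_not_lt _ _ hi]
      rcases j with j | j
      · have h : (i : ℕ) ≠ j := fun h => hi (h ▸ j.2)
        simp [torusMatrix, h]
      · simp [torusMatrix, hi]

theorem torusMatrix_zero : torusMatrix p q 0 = 1 := by
  ext i j
  rcases i with i | i <;> rcases j with j | j <;> simp [torusMatrix, one_apply]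

theorem torusMatrix_transpose (x : Fin q → ℝ) :
    (torusMatrix p q x)ᵀ = torusMatrix p q (-x) := by
  ext i j
  rcases i with i | i <;> rcases j with j | j
  · by_cases h : i = j
    · simp [torusMatrix, h]
    · simp [torusMatrix, h, Ne.symm h]
  · simp [torusMatrix, eq_comm]
  · simp [torusMatrix, eq_comm]
  · by_cases h : i = j
    · simp [torusMatrix, h]
    · simp [torusMatrix, h, Ne.symm h]

theorem torusMatrix_transpose_mul (hqp : q ≤ p) (x : Fin q → ℝ) :
    (torusMatrix p q x)ᵀ * torusMatrix p q x = 1 := by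
  rw [torusMatrix_transpose, torusMatrix_mul hqp, neg_add_cancel, torusMatrix_zero]

/-- The matrix is the square of the one for `x / 2`, and an orthogonal matrix has determinant `±1`.
-/
theorem det_torusMatrix (hqp : q ≤ p) (x : Fin q → ℝ) : (torusMatrix p q x).det = 1 := by
  have h1 : (torusMatrix p q x).det = (torusMatrix p q ((1 / 2 : ℝ) • x)).det ^ 2 := by
    rw [sq, ← det_mul, torusMatrix_mul hqp, ← add_smul]
    norm_num
  have h2 := congrArg det (torusMatrix_transpose_mul hqp ((1 / 2 : ℝ) • x))
  rw [det_mul, det_transpose, det_one, ← sq] at h2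
  rw [h1, h2]

theorem continuous_torusMatrix : Continuous (torusMatrix p q) := by
  refine continuous_matrix fun i j => ?_
  rcases i with i | i <;> rcases j with j | j <;> simp only [torusMatrix, of_apply]
  · split_ifs <;> fun_prop
  · split_ifs <;> fun_prop
  · split_ifs <;> fun_prop
  · split_ifs <;> fun_prop

variable (F : Type) [NormedDivisionRing F] [StarRing F] [NormedAlgebra ℝ F] [HurwitzField F]

theorem torusMatrix_map_mem_unitary (hqp : q ≤ p) (x : Fin q → ℝ) :
    (torusMatrix p q x).map (algebraMap ℝ F) ∈ unitary (Matrix (Fin q ⊕ Fin p) (Fin q ⊕ Fin p) F) := by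
  apply mem_unitary_of_conjTranspose_mul
  have : ((torusMatrix p q x).map (algebraMap ℝ F))ᴴ =
      (torusMatrix p q x)ᵀ.map (algebraMap ℝ F) := by
    ext i j
    simp [HurwitzField.star_algebraMap]
  rw [this, ← Matrix.map_mul, torusMatrix_transpose_mul hqp]
  simp

variable {F}

theorem realDiagonal_conjTranspose {m : Type} [DecidableEq m] (a : m → ℝ) :
    (realDiagonal F a)ᴴ = realDiagonal F a := by
  rw [diagonal_conjTranspose]
  exact congrArg diagonal (funext fun i => HurwitzField.star_algebraMap (a i))

theorem fromBlocks_diagonal_mem_unitary {m n : Type} [Fintype m] [Fintype n] [DecidableEq m]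
    [DecidableEq n] {A : Matrix m m F} {D : Matrix n n F} (hA : A ∈ unitary (Matrix m m F))
    (hD : D ∈ unitary (Matrix n n F)) :
    fromBlocks A 0 0 D ∈ unitary (Matrix (m ⊕ n) (m ⊕ n) F) := by
  apply mem_unitary_of_conjTranspose_mul
  rw [fromBlocks_conjTranspose, fromBlocks_multiply]
  simp [show Aᴴ * A = 1 from (Unitary.mem_iff.1 hA).1,
    show Dᴴ * D = 1 from (Unitary.mem_iff.1 hD).1]

/-- The decomposition `U(p+q) = (U(q) × U(p)) A (U(q) × U(p))` over `ℝ`, `ℂ` and `ℍ`. -/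
theorem exists_blocks_mul_torusMatrix_mul_blocks (hqp : q ≤ p)
    {g : Matrix (Fin q ⊕ Fin p) (Fin q ⊕ Fin p) F}
    (hg : g ∈ unitary (Matrix (Fin q ⊕ Fin p) (Fin q ⊕ Fin p) F)) :
    ∃ x ∈ alcove q, ∃ k₁ ∈ unitary (Matrix (Fin q) (Fin q) F),
      ∃ k₂ ∈ unitary (Matrix (Fin p) (Fin p) F), ∃ l₁ ∈ unitary (Matrix (Fin q) (Fin q) F),
      ∃ l₂ ∈ unitary (Matrix (Fin p) (Fin p) F),
      g = fromBlocks k₁ 0 0 k₂ * (torusMatrix p q x).map (algebraMap ℝ F) *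
        fromBlocks l₁ 0 0 l₂ := by
  -- Diagonalizing the upper left block gives the cosines. Unitarity then makes the columns of the
  -- block below orthogonal with squared norms `1 - a i ^ 2`, so a further unitary matrix turns that
  -- block into the sines.
  obtain ⟨u, hu, u', hu', a, ha, ha0, hA⟩ :=
    exists_unitary_mul_mul_eq_realDiagonal g.toBlocks₁₁
  have hu1 : fromBlocks u 0 0 1 ∈ unitary (Matrix (Fin q ⊕ Fin p) (Fin q ⊕ Fin p) F) :=
    fromBlocks_diagonal_mem_unitary hu (one_mem _)
  have hu1' : fromBlocks u' 0 0 1 ∈ unitary (Matrix (Fin q ⊕ Fin p) (Fin q ⊕ Fin p) F) :=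
    fromBlocks_diagonal_mem_unitary hu' (one_mem _)
  set C := g.toBlocks₂₁ * u' with hC
  obtain ⟨B', D', hg1⟩ : ∃ B' D', fromBlocks u 0 0 1 * g * fromBlocks u' 0 0 1 =
      fromBlocks (realDiagonal F a) B' C D' := by
    refine ⟨u * g.toBlocks₁₂, g.toBlocks₂₂, ?_⟩
    rw [← fromBlocks_toBlocks g, fromBlocks_multiply, fromBlocks_multiply]
    simp only [Matrix.zero_mul, Matrix.one_mul, Matrix.mul_zero, Matrix.mul_one, add_zero,
      zero_add, hC, toBlocks_fromBlocks₁₂, toBlocks_fromBlocks₂₂, hA]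
  have hg1u := mul_mem (mul_mem hu1 hg) hu1'
  rw [hg1] at hg1u
  have hcol : realDiagonal F (fun i => a i ^ 2) + Cᴴ * C = 1 := by
    have h := (Unitary.mem_iff.1 hg1u).1
    rw [star_eq_conjTranspose, fromBlocks_conjTranspose, fromBlocks_multiply, ← fromBlocks_one] at h
    have h1 := (fromBlocks_inj.1 h).1
    rw [← h1, realDiagonal_conjTranspose, diagonal_mul_diagonal]
    simp_rw [← map_mul, ← sq]
  have hCC : Cᴴ * C = realDiagonal F fun i => 1 - a i ^ 2 := by
    rw [eq_sub_of_add_eq' hcol]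
    ext i j
    rcases eq_or_ne i j with rfl | h
    · rw [Matrix.sub_apply, realDiagonal_apply_self, realDiagonal_apply_self, one_apply_eq, map_sub,
        map_one]
    · rw [Matrix.sub_apply, realDiagonal_apply_ne _ h, realDiagonal_apply_ne _ h, one_apply_ne h, sub_zero]
  have ha1 : ∀ i, a i ≤ 1 := by
    intro i
    have h := conjTranspose_mul_self_apply_self C i
    rw [hCC, realDiagonal_apply_self] at h
    have h2 : (0 : ℝ) ≤ ∑ k, ‖C k i‖ ^ 2 := Finset.sum_nonneg fun _ _ => by positivity
    rw [← (algebraMap ℝ F).injective h] at h2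
    nlinarith [ha0 i]
  -- The singular values were sorted increasingly because `arccos` reverses the order and the alcove
  -- consists of decreasing tuples.
  set x : Fin q → ℝ := fun i => Real.arccos (a i) with hx
  have hcos : ∀ i, Real.cos (x i) = a i := fun i =>
    Real.cos_arccos (by linarith [ha0 i]) (ha1 i)
  have hxA : x ∈ alcove q :=
    ⟨fun i => ⟨Real.arccos_nonneg _, Real.arccos_le_pi_div_two.2 (ha0 i)⟩,
      fun i j hij => Real.arccos_le_arccos (ha hij)⟩
  obtain ⟨v, hv, hvC⟩ := exists_unitary_mul_eq_of_orthogonal_columns hqp C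
    (s := fun i => Real.sin (x i))
    (fun i j hij => Real.sin_le_sin_of_le_of_le_pi_div_two
      (by linarith [(hxA.1 j).1, Real.pi_pos]) (hxA.1 i).2 (hxA.2 hij))
    (fun i => Real.sin_nonneg_of_nonneg_of_le_pi (hxA.1 i).1
      (by linarith [(hxA.1 i).2, Real.pi_pos]))
    (by
      rw [hCC]
      congr 2
      ext i
      rw [Real.sin_sq, hcos])
  set T := (torusMatrix p q x).map (algebraMap ℝ F) with hT
  have hTu : T ∈ unitary _ := torusMatrix_map_mem_unitary F hqp x
  have hv1 : fromBlocks 1 0 0 v ∈ unitary (Matrix (Fin q ⊕ Fin p) (Fin q ⊕ Fin p) F) :=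
    fromBlocks_diagonal_mem_unitary (one_mem _) hv
  set g2 := fromBlocks 1 0 0 v * fromBlocks (realDiagonal F a) B' C D' with hg2
  have hg2u : g2 ∈ unitary _ := mul_mem hv1 hg1u
  have hT1 : T.toBlocks₁₁ = realDiagonal F a := by
    ext i j
    rcases eq_or_ne i j with rfl | h
    · simp [hT, toBlocks₁₁, torusMatrix, hcos]
    · simp [hT, toBlocks₁₁, torusMatrix, h]
  have hT2 : T.toBlocks₂₁ = v * C := by
    rw [hvC]
    ext i j
    by_cases h : (i : ℕ) = j
    · simp [hT, toBlocks₂₁, torusMatrix, h]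
    · simp [hT, toBlocks₂₁, torusMatrix, h, Ne.symm h]
  have hg2' : g2 = fromBlocks T.toBlocks₁₁ B' T.toBlocks₂₁ (v * D') := by
    rw [hg2, fromBlocks_multiply, hT1, hT2]
    simp
  have hTT : Tᴴ * T = 1 := (Unitary.mem_iff.1 hTu).1
  -- `g2` and `T` share their first block column, so `Tᴴ * g2` has first block column `(1, 0)`;
  -- being unitary, it must be block diagonal.
  obtain ⟨B, D, hH⟩ : ∃ B D, Tᴴ * g2 = fromBlocks 1 B 0 D := by
    have h := hTT
    rw [← fromBlocks_toBlocks T, fromBlocks_conjTranspose, fromBlocks_multiply,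
      ← fromBlocks_one] at h
    obtain ⟨h1, -, h2, -⟩ := fromBlocks_inj.1 h
    refine ⟨T.toBlocks₁₁ᴴ * B' + T.toBlocks₂₁ᴴ * (v * D'),
      T.toBlocks₁₂ᴴ * B' + T.toBlocks₂₂ᴴ * (v * D'), ?_⟩
    rw [hg2', ← fromBlocks_toBlocks T, fromBlocks_conjTranspose, fromBlocks_multiply]
    simp only [toBlocks_fromBlocks₁₁, toBlocks_fromBlocks₂₁, toBlocks_fromBlocks₁₂,
      toBlocks_fromBlocks₂₂, h1, h2]
  have hHu : fromBlocks 1 B 0 D ∈ unitary (Matrix (Fin q ⊕ Fin p) (Fin q ⊕ Fin p) F) := by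
    rw [← hH]
    exact mul_mem (Unitary.star_mem hTu) hg2u
  have h3 := (Unitary.mem_iff.1 hHu).1
  rw [star_eq_conjTranspose, fromBlocks_conjTranspose, fromBlocks_multiply, ← fromBlocks_one] at h3
  obtain ⟨-, h4, -, h5⟩ := fromBlocks_inj.1 h3
  have hB : B = 0 := by simpa using h4
  have hD : D ∈ unitary (Matrix (Fin p) (Fin p) F) := by
    apply mem_unitary_of_conjTranspose_mul
    simpa [hB] using h5
  have hg2T : g2 = T * fromBlocks 1 0 0 D := by
    rw [← hB, ← hH, ← Matrix.mul_assoc, show T * Tᴴ = 1 from (Unitary.mem_iff.1 hTu).2,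
      Matrix.one_mul]
  refine ⟨x, hxA, star u, Unitary.star_mem hu, star v, Unitary.star_mem hv, star u',
    Unitary.star_mem hu', D, hD, ?_⟩
  have e1 : fromBlocks (star u) 0 0 (star v) * fromBlocks 1 0 0 v * fromBlocks u 0 0 1 =
      (1 : Matrix (Fin q ⊕ Fin p) (Fin q ⊕ Fin p) F) := by
    rw [fromBlocks_multiply, fromBlocks_multiply]
    simp [(Unitary.mem_iff.1 hu).1, (Unitary.mem_iff.1 hv).1]
  have e2 : fromBlocks u' 0 0 1 * fromBlocks (star u') 0 0 1 =
      (1 : Matrix (Fin q ⊕ Fin p) (Fin q ⊕ Fin p) F) := by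
    rw [fromBlocks_multiply]
    simp [(Unitary.mem_iff.1 hu').2]
  have e3 : fromBlocks (star u') 0 0 D = fromBlocks 1 0 0 D * fromBlocks (star u') 0 0 1 := by
    rw [fromBlocks_multiply]
    simp
  calc g = fromBlocks (star u) 0 0 (star v) * fromBlocks 1 0 0 v * fromBlocks u 0 0 1 * g *
        (fromBlocks u' 0 0 1 * fromBlocks (star u') 0 0 1) := by
        rw [e1, e2, Matrix.one_mul, Matrix.mul_one]
    _ = fromBlocks (star u) 0 0 (star v) * g2 * fromBlocks (star u') 0 0 1 := by
        rw [hg2, ← hg1]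
        simp only [Matrix.mul_assoc]
    _ = _ := by
        rw [hg2T, e3, ← hT]
        simp only [Matrix.mul_assoc]

end Torus
end

noncomputable section
open HurwitzField Matrix

/-! ### The decomposition `G = K A₀ K` with determinant conditions -/

section CartanDecomposition

variable {p q : ℕ}

/-- The torus matrix couples an index only with the index of the same number in the other block, and
`δ` takes equal values on both. Such diagonal matrices therefore centralize the torus and can be
moved from one `K`-factor to the other. -/
theorem diagonal_mul_torusMatrix_map {F : Type} [NormedDivisionRing F] [NormedAlgebra ℝ F]
    (δ : ℕ → F) (x : Fin q → ℝ) :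
    fromBlocks (diagonal fun i : Fin q => δ i) 0 0 (diagonal fun i : Fin p => δ i) *
        (torusMatrix p q x).map (algebraMap ℝ F) =
      (torusMatrix p q x).map (algebraMap ℝ F) *
        fromBlocks (diagonal fun i : Fin q => δ i) 0 0 (diagonal fun i : Fin p => δ i) := by
  rw [fromBlocks_diagonal]
  ext i j
  rw [diagonal_mul, mul_diagonal, map_apply, ← Algebra.commutes]
  have h0 : ∀ r : ℝ, ∀ a b : F, (r ≠ 0 → a = b) → algebraMap ℝ F r * a = algebraMap ℝ F r * b := by
    intro r a b h
    rcases eq_or_ne r 0 with rfl | hr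
    · simp
    · rw [h hr]
  apply h0
  rcases i with i | i <;> rcases j with j | j <;> simp only [torusMatrix, of_apply]
  · split_ifs with h
    · simp [h]
    · simp
  · split_ifs with h
    · simp [h]
    · simp
  · split_ifs with h
    · simp [h]
    · simp
  · split_ifs with h
    · simp [h]
    · simp [h]
    · simp

/-- A factorization `k a l` may be replaced by `(k m) a (m⁻¹ l)` with `m` a diagonal unitary matrix
centralizing the torus. Choosing `det m = (det k)⁻¹` normalizes the first factor, and the
determinant of the last one is then forced to be one. -/
theorem exists_blocks_mul_torusMatrix_mul_blocks_of_det {F : Type} [NormedField F] [StarRing F]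
    [NormedAlgebra ℝ F] [HurwitzField F] (hq : 1 ≤ q) (hqp : q ≤ p)
    (h : q < p ∨ ∀ c : F, ∃ z, z ^ 2 = c) {g : Matrix (Fin q ⊕ Fin p) (Fin q ⊕ Fin p) F}
    (hg : g ∈ unitary (Matrix (Fin q ⊕ Fin p) (Fin q ⊕ Fin p) F)) (hdet : g.det = 1) :
    ∃ x ∈ alcove q, ∃ k₁ ∈ unitary (Matrix (Fin q) (Fin q) F),
      ∃ k₂ ∈ unitary (Matrix (Fin p) (Fin p) F), ∃ l₁ ∈ unitary (Matrix (Fin q) (Fin q) F),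
      ∃ l₂ ∈ unitary (Matrix (Fin p) (Fin p) F), (fromBlocks k₁ 0 0 k₂).det = 1 ∧
      (fromBlocks l₁ 0 0 l₂).det = 1 ∧
      g = fromBlocks k₁ 0 0 k₂ * (torusMatrix p q x).map (algebraMap ℝ F) *
        fromBlocks l₁ 0 0 l₂ := by
  obtain ⟨x, hx, k₁, hk₁, k₂, hk₂, l₁, hl₁, l₂, hl₂, hgk⟩ :=
    exists_blocks_mul_torusMatrix_mul_blocks hqp hg
  set k := fromBlocks k₁ 0 0 k₂ with hk
  set l := fromBlocks l₁ 0 0 l₂ with hl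
  set T := (torusMatrix p q x).map (algebraMap ℝ F) with hT
  have hTdet : T.det = 1 := by
    have : T.det = algebraMap ℝ F (torusMatrix p q x).det :=
      ((algebraMap ℝ F).map_det (torusMatrix p q x)).symm
    rw [this, det_torusMatrix hqp, map_one]
  have hku : k ∈ unitary _ := fromBlocks_diagonal_mem_unitary hk₁ hk₂
  have hnk : ‖k.det‖ = 1 := by
    have h1 := congrArg det (Unitary.mem_iff.1 hku).1
    rw [star_eq_conjTranspose, det_mul, det_conjTranspose, det_one,
      HurwitzField.star_mul_self, ← map_one (algebraMap ℝ F)] at h1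
    exact (pow_eq_one_iff_of_nonneg (norm_nonneg _) two_ne_zero).1 ((algebraMap ℝ F).injective h1)
  have hk0 : k.det ≠ 0 := norm_ne_zero_iff.1 (by rw [hnk]; exact one_ne_zero)
  obtain ⟨δ, hδ, hδdet⟩ : ∃ δ : ℕ → F, (∀ i, star (δ i) * δ i = 1) ∧
      (∏ i : Fin q, δ i) * ∏ i : Fin p, δ i = (k.det)⁻¹ := by
    have hstar : ∀ (n : ℕ) (z : F), ‖z‖ = 1 → ∀ i,
        star (Function.update (fun _ => (1 : F)) n z i) *
          Function.update (fun _ => (1 : F)) n z i = 1 := by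
      intro n z hz i
      rcases eq_or_ne i n with rfl | hi
      · rw [Function.update_self, HurwitzField.star_mul_self, hz, one_pow, map_one]
      · simp [hi]
    have hprod : ∀ (m n : ℕ) (z : F), (∏ i : Fin m, Function.update (fun _ => (1 : F)) n z i) =
        if n < m then z else 1 := by
      intro m n z
      rw [Finset.prod_fin_eq_prod_range, Finset.prod_congr rfl
        (g := fun i => if i = n then z else 1)]
      · simp
      · intro i hi
        simp [Finset.mem_range.1 hi, Function.update_apply]
    -- If `q < p`, the entry number `q` occurs only in the second block and can carry the whole
    -- determinant. If `q = p`, every entry occurs twice, so a square root is needed.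
    rcases hqp.lt_or_eq with hlt | heq
    · refine ⟨Function.update (fun _ => 1) q (k.det)⁻¹, hstar _ _ (by rw [norm_inv, hnk, inv_one]), ?_⟩
      rw [hprod, hprod, if_neg (lt_irrefl q), if_pos hlt, one_mul]
    · obtain ⟨z, hz⟩ := (h.resolve_left (by omega)) (k.det)⁻¹
      have hz1 : ‖z‖ = 1 := by
        have := congrArg norm hz
        rw [norm_pow, norm_inv, hnk, inv_one] at this
        exact (pow_eq_one_iff_of_nonneg (norm_nonneg _) two_ne_zero).1 this
      refine ⟨Function.update (fun _ => 1) 0 z, hstar _ _ hz1, ?_⟩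
      rw [hprod, hprod, if_pos (by omega), if_pos (by omega), ← sq, hz]
  have hdiag : ∀ n : ℕ, diagonal (fun i : Fin n => δ i) ∈ unitary (Matrix (Fin n) (Fin n) F) := by
    intro n
    apply mem_unitary_of_conjTranspose_mul
    rw [diagonal_conjTranspose, diagonal_mul_diagonal, ← diagonal_one]
    exact congrArg diagonal (funext fun i => hδ i)
  set m := fromBlocks (diagonal fun i : Fin q => δ i) 0 0 (diagonal fun i : Fin p => δ i) with hm
  have hmdet : m.det = (k.det)⁻¹ := by
    rw [hm, det_fromBlocks_zero₂₁, det_diagonal, det_diagonal, hδdet]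
  have hmu : m ∈ unitary _ := fromBlocks_diagonal_mem_unitary (hdiag q) (hdiag p)
  have hkm : fromBlocks (k₁ * diagonal fun i : Fin q => δ i) 0 0
      (k₂ * diagonal fun i : Fin p => δ i) = k * m := by
    rw [hk, hm, fromBlocks_multiply]
    simp
  have hml : fromBlocks (star (diagonal fun i : Fin q => δ i) * l₁) 0 0
      (star (diagonal fun i : Fin p => δ i) * l₂) = star m * l := by
    rw [hl, hm, star_eq_conjTranspose (fromBlocks _ _ _ _), fromBlocks_conjTranspose, fromBlocks_multiply]
    simp [star_eq_conjTranspose]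
  have hg' : g = k * m * T * (star m * l) := by
    rw [hgk]
    have : k * m * T * (star m * l) = k * (m * T) * star m * l := by simp only [Matrix.mul_assoc]
    rw [this, diagonal_mul_torusMatrix_map]
    have : k * (T * m) * star m * l = k * T * (m * star m) * l := by simp only [Matrix.mul_assoc]
    rw [this, (Unitary.mem_iff.1 hmu).2, Matrix.mul_one]
  have hkm1 : (k * m).det = 1 := by rw [det_mul, hmdet, mul_inv_cancel₀ hk0]
  refine ⟨x, hx, _, mul_mem hk₁ (hdiag q), _, mul_mem hk₂ (hdiag p), _,
    mul_mem (Unitary.star_mem (hdiag q)) hl₁, _, mul_mem (Unitary.star_mem (hdiag p)) hl₂,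
    ?_, ?_, ?_⟩
  · rw [hkm, hkm1]
  · rw [hml]
    have h1 := congrArg det hg'
    rwa [det_mul, det_mul (k * m), hkm1, hTdet, hdet, one_mul, one_mul, eq_comm] at h1
  · rw [hkm, hml]
    exact hg'

variable {𝔽 : BaseField}

theorem BaseField.exists_blocks_mul_torusMatrix_mul_blocks (hq : 1 ≤ q) (hqp : q ≤ p)
    (hreal : 𝔽 = BaseField.real → q < p)
    {g : Matrix (Fin q ⊕ Fin p) (Fin q ⊕ Fin p) 𝔽.Carrier}
    (hg : g ∈ unitary (Matrix (Fin q ⊕ Fin p) (Fin q ⊕ Fin p) 𝔽.Carrier)) (hdet : 𝔽.DetOne g) :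
    ∃ x ∈ alcove q, ∃ k₁ ∈ unitary (Matrix (Fin q) (Fin q) 𝔽.Carrier),
      ∃ k₂ ∈ unitary (Matrix (Fin p) (Fin p) 𝔽.Carrier),
      ∃ l₁ ∈ unitary (Matrix (Fin q) (Fin q) 𝔽.Carrier),
      ∃ l₂ ∈ unitary (Matrix (Fin p) (Fin p) 𝔽.Carrier), 𝔽.DetOne (fromBlocks k₁ 0 0 k₂) ∧
      𝔽.DetOne (fromBlocks l₁ 0 0 l₂) ∧
      g = fromBlocks k₁ 0 0 k₂ * (torusMatrix p q x).map (algebraMap ℝ 𝔽.Carrier) *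
        fromBlocks l₁ 0 0 l₂ := by
  obtain ⟨x, hx, k₁, hk₁, k₂, hk₂, l₁, hl₁, l₂, hl₂, h⟩ :=
    _root_.exists_blocks_mul_torusMatrix_mul_blocks hqp hg
  cases 𝔽 with
  | real =>
    let _ : HurwitzField ℝ := BaseField.hurwitzField BaseField.real
    exact exists_blocks_mul_torusMatrix_mul_blocks_of_det (F := ℝ) hq hqp (Or.inl (hreal rfl))
      hg hdet
  | complex =>
    let _ : HurwitzField ℂ := BaseField.hurwitzField BaseField.complex
    exact exists_blocks_mul_torusMatrix_mul_blocks_of_det (F := ℂ) hq hqp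
      (Or.inr fun c => IsAlgClosed.exists_pow_nat_eq c two_pos)
      hg hdet
  | quaternion =>
    exact ⟨x, hx, k₁, hk₁, k₂, hk₂, l₁, hl₁, l₂, hl₂, trivial, trivial, h⟩

theorem BaseField.detOne_torusMatrix (hqp : q ≤ p) (x : Fin q → ℝ) :
    𝔽.DetOne ((torusMatrix p q x).map (algebraMap ℝ 𝔽.Carrier)) := by
  cases 𝔽 with
  | real =>
    exact ((algebraMap ℝ ℝ).map_det (torusMatrix p q x)).symm.trans
      ((congrArg _ (det_torusMatrix hqp x)).trans (map_one _))
  | complex =>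
    exact ((algebraMap ℝ ℂ).map_det (torusMatrix p q x)).symm.trans
      ((congrArg _ (det_torusMatrix hqp x)).trans (map_one _))
  | quaternion => exact trivial

/-- The element `a_x` of `G`. -/
def torusElement (𝔽 : BaseField) (hqp : q ≤ p) (x : Fin q → ℝ) : GrassmannG 𝔽 p q :=
  ⟨⟨(torusMatrix p q x).map (algebraMap ℝ 𝔽.Carrier),
    torusMatrix_map_mem_unitary 𝔽.Carrier hqp x⟩, BaseField.detOne_torusMatrix hqp x⟩

theorem torusElement_mat (hqp : q ≤ p) (x : Fin q → ℝ) :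
    (torusElement 𝔽 hqp x).mat = (torusMatrix p q x).map (algebraMap ℝ 𝔽.Carrier) := rfl

theorem continuous_torusElement (hqp : q ≤ p) :
    Continuous (torusElement 𝔽 hqp : (Fin q → ℝ) → GrassmannG 𝔽 p q) := by
  refine Continuous.subtype_mk (Continuous.subtype_mk ?_ _) _
  exact continuous_torusMatrix.matrix_map (continuous_algebraMap ℝ 𝔽.Carrier)

/-- The Cartan decomposition `G = K A₀ K`. -/
theorem exists_mem_grassmannK_mul_torusElement_mul (hq : 1 ≤ q) (hqp : q ≤ p)
    (hreal : 𝔽 = BaseField.real → q < p) (g : GrassmannG 𝔽 p q) :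
    ∃ x ∈ alcove q, ∃ k ∈ GrassmannK 𝔽 p q, ∃ l ∈ GrassmannK 𝔽 p q,
      g = k * torusElement 𝔽 hqp x * l := by
  obtain ⟨x, hx, k₁, hk₁, k₂, hk₂, l₁, hl₁, l₂, hl₂, hk, hl, h⟩ :=
    BaseField.exists_blocks_mul_torusMatrix_mul_blocks hq hqp hreal g.1.2 g.2
  refine ⟨x, hx, ⟨⟨_, fromBlocks_diagonal_mem_unitary hk₁ hk₂⟩, hk⟩, ?_,
    ⟨⟨_, fromBlocks_diagonal_mem_unitary hl₁ hl₂⟩, hl⟩, ?_, Subtype.ext (Subtype.ext h)⟩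
  · exact ⟨toBlocks_fromBlocks₁₂ _ _ _ _, toBlocks_fromBlocks₂₁ _ _ _ _⟩
  · exact ⟨toBlocks_fromBlocks₁₂ _ _ _ _, toBlocks_fromBlocks₂₁ _ _ _ _⟩

theorem BaseField.isClosed_detOne {m : Type} [Fintype m] [DecidableEq m] :
    IsClosed {M : Matrix m m 𝔽.Carrier | 𝔽.DetOne M} := by
  cases 𝔽 with
  | real =>
    have h : IsClosed {M : Matrix m m ℝ | M.det = 1} :=
      isClosed_eq continuous_id.matrix_det continuous_const
    exact h
  | complex =>
    have h : IsClosed {M : Matrix m m ℂ | M.det = 1} :=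
      isClosed_eq continuous_id.matrix_det continuous_const
    exact h
  | quaternion => exact isClosed_univ

instance (𝔽 : BaseField) (m : Type) [Fintype m] [DecidableEq m] : CompactSpace (𝔽.SU m) := by
  have h1 : CompactSpace (unitary (Matrix m m 𝔽.Carrier)) :=
    isCompact_iff_compactSpace.1 isCompact_unitary
  have h2 : IsClosed (𝔽.SU m : Set (unitary (Matrix m m 𝔽.Carrier))) :=
    BaseField.isClosed_detOne.preimage continuous_subtype_val
  exact isCompact_iff_compactSpace.1 h2.isCompact

end CartanDecomposition
end

noncomputable section

theorem norm_sum_sq_of_pairwise_inner_eq_zero {E ι : Type*} [NormedAddCommGroup E]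
    [InnerProductSpace ℂ E] (s : Finset ι) (x : ι → E)
    (h : ∀ i j, i ≠ j → inner ℂ (x i) (x j) = 0) : ‖∑ i ∈ s, x i‖ ^ 2 = ∑ i ∈ s, ‖x i‖ ^ 2 := by
  classical
  induction s using Finset.induction_on with
  | empty => simp
  | insert i s hi ih =>
    have h0 : inner ℂ (x i) (∑ j ∈ s, x j) = 0 := by
      rw [inner_sum]
      exact Finset.sum_eq_zero fun j hj => h i j fun h' => hi (h' ▸ hj)
    rw [Finset.sum_insert hi, Finset.sum_insert hi, ← ih, sq, sq, sq]
    exact norm_add_sq_eq_norm_sq_add_norm_sq_of_inner_eq_zero _ _ h0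

/-! ### Schur's lemma, isotypic components and complete reducibility -/

namespace UnitaryRep

variable {G : Type} [Group G] [TopologicalSpace G] {V V' V'' : UnitaryRep G}

/-- The linear map `T` commutes with the group actions. -/
def Intertwines (V V' : UnitaryRep G) (T : V.H →ₗ[ℂ] V'.H) : Prop :=
  ∀ g v, T (V.ρ g v) = V'.ρ g (T v)

theorem inner_ρ_ρ (V : UnitaryRep G) (g : G) (v w : V.H) :
    inner ℂ (V.ρ g v) (V.ρ g w) = inner ℂ v w := (V.ρ g).inner_map_map v w

theorem ρ_mul_apply (V : UnitaryRep G) (g h : G) (v : V.H) :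
    V.ρ (g * h) v = V.ρ g (V.ρ h v) := by rw [map_mul]; rfl

theorem ρ_inv_apply_ρ (V : UnitaryRep G) (g : G) (v : V.H) : V.ρ g⁻¹ (V.ρ g v) = v := by
  rw [← ρ_mul_apply, inv_mul_cancel, map_one]; rfl

theorem ρ_apply_ρ_inv (V : UnitaryRep G) (g : G) (v : V.H) : V.ρ g (V.ρ g⁻¹ v) = v := by
  rw [← ρ_mul_apply, mul_inv_cancel, map_one]; rfl

theorem inner_ρ_left (V : UnitaryRep G) (g : G) (v w : V.H) :
    inner ℂ (V.ρ g v) w = inner ℂ v (V.ρ g⁻¹ w) := by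
  rw [← inner_ρ_ρ V g v, ρ_apply_ρ_inv]

theorem Intertwines.comp {T : V.H →ₗ[ℂ] V'.H} {S : V'.H →ₗ[ℂ] V''.H} (hS : Intertwines V' V'' S)
    (hT : Intertwines V V' T) : Intertwines V V'' (S ∘ₗ T) := by
  intro g v
  rw [LinearMap.comp_apply, hT, hS, LinearMap.comp_apply]

theorem Intertwines.adjoint {T : V.H →ₗ[ℂ] V'.H} (hT : Intertwines V V' T) :
    Intertwines V' V (LinearMap.adjoint T) := by
  intro g w
  refine ext_inner_right ℂ fun v => ?_
  rw [LinearMap.adjoint_inner_left, inner_ρ_left, inner_ρ_left, LinearMap.adjoint_inner_left, hT]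

theorem Intertwines.invariant_range {T : V.H →ₗ[ℂ] V'.H} (hT : Intertwines V V' T) :
    V'.Invariant (LinearMap.range T) := by
  rintro g _ ⟨v, rfl⟩
  exact ⟨V.ρ g v, hT g v⟩

theorem Invariant.orthogonal {W : Submodule ℂ V.H} (hW : V.Invariant W) : V.Invariant Wᗮ := by
  intro g v hv w hw
  rw [← inner_conj_symm, inner_ρ_left, inner_conj_symm]
  exact hv _ (hW g⁻¹ w hw)

theorem Invariant.starProjection_ρ {W : Submodule ℂ V.H} (hW : V.Invariant W) (g : G) (v : V.H) :
    W.starProjection (V.ρ g v) = V.ρ g (W.starProjection v) := by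
  refine Submodule.eq_starProjection_of_mem_orthogonal
    (hW g _ (W.starProjection_apply_mem v)) ?_
  rw [← map_sub]
  exact hW.orthogonal g _ (W.sub_starProjection_mem_orthogonal v)

theorem Invariant.intertwines_starProjection {W : Submodule ℂ V.H} (hW : V.Invariant W) :
    Intertwines V V W.starProjection.toLinearMap := fun g v => hW.starProjection_ρ g v

theorem Invariant.starProjection_mem_fixed {W : Submodule ℂ V.H} (hW : V.Invariant W)
    {K : Subgroup G} {v : V.H} (hv : v ∈ V.fixed K) : W.starProjection v ∈ V.fixed K := by
  intro k hk
  rw [← hW.starProjection_ρ, hv k hk]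

/-- The representation on an invariant subspace. -/
def sub (V : UnitaryRep G) (W : Submodule ℂ V.H) (hW : V.Invariant W) : UnitaryRep G where
  H := W
  ρ :=
    { toFun := fun g =>
        { toFun := fun v => ⟨V.ρ g v, hW g v v.2⟩
          invFun := fun v => ⟨V.ρ g⁻¹ v, hW g⁻¹ v v.2⟩
          map_add' := fun v w => Subtype.ext (map_add _ _ _)
          map_smul' := fun c v => Subtype.ext (map_smul _ _ _)
          left_inv := fun v => Subtype.ext (V.ρ_inv_apply_ρ g v)
          right_inv := fun v => Subtype.ext (V.ρ_apply_ρ_inv g v)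
          norm_map' := fun v => (V.ρ g).norm_map v }
      map_one' := by
        ext v
        exact congrArg (fun f : V.H ≃ₗᵢ[ℂ] V.H => f v) V.ρ.map_one
      map_mul' := by
        intro g h
        ext v
        exact V.ρ_mul_apply g h v }
  continuous_apply := fun v => (V.continuous_apply v).subtype_mk _

theorem intertwines_subtype {W : Submodule ℂ V.H} (hW : V.Invariant W) :
    Intertwines (V.sub W hW) V W.subtype := fun _ _ => rfl

theorem IrreducibleSub.irreducible_sub {W : Submodule ℂ V.H} (hW : V.IrreducibleSub W) :
    (V.sub W hW.1).Irreducible := by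
  refine ⟨fun _ _ _ => Submodule.mem_top, ?_, ?_⟩
  · intro h
    apply hW.2.1
    rw [eq_bot_iff]
    intro v hv
    have : (⟨v, hv⟩ : W) ∈ (⊤ : Submodule ℂ W) := Submodule.mem_top
    rw [show (⊤ : Submodule ℂ W) = ⊥ from h] at this
    exact congrArg Subtype.val ((Submodule.mem_bot ℂ).1 this)
  · intro (U : Submodule ℂ W) _ hU
    have h := hW.2.2 (U.map W.subtype) (Submodule.map_subtype_le W U) (by
      rintro g _ ⟨v, hv, rfl⟩
      exact ⟨_, hU g v hv, rfl⟩)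
    rcases h with h | h
    · left
      exact Submodule.map_injective_of_injective W.subtype_injective (h.trans (Submodule.map_bot _).symm)
    · right
      refine (eq_top_iff (a := U)).2 ?_
      intro v _
      have h1 : W.subtype v ∈ U.map W.subtype := h.symm ▸ Subtype.property (p := (· ∈ W)) v
      obtain ⟨w, hw, hwv⟩ := h1
      rwa [← Subtype.ext hwv]

/-- Schur's lemma: an operator that commutes with an irreducible representation is scalar. -/
theorem Irreducible.exists_eq_smul (hV : V.Irreducible) {S : V.H →ₗ[ℂ] V.H}
    (hS : Intertwines V V S) : ∃ c : ℂ, ∀ v, S v = c • v := by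
  have : Nontrivial V.H := by
    by_contra h
    rw [not_nontrivial_iff_subsingleton] at h
    exact hV.2.1 (Subsingleton.elim _ _)
  obtain ⟨c, hc⟩ := Module.End.exists_eigenvalue S
  refine ⟨c, fun v => ?_⟩
  have h := hV.2.2 (Module.End.eigenspace S c) le_top (by
    intro g v hv
    rw [Module.End.mem_eigenspace_iff] at hv ⊢
    rw [hS, hv, map_smul])
  rcases h with h | h
  · exact absurd h hc
  · exact Module.End.mem_eigenspace_iff.1 (h ▸ Submodule.mem_top)

/-- An intertwining operator on an irreducible representation is a multiple of an isometry. -/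
theorem Irreducible.exists_norm_eq (hV : V.Irreducible) {T : V.H →ₗ[ℂ] V'.H}
    (hT : Intertwines V V' T) : ∃ c : ℝ, 0 ≤ c ∧ ∀ v, ‖T v‖ = c * ‖v‖ := by
  obtain ⟨c, hc⟩ := hV.exists_eq_smul (hT.adjoint.comp hT)
  refine ⟨Real.sqrt c.re, Real.sqrt_nonneg _, fun v => ?_⟩
  have h1 : ‖T v‖ ^ 2 = c.re * ‖v‖ ^ 2 := by
    have h2 : inner ℂ v ((LinearMap.adjoint T ∘ₗ T) v) = ((‖T v‖ ^ 2 : ℝ) : ℂ) := by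
      rw [LinearMap.comp_apply, LinearMap.adjoint_inner_right, inner_self_eq_norm_sq_to_K]
      norm_cast
    rw [hc, inner_smul_right, inner_self_eq_norm_sq_to_K] at h2
    have h3 := congrArg Complex.re h2
    rw [Complex.ofReal_re] at h3
    have h4 : (c * (‖v‖ : ℂ) ^ 2).re = c.re * ‖v‖ ^ 2 := by
      rw [← Complex.ofReal_pow, Complex.re_mul_ofReal]
    exact h3.symm.trans h4
  rcases eq_or_ne v 0 with rfl | hv
  · simp
  · have hc0 : 0 ≤ c.re := by
      have : 0 < ‖v‖ ^ 2 := by positivity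
      by_contra! hneg
      nlinarith [sq_nonneg ‖T v‖]
    rw [← Real.sqrt_sq (norm_nonneg (T v)), h1, Real.sqrt_mul hc0, Real.sqrt_sq (norm_nonneg v)]

/-- A nonzero intertwining operator scales norms by a positive constant; dividing by it gives the
required isometry. -/
theorem Irreducible.equivSub_range (hV : V.Irreducible) {T : V.H →ₗ[ℂ] V'.H}
    (hT : Intertwines V V' T) (h0 : T ≠ 0) : V'.EquivSub (LinearMap.range T) V := by
  obtain ⟨c, hc0, hc⟩ := hV.exists_norm_eq hT
  have hc1 : c ≠ 0 := by
    rintro rfl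
    apply h0
    ext v
    simpa using hc v
  have hc2 : ((c⁻¹ : ℝ) : ℂ) ≠ 0 := by exact_mod_cast inv_ne_zero hc1
  refine ⟨⟨((c⁻¹ : ℝ) : ℂ) • T, fun v => ?_⟩, fun g v => ?_, ?_⟩
  · rw [LinearMap.smul_apply, norm_smul, hc, Complex.norm_real, Real.norm_of_nonneg (by positivity),
      inv_mul_cancel_left₀ hc1]
  · change ((c⁻¹ : ℝ) : ℂ) • T (V.ρ g v) = V'.ρ g (((c⁻¹ : ℝ) : ℂ) • T v)
    rw [hT, map_smul]
  · exact LinearMap.range_smul T _ hc2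

theorem Irreducible.range_le_isotypic (hV : V.Irreducible) {T : V.H →ₗ[ℂ] V'.H}
    (hT : Intertwines V V' T) : LinearMap.range T ≤ V'.isotypic V := by
  rcases eq_or_ne T 0 with rfl | h0
  · simp
  · exact le_sSup (hV.equivSub_range hT h0)

theorem EquivSub.invariant {W : Submodule ℂ V.H} (h : V.EquivSub W V') : V.Invariant W := by
  obtain ⟨f, hf, rfl⟩ := h
  exact Intertwines.invariant_range (T := f.toLinearMap) hf

/-- The projections to isotypic components commute with isometric intertwining operators. -/
theorem Irreducible.starProjection_isotypic_map (hV : V.Irreducible) (f : V'.H →ₗᵢ[ℂ] V''.H)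
    (hf : Intertwines V' V'' f.toLinearMap) (x : V'.H) :
    (V''.isotypic V).starProjection (f x) = f ((V'.isotypic V).starProjection x) := by
  refine Submodule.eq_starProjection_of_mem_orthogonal ?_ ?_
  · have hle : V'.isotypic V ≤ (V''.isotypic V).comap f.toLinearMap := by
      apply sSup_le
      rintro _ ⟨h, hh, rfl⟩
      rintro _ ⟨v, rfl⟩
      exact hV.range_le_isotypic (T := f.toLinearMap ∘ₗ h.toLinearMap)
        (hf.comp (T := h.toLinearMap) hh) ⟨v, rfl⟩
    exact hle (Submodule.starProjection_apply_mem _ x)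
  · rw [← map_sub]
    set z := x - (V'.isotypic V).starProjection x
    have hz : z ∈ (V'.isotypic V)ᗮ := Submodule.sub_starProjection_mem_orthogonal x
    -- A copy of `V` in `V''` is pulled back by the adjoint of `f` into the isotypic component of
    -- `V'`, to which `z` is orthogonal.
    have hle : V''.isotypic V ≤ (Submodule.span ℂ {f z})ᗮ := by
      apply sSup_le
      rintro _ ⟨h, hh, rfl⟩
      rintro _ ⟨v, rfl⟩
      rw [Submodule.mem_orthogonal_singleton_iff_inner_left]
      change inner ℂ (h.toLinearMap v) (f.toLinearMap z) = 0
      rw [← LinearMap.adjoint_inner_left]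
      exact hz _ (hV.range_le_isotypic (T := LinearMap.adjoint f.toLinearMap ∘ₗ h.toLinearMap)
        (hf.adjoint.comp (T := h.toLinearMap) hh) ⟨v, rfl⟩)
    intro w hw
    exact (Submodule.mem_orthogonal_singleton_iff_inner_left).1 (hle hw)

section Decomposition

variable {ι : Type*} [Fintype ι] {W : ι → Submodule ℂ V.H}

theorem IsDecomposition.sum_starProjection (hW : V.IsDecomposition W) (v : V.H) :
    ∑ i, (W i).starProjection v = v := by
  have h : OrthogonalFamily ℂ (fun i => W i) fun i => (W i).subtypeₗᵢ :=
    OrthogonalFamily.of_pairwise fun i j hij => hW.orthogonal i j hij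
  exact h.sum_projection_of_mem_iSup v (by rw [hW.iSup_eq_top]; exact Submodule.mem_top)

theorem IsDecomposition.inner_eq_zero (hW : V.IsDecomposition W) {i j : ι} (hij : i ≠ j)
    {v w : V.H} (hv : v ∈ W i) (hw : w ∈ W j) : inner ℂ v w = 0 :=
  Submodule.isOrtho_iff_inner_eq.1 (hW.orthogonal i j hij) v hv w hw

open Classical in
-- Each component either lies in the isotypic component or is orthogonal to it: projecting a copy of
-- `V'` to an irreducible `W i` gives zero or an equivalence of `V'` with `W i`.
theorem IsDecomposition.starProjection_isotypic (hW : V.IsDecomposition W) (hV' : V'.Irreducible)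
    (v : V.H) : (V.isotypic V').starProjection v =
      ∑ i with V.EquivSub (W i) V', (W i).starProjection v := by
  nth_rewrite 1 [← hW.sum_starProjection v]
  rw [map_sum, Finset.sum_filter]
  refine Finset.sum_congr rfl fun i _ => ?_
  have hmem := (W i).starProjection_apply_mem v
  split_ifs with h
  · exact Submodule.starProjection_eq_self_iff.2 (le_sSup (a := W i) h hmem)
  · rw [Submodule.starProjection_apply_eq_zero_iff]
    have hle : V.isotypic V' ≤ (W i)ᗮ := by
      apply sSup_le
      rintro _ ⟨f, hf, rfl⟩
      have hT : Intertwines V' V ((W i).starProjection.toLinearMap ∘ₗ f.toLinearMap) :=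
        (hW.irreducible i).1.intertwines_starProjection.comp (T := f.toLinearMap) hf
      have hT0 : (W i).starProjection.toLinearMap ∘ₗ f.toLinearMap = 0 := by
        by_contra h0
        apply h
        have hle : LinearMap.range ((W i).starProjection.toLinearMap ∘ₗ f.toLinearMap) ≤ W i := by
          rintro _ ⟨x, rfl⟩
          exact (W i).starProjection_apply_mem _
        rcases (hW.irreducible i).2.2 _ hle hT.invariant_range with h1 | h1
        · exact absurd (LinearMap.range_eq_bot.1 h1) h0
        · rw [← h1]
          exact hV'.equivSub_range hT h0
      rintro _ ⟨x, rfl⟩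
      rw [← Submodule.starProjection_apply_eq_zero_iff]
      exact congrArg (fun T : V'.H →ₗ[ℂ] V.H => T x) hT0
    intro w hw
    exact Submodule.inner_left_of_mem_orthogonal hmem (hle hw)

open Classical in
theorem IsDecomposition.norm_sq_starProjection_isotypic (hW : V.IsDecomposition W)
    (hV' : V'.Irreducible) (v : V.H) : ‖(V.isotypic V').starProjection v‖ ^ 2 =
      ∑ i with V.EquivSub (W i) V', ‖(W i).starProjection v‖ ^ 2 := by
  rw [hW.starProjection_isotypic hV', norm_sum_sq_of_pairwise_inner_eq_zero]
  exact fun i j hij => hW.inner_eq_zero hij ((W i).starProjection_apply_mem v)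
    ((W j).starProjection_apply_mem v)

end Decomposition

theorem exists_irreducibleSub_le {U : Submodule ℂ V.H} (hU : V.Invariant U) (h0 : U ≠ ⊥) :
    ∃ W ≤ U, V.IrreducibleSub W := by
  obtain ⟨W, ⟨hW1, hW2, hW3⟩, hmin⟩ := WellFounded.has_min
    (wellFounded_lt (α := Submodule ℂ V.H)) {W | V.Invariant W ∧ W ≠ ⊥ ∧ W ≤ U} ⟨U, hU, h0, le_rfl⟩
  refine ⟨W, hW3, hW1, hW2, fun X hX hXi => ?_⟩
  by_contra! h
  exact hmin X ⟨hXi, h.1, hX.trans hW3⟩ (lt_of_le_of_ne hX h.2)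

/-- Split off an irreducible subspace `W` of `U`; its orthogonal complement in `U` is invariant and
strictly smaller, so well-founded induction on `U` applies. -/
theorem exists_finset_sSup_eq {U : Submodule ℂ V.H} (hU : V.Invariant U) :
    ∃ s : Finset (Submodule ℂ V.H), (∀ W ∈ s, V.IrreducibleSub W) ∧
      (∀ W ∈ s, ∀ W' ∈ s, W ≠ W' → W ⟂ W') ∧ sSup (s : Set (Submodule ℂ V.H)) = U := by
  classical
  induction U using WellFoundedLT.induction with
  | ind U ih =>
    by_cases h0 : U = ⊥
    · exact ⟨∅, by simp, by simp, by simp [h0]⟩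
    obtain ⟨W, hWU, hW⟩ := exists_irreducibleSub_le hU h0
    have hinv : V.Invariant (Wᗮ ⊓ U) := fun g v hv => ⟨hW.1.orthogonal g v hv.1, hU g v hv.2⟩
    have hsup : W ⊔ (Wᗮ ⊓ U) = U := Submodule.sup_orthogonal_inf_of_hasOrthogonalProjection hWU
    have hlt : Wᗮ ⊓ U < U := by
      refine lt_of_le_of_ne inf_le_right fun h => hW.2.1 ?_
      rw [eq_bot_iff, ← W.inf_orthogonal_eq_bot]
      exact le_inf le_rfl (hWU.trans (inf_eq_right.1 h))
    obtain ⟨s, hs1, hs2, hs3⟩ := ih _ hlt hinv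
    have hle : ∀ X ∈ s, X ≤ Wᗮ := fun X hX =>
      (le_sSup (Finset.mem_coe.2 hX)).trans (hs3.le.trans inf_le_left)
    refine ⟨insert W s, ?_, ?_, ?_⟩
    · intro X hX
      rcases Finset.mem_insert.1 hX with rfl | hX
      · exact hW
      · exact hs1 X hX
    · intro X hX Y hY hXY
      rcases Finset.mem_insert.1 hX with hX' | hX' <;> rcases Finset.mem_insert.1 hY with hY' | hY'
      · exact absurd (hX'.trans hY'.symm) hXY
      · exact hX' ▸ Submodule.IsOrtho.symm (hle Y hY')
      · exact hY' ▸ hle X hX'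
      · exact hs2 X hX' Y hY' hXY
    · rw [Finset.coe_insert, sSup_insert, hs3, hsup]

/-- Complete reducibility. -/
theorem exists_isDecomposition (V : UnitaryRep G) :
    ∃ (s : Finset (Submodule ℂ V.H)), V.IsDecomposition fun W : s => (W : Submodule ℂ V.H) := by
  obtain ⟨s, h1, h2, h3⟩ := exists_finset_sSup_eq (V := V) (U := ⊤) fun _ _ _ => Submodule.mem_top
  refine ⟨s, fun W => h1 W W.2, fun W W' h => h2 W W.2 W' W'.2 fun h' => h (Subtype.ext h'), ?_⟩
  rw [← h3, sSup_eq_iSup']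
  rfl

/-- Two representations that are equivalent to the same subrepresentation are equivalent. -/
theorem EquivSub.exists_intertwines {W : Submodule ℂ V.H} (h : V.EquivSub W V')
    (h' : V.EquivSub W V'') : ∃ T : V'.H →ₗᵢ[ℂ] V''.H, Intertwines V' V'' T.toLinearMap := by
  obtain ⟨f, hf, hfW⟩ := h
  obtain ⟨f', hf', hfW'⟩ := h'
  have hf1 : Intertwines V'' V f'.toLinearMap := hf'
  -- The adjoint of an isometry is a left inverse, so `f'` can be inverted on its range `W`.
  have hleft : ∀ y, LinearMap.adjoint f'.toLinearMap (f' y) = y := by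
    intro y
    refine ext_inner_right ℂ fun z => ?_
    rw [LinearMap.adjoint_inner_left]
    exact f'.inner_map_map y z
  refine ⟨⟨LinearMap.adjoint f'.toLinearMap ∘ₗ f.toLinearMap, fun x => ?_⟩,
    hf1.adjoint.comp (T := f.toLinearMap) hf⟩
  obtain ⟨y, hy⟩ : f x ∈ LinearMap.range f'.toLinearMap := hfW'.symm ▸ hfW ▸ ⟨x, rfl⟩
  have hy' : f' y = f x := hy
  change ‖LinearMap.adjoint f'.toLinearMap (f x)‖ = ‖x‖
  rw [← hy', hleft, ← f.norm_map x, ← hy', f'.norm_map]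

end UnitaryRep
end

noncomputable section

/-! ### Density of the orbit sums on the alcove -/

namespace PPlus

variable {q : ℕ}

theorem orbitSum_comp_perm (μ : PPlus q) (x : Fin q → ℝ) (σ : Equiv.Perm (Fin q)) :
    μ.orbitSum (x ∘ σ) = μ.orbitSum x := by
  unfold orbitSum
  refine Fintype.sum_equiv (Equiv.mulRight σ⁻¹) _ _ fun ρ => ?_
  refine Fintype.prod_equiv σ _ _ fun j => ?_
  simp

theorem continuous_orbitSum (μ : PPlus q) : Continuous μ.orbitSum := by
  unfold orbitSum
  fun_prop

/-- The dominant weight in the Weyl group orbit of `2k`. -/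
def dominantOfInt (k : Fin q → ℤ) : PPlus q :=
  ⟨fun i => -((fun j => -|2 * k j|) ∘ Tuple.sort fun j => -|2 * k j|) i, by
    refine ⟨fun i => ?_, fun i j hij => ?_, fun i => ?_⟩
    · simp
    · exact neg_le_neg (Tuple.monotone_sort (fun j => -|2 * k j|) hij)
    · simp⟩

/-- Absolute values do no harm since the cosine is even, and sorting is absorbed in the sum over
permutations. Thus symmetrizing any cosine monomial yields an orbit sum. -/
theorem orbitSum_dominantOfInt (k : Fin q → ℤ) (x : Fin q → ℝ) :
    (dominantOfInt k).orbitSum x =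
      ∑ σ : Equiv.Perm (Fin q), ∏ j, Real.cos (2 * k j * (x ∘ σ) j) := by
  set s := Tuple.sort fun j => -|2 * k j| with hs
  unfold orbitSum
  refine Fintype.sum_equiv ((Equiv.mulLeft s).trans (Equiv.inv _)) _ _ fun ρ => ?_
  refine Fintype.prod_equiv (s * ρ) _ _ fun j => ?_
  have h1 : (dominantOfInt k).1 (ρ j) = |2 * k (s (ρ j))| := by simp [dominantOfInt, hs]
  rw [h1]
  have h2 : ((s * ρ)⁻¹ : Equiv.Perm (Fin q)) (s (ρ j)) = j := by
    exact (s * ρ).symm_apply_apply j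
  simp only [Equiv.trans_apply, Equiv.coe_mulLeft, Equiv.inv_apply, Function.comp_apply,
    Equiv.Perm.mul_apply]
  rw [h2]
  rcases abs_choice (2 * k (s (ρ j))) with h | h
  · rw [h]; push_cast; rfl
  · rw [h]; push_cast; rw [neg_mul, Real.cos_neg]

/-- The even trigonometric polynomials with frequencies in `2ℤ`. -/
def evenTrigPoly (q : ℕ) : Submodule ℝ ((Fin q → ℝ) → ℝ) :=
  Submodule.span ℝ (Set.range fun (k : Fin q → ℤ) x => ∏ j, Real.cos (2 * k j * x j))

/-- The product-to-sum formula in each coordinate; `ε` below records the choice between sum and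
difference of the frequencies. -/
theorem mul_mem_evenTrigPoly {f g : (Fin q → ℝ) → ℝ} (hf : f ∈ evenTrigPoly q)
    (hg : g ∈ evenTrigPoly q) : f * g ∈ evenTrigPoly q := by
  have h := Submodule.mul_mem_mul hf hg
  rw [evenTrigPoly, Submodule.span_mul_span] at h
  refine Submodule.span_le.2 ?_ h
  rintro _ ⟨_, ⟨k, rfl⟩, _, ⟨l, rfl⟩, rfl⟩
  have key : ((fun x : Fin q → ℝ => ∏ j, Real.cos (2 * k j * x j)) *
      fun x => ∏ j, Real.cos (2 * l j * x j)) =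
      ∑ ε : Fin q → Bool, (∏ _j : Fin q, (1 / 2 : ℝ)) • fun x : Fin q → ℝ =>
        ∏ j, Real.cos (2 * ((if ε j then k j + l j else k j - l j : ℤ) : ℝ) * x j) := by
    ext x
    have h1 : ∀ j, Real.cos (2 * k j * x j) * Real.cos (2 * l j * x j) =
        ∑ b : Bool, (1 / 2 : ℝ) *
          Real.cos (2 * ((if b then k j + l j else k j - l j : ℤ) : ℝ) * x j) := by
      intro j
      rw [Fintype.sum_bool]
      simp only [if_true, Bool.false_eq_true, if_false]
      push_cast
      rw [show 2 * ((k j : ℝ) + l j) * x j = 2 * k j * x j + 2 * l j * x j by ring,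
        show 2 * ((k j : ℝ) - l j) * x j = 2 * k j * x j - 2 * l j * x j by ring,
        Real.cos_add, Real.cos_sub]
      ring
    rw [Pi.mul_apply, ← Finset.prod_mul_distrib, Finset.prod_congr rfl fun j _ => h1 j,
      Fintype.prod_sum, Finset.sum_apply]
    refine Finset.sum_congr rfl fun ε _ => ?_
    rw [Finset.prod_mul_distrib, Pi.smul_apply, smul_eq_mul]
  simp only [key]
  refine Submodule.sum_mem _ fun ε _ => Submodule.smul_mem _ _ (Submodule.subset_span ?_)
  exact ⟨fun j => if ε j then k j + l j else k j - l j, rfl⟩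

theorem one_mem_evenTrigPoly : (1 : (Fin q → ℝ) → ℝ) ∈ evenTrigPoly q := by
  refine Submodule.subset_span ⟨0, ?_⟩
  ext x
  simp

theorem cos_mem_evenTrigPoly (j : Fin q) :
    (fun x : Fin q → ℝ => Real.cos (2 * x j)) ∈ evenTrigPoly q := by
  refine Submodule.subset_span ⟨Pi.single j 1, ?_⟩
  ext x
  change ∏ i, Real.cos (2 * ((Pi.single j 1 : Fin q → ℤ) i : ℝ) * x i) = _
  rw [Finset.prod_eq_single j]
  · simp
  · intro i _ hi
    simp [hi]
  · simp

theorem sum_comp_perm_mem_span {f : (Fin q → ℝ) → ℝ} (hf : f ∈ evenTrigPoly q) :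
    (fun x => ∑ σ : Equiv.Perm (Fin q), f (x ∘ σ)) ∈
      Submodule.span ℝ (Set.range (orbitSum : PPlus q → (Fin q → ℝ) → ℝ)) := by
  induction hf using Submodule.span_induction with
  | mem f hf =>
    obtain ⟨k, rfl⟩ := hf
    refine Submodule.subset_span ⟨dominantOfInt k, ?_⟩
    ext x
    exact orbitSum_dominantOfInt k x
  | zero =>
    convert! Submodule.zero_mem _
    simp
  | add f g _ _ hf hg =>
    convert! Submodule.add_mem _ hf hg using 1
    ext x
    simp [Finset.sum_add_distrib]
  | smul c f _ hf =>
    convert! Submodule.smul_mem _ c hf using 1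
    ext x
    simp [Finset.mul_sum]

theorem mem_span_orbitSum_of_symmetric {f : (Fin q → ℝ) → ℝ} (hf : f ∈ evenTrigPoly q)
    (hs : ∀ (σ : Equiv.Perm (Fin q)) x, f (x ∘ σ) = f x) :
    f ∈ Submodule.span ℝ (Set.range (orbitSum : PPlus q → (Fin q → ℝ) → ℝ)) := by
  have h := Submodule.smul_mem _ ((Fintype.card (Equiv.Perm (Fin q)) : ℝ)⁻¹)
    (sum_comp_perm_mem_span hf)
  convert! h using 1
  ext x
  have h0 : (Fintype.card (Equiv.Perm (Fin q)) : ℝ) ≠ 0 := by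
    exact_mod_cast Fintype.card_ne_zero
  simp only [hs, Finset.sum_const, Finset.card_univ, nsmul_eq_mul, Pi.smul_apply, smul_eq_mul]
  rw [inv_mul_cancel_left₀ h0]

/-- The algebra of restrictions of symmetric even trigonometric polynomials to the alcove. -/
def symmetricSubalgebra (q : ℕ) : Subalgebra ℝ C(alcove q, ℝ) where
  carrier := {f | ∃ g ∈ evenTrigPoly q, (∀ (σ : Equiv.Perm (Fin q)) x, g (x ∘ σ) = g x) ∧
    ∀ x : alcove q, f x = g x}
  mul_mem' := by
    rintro f f' ⟨g, hg, hs, h⟩ ⟨g', hg', hs', h'⟩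
    exact ⟨g * g', mul_mem_evenTrigPoly hg hg', fun σ x => by simp [hs, hs'],
      fun x => by simp [h, h']⟩
  add_mem' := by
    rintro f f' ⟨g, hg, hs, h⟩ ⟨g', hg', hs', h'⟩
    exact ⟨g + g', Submodule.add_mem _ hg hg', fun σ x => by simp [hs, hs'],
      fun x => by simp [h, h']⟩
  algebraMap_mem' := by
    intro r
    exact ⟨r • 1, Submodule.smul_mem _ _ one_mem_evenTrigPoly, fun σ x => by simp,
      fun x => by simp⟩

theorem prod_sub_cos_mem_evenTrigPoly (t : ℝ) (s : Finset (Fin q)) :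
    (fun x : Fin q → ℝ => ∏ j ∈ s, (t - Real.cos (2 * x j))) ∈ evenTrigPoly q := by
  classical
  induction s using Finset.induction_on with
  | empty =>
    simp only [Finset.prod_empty]
    exact one_mem_evenTrigPoly
  | insert i s hi ih =>
    have h1 : (fun x : Fin q → ℝ => t - Real.cos (2 * x i)) ∈ evenTrigPoly q := by
      convert! Submodule.sub_mem _ (Submodule.smul_mem _ t one_mem_evenTrigPoly)
        (cos_mem_evenTrigPoly i) using 1
      ext x
      simp
    convert! mul_mem_evenTrigPoly h1 ih using 1
    ext x
    simp [Finset.prod_insert hi]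

/-- Both products are the values of monic polynomials, which have equal root multisets, and a sorted
tuple is determined by its multiset. -/
theorem eq_of_forall_prod_sub_eq {u v : Fin q → ℝ} (hu : Monotone u) (hv : Monotone v)
    (h : ∀ t : ℝ, ∏ j, (t - u j) = ∏ j, (t - v j)) : u = v := by
  open Polynomial in
  have h1 : (∏ j, (X - C (u j)) : ℝ[X]) = ∏ j, (X - C (v j)) := by
    refine Polynomial.funext fun t => ?_
    simpa [Polynomial.eval_prod] using h t
  have h2 : ∀ w : Fin q → ℝ, (∏ j, (Polynomial.X - Polynomial.C (w j))).roots =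
      (List.ofFn w : Multiset ℝ) := by
    intro w
    rw [← Fin.univ_val_map, ← Polynomial.roots_multiset_prod_X_sub_C (Multiset.map w _),
      Multiset.map_map]
    rfl
  have h3 := congrArg Polynomial.roots h1
  rw [h2, h2, Multiset.coe_eq_coe] at h3
  exact List.ofFn_injective
    (h3.eq_of_pairwise' hu.sortedLE_ofFn.pairwise hv.sortedLE_ofFn.pairwise)

/-- The functions `∏ (t - cos 2x_j)` recover the multiset of the `cos 2x_j`. On the alcove these
numbers are sorted and `cos` is injective on `[0, π]`, so the point itself is recovered. -/
theorem symmetricSubalgebra_separatesPoints : (symmetricSubalgebra q).SeparatesPoints := by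
  intro x y hxy
  by_contra hne
  apply hxy
  have hmono : ∀ x : alcove q, Monotone fun j => Real.cos (2 * x.1 j) := by
    intro x i j hij
    have := x.2.2 hij
    exact Real.cos_le_cos_of_nonneg_of_le_pi (by linarith [(x.2.1 j).1])
      (by linarith [(x.2.1 i).2]) (by linarith)
  have h1 : (fun j => Real.cos (2 * x.1 j)) = fun j => Real.cos (2 * y.1 j) := by
    refine eq_of_forall_prod_sub_eq (hmono x) (hmono y) fun t => ?_
    by_contra h
    apply hne
    have hc : Continuous fun z : alcove q => ∏ j, (t - Real.cos (2 * z.1 j)) :=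
      continuous_finsetProd _ fun j _ => continuous_const.sub (Real.continuous_cos.comp
        (continuous_const.mul ((continuous_apply j).comp continuous_subtype_val)))
    refine ⟨_, ⟨⟨_, hc⟩, ⟨_, prod_sub_cos_mem_evenTrigPoly t Finset.univ, fun σ z => ?_,
      fun z => rfl⟩, rfl⟩, h⟩
    exact Fintype.prod_equiv σ _ _ fun j => rfl
  ext j
  have h2 := congrFun h1 j
  have := Real.injOn_cos ⟨by linarith [(x.2.1 j).1], by linarith [(x.2.1 j).2]⟩
    ⟨by linarith [(y.2.1 j).1], by linarith [(y.2.1 j).2]⟩ h2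
  linarith

theorem isCompact_alcove : IsCompact (alcove q) := by
  have hK : IsCompact (Set.univ.pi fun _ : Fin q => Set.Icc (0 : ℝ) (Real.pi / 2)) :=
    isCompact_univ_pi fun _ => isCompact_Icc
  refine hK.of_isClosed_subset ?_ fun x hx i _ => hx.1 i
  have : alcove q = (⋂ i, {x : Fin q → ℝ | 0 ≤ x i ∧ x i ≤ Real.pi / 2}) ∩
      ⋂ i, ⋂ j, {x : Fin q → ℝ | i ≤ j → x j ≤ x i} := by
    ext x
    simp [alcove, Antitone]
  rw [this]
  refine (isClosed_iInter fun i => ?_).inter (isClosed_iInter fun i => isClosed_iInter fun j => ?_)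
  · exact (isClosed_le continuous_const (continuous_apply i)).inter
      (isClosed_le (continuous_apply i) continuous_const)
  · by_cases h : i ≤ j
    · simpa [h] using isClosed_le (continuous_apply j) (continuous_apply i)
    · simp [h]

/-- The orbit sums span a dense subspace of the continuous functions on the alcove. -/
theorem exists_mem_span_orbitSum_near {f : (Fin q → ℝ) → ℝ} (hf : Continuous f) {ε : ℝ}
    (hε : 0 < ε) :
    ∃ P ∈ Submodule.span ℝ (Set.range (orbitSum : PPlus q → (Fin q → ℝ) → ℝ)),
      ∀ x ∈ alcove q, ‖P x - f x‖ < ε := by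
  have : CompactSpace (alcove q) := isCompact_iff_compactSpace.1 isCompact_alcove
  obtain ⟨⟨g, P, hP, hs, hgP⟩, hg⟩ :=
    ContinuousMap.exists_mem_subalgebra_near_continuous_of_separatesPoints _
      symmetricSubalgebra_separatesPoints (fun x : alcove q => f x) (by fun_prop) ε hε
  refine ⟨P, mem_span_orbitSum_of_symmetric hP hs, fun x hx => ?_⟩
  rw [← hgP ⟨x, hx⟩]
  exact hg ⟨x, hx⟩

end PPlus
end

noncomputable section

/-! ### Dominance order and Fourier coefficients of orbit sums -/

namespace PPlus

variable {q : ℕ}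

theorem sum_Iic_eq (f : Fin q → ℤ) (k : Fin q) :
    ∑ i ∈ Finset.Iic k, f i = f k + ∑ i ∈ Finset.Iio k, f i := by
  rw [← Finset.Iio_insert, Finset.sum_insert (by simp)]

theorem eq_of_sum_Iic_eq {μ ν : PPlus q}
    (h : ∀ k : Fin q, ∑ i ∈ Finset.Iic k, μ.1 i = ∑ i ∈ Finset.Iic k, ν.1 i) : μ = ν := by
  apply Subtype.ext
  ext k
  induction k using WellFoundedLT.induction with
  | ind k ih =>
    have h1 := h k
    rw [sum_Iic_eq, sum_Iic_eq, Finset.sum_congr rfl fun i hi => ih i (Finset.mem_Iio.1 hi)] at h1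
    exact add_right_cancel h1

theorem Dominated.refl (μ : PPlus q) : μ.Dominated μ := fun _ => le_rfl

theorem Dominated.antisymm {μ ν : PPlus q} (h : μ.Dominated ν) (h' : ν.Dominated μ) : μ = ν :=
  eq_of_sum_Iic_eq fun k => le_antisymm (h k) (h' k)

/-- The sum of all partial sums of a dominant weight. -/
def height (μ : PPlus q) : ℤ := ∑ k, ∑ i ∈ Finset.Iic k, μ.1 i

theorem height_nonneg (μ : PPlus q) : 0 ≤ μ.height :=
  Finset.sum_nonneg fun _ _ => Finset.sum_nonneg fun i _ => μ.2.2.2 i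

/-- A nonnegative integer that strictly increases along the dominance order permits induction over
dominated weights. -/
theorem Dominated.height_lt {μ ν : PPlus q} (h : μ.Dominated ν) (hne : μ ≠ ν) :
    μ.height < ν.height := by
  refine lt_of_le_of_ne (Finset.sum_le_sum fun k _ => h k) fun heq => hne ?_
  exact eq_of_sum_Iic_eq fun k =>
    (Finset.sum_eq_sum_iff_of_le fun k _ => h k).1 heq k (Finset.mem_univ k)

theorem Dominated.eq_zero {μ : PPlus q} (h : μ.Dominated 0) : μ = 0 :=
  h.antisymm fun _ => Finset.sum_le_sum fun i _ => μ.2.2.2 i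

theorem eq_of_comp_perm_eq {μ ν : PPlus q} {σ : Equiv.Perm (Fin q)} (h : ∀ j, μ.1 (σ j) = ν.1 j) :
    μ = ν := by
  apply Subtype.ext
  have h1 : Antitone (μ.1 ∘ σ) := by
    rw [show μ.1 ∘ σ = ν.1 from funext h]
    exact ν.2.2.1
  have h2 : Antitone (μ.1 ∘ (1 : Equiv.Perm (Fin q))) := μ.2.2.1
  have h3 := Tuple.unique_antitone h2 h1
  exact h3.trans (funext h)

theorem integral_cos_int_mul (k : ℤ) :
    ∫ x in (0 : ℝ)..Real.pi, Real.cos (k * x) = if k = 0 then Real.pi else 0 := by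
  split_ifs with h
  · simp [h]
  · rw [intervalIntegral.integral_comp_mul_left Real.cos (Int.cast_ne_zero.2 h), integral_cos]
    simp [Real.sin_int_mul_pi]

theorem integral_cos_mul_cos (k l : ℤ) :
    ∫ x in Set.Icc (0 : ℝ) Real.pi, Real.cos (k * x) * Real.cos (l * x) =
      ((if k + l = 0 then Real.pi else 0) + if k - l = 0 then Real.pi else 0) / 2 := by
  rw [integral_Icc_eq_integral_Ioc, ← intervalIntegral.integral_of_le Real.pi_pos.le,
    ← integral_cos_int_mul, ← integral_cos_int_mul, ← intervalIntegral.integral_add,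
    ← intervalIntegral.integral_div]
  · refine intervalIntegral.integral_congr fun x _ => ?_
    push_cast
    rw [add_mul, sub_mul, Real.cos_add, Real.cos_sub]
    ring
  · exact Continuous.intervalIntegrable (by fun_prop) _ _
  · exact Continuous.intervalIntegrable (by fun_prop) _ _

/-- The cube `[0, π]^q`. -/
def cube (q : ℕ) : Set (Fin q → ℝ) := Set.univ.pi fun _ => Set.Icc 0 Real.pi

theorem isCompact_cube : IsCompact (cube q) := isCompact_univ_pi fun _ => isCompact_Icc

/-- The Fourier coefficients of functions on the cube. -/
def cosCoeff (μ : PPlus q) (f : (Fin q → ℝ) → ℝ) : ℝ :=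
  ∫ x in cube q, f x * ∏ j, Real.cos (μ.1 j * x j)

theorem continuous_of_mem_span_orbitSum {A : Set (PPlus q)} {f : (Fin q → ℝ) → ℝ}
    (hf : f ∈ Submodule.span ℝ (orbitSum '' A)) : Continuous f := by
  induction hf using Submodule.span_induction with
  | mem f hf =>
    obtain ⟨μ, -, rfl⟩ := hf
    exact continuous_orbitSum μ
  | zero => exact continuous_const
  | add f g _ _ hf hg => exact hf.add hg
  | smul c f _ hf => exact hf.const_smul c

theorem integrableOn_cosCoeff (μ : PPlus q) {f : (Fin q → ℝ) → ℝ} (hf : Continuous f) :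
    IntegrableOn (fun x => f x * ∏ j, Real.cos (μ.1 j * x j)) (cube q) :=
  ContinuousOn.integrableOn_compact isCompact_cube (by fun_prop)

theorem cosCoeff_add (μ : PPlus q) {f g : (Fin q → ℝ) → ℝ} (hf : Continuous f)
    (hg : Continuous g) : μ.cosCoeff (f + g) = μ.cosCoeff f + μ.cosCoeff g := by
  simp only [cosCoeff, Pi.add_apply, add_mul]
  exact integral_add (integrableOn_cosCoeff μ hf) (integrableOn_cosCoeff μ hg)

theorem cosCoeff_smul (μ : PPlus q) (c : ℝ) (f : (Fin q → ℝ) → ℝ) :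
    μ.cosCoeff (c • f) = c * μ.cosCoeff f := by
  simp only [cosCoeff, Pi.smul_apply, smul_eq_mul, mul_assoc]
  exact integral_const_mul _ _

/-- On the cube, without a weight, the integral factorizes over the coordinates; this is why the
coefficients are taken there and not on the alcove. -/
theorem cosCoeff_orbitSum (μ ν : PPlus q) : μ.cosCoeff ν.orbitSum =
    ∑ σ : Equiv.Perm (Fin q), ∏ j,
      ((if ν.1 (σ j) + μ.1 j = 0 then Real.pi else 0) +
        if ν.1 (σ j) - μ.1 j = 0 then Real.pi else 0) / 2 := by
  simp only [cosCoeff, orbitSum, Finset.sum_mul]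
  rw [integral_finsetSum]
  · refine Finset.sum_congr rfl fun σ _ => ?_
    simp only [← Finset.prod_mul_distrib, ← integral_cos_mul_cos]
    rw [cube, volume_pi, Measure.restrict_pi_pi]
    exact integral_fintype_prod_eq_prod (𝕜 := ℝ)
      (fun j x => Real.cos (ν.1 (σ j) * x) * Real.cos (μ.1 j * x))
  · intro σ _
    exact ContinuousOn.integrableOn_compact isCompact_cube (by fun_prop)

theorem cosCoeff_orbitSum_self_pos (μ : PPlus q) : 0 < μ.cosCoeff μ.orbitSum := by
  rw [cosCoeff_orbitSum]
  have hpi := Real.pi_pos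
  have h : ∀ a b : ℤ, 0 ≤ ((if a = 0 then Real.pi else 0) + if b = 0 then Real.pi else 0) / 2 := by
    intro a b
    split_ifs <;> positivity
  refine Finset.sum_pos' (fun σ _ => Finset.prod_nonneg fun j _ => h _ _)
    ⟨1, Finset.mem_univ _, Finset.prod_pos fun j _ => ?_⟩
  simp only [Equiv.Perm.coe_one, id_eq, sub_self, if_true]
  split_ifs <;> positivity

/-- Two distinct dominant weights are not permutations of each other, so every summand has a
coordinate with different nonnegative frequencies, whose cosines are orthogonal. -/
theorem cosCoeff_orbitSum_of_ne {μ ν : PPlus q} (hne : ν ≠ μ) : μ.cosCoeff ν.orbitSum = 0 := by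
  rw [cosCoeff_orbitSum]
  refine Finset.sum_eq_zero fun σ _ => ?_
  obtain ⟨j, hj⟩ : ∃ j, ν.1 (σ j) ≠ μ.1 j := by
    by_contra! h
    exact hne (eq_of_comp_perm_eq h)
  refine Finset.prod_eq_zero (Finset.mem_univ j) ?_
  have h1 := ν.2.2.2 (σ j)
  have h2 := μ.2.2.2 j
  rw [if_neg (by omega), if_neg (by omega)]
  simp

theorem cosCoeff_eq_zero {μ : PPlus q} {A : Set (PPlus q)} (hμ : μ ∉ A) {f : (Fin q → ℝ) → ℝ}
    (hf : f ∈ Submodule.span ℝ (orbitSum '' A)) : μ.cosCoeff f = 0 := by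
  induction hf using Submodule.span_induction with
  | mem f hf =>
    obtain ⟨ν, hν, rfl⟩ := hf
    exact cosCoeff_orbitSum_of_ne fun h => hμ (h ▸ hν)
  | zero => simp [cosCoeff]
  | add f g hf hg hf' hg' =>
    rw [cosCoeff_add μ (continuous_of_mem_span_orbitSum hf) (continuous_of_mem_span_orbitSum hg),
      hf', hg', add_zero]
  | smul c f _ hf => rw [cosCoeff_smul, hf, mul_zero]

/-- All frequencies are even, so every factor is invariant under `x_j ↦ π - x_j`. -/
theorem orbitSum_congr_abs_cos (μ : PPlus q) {x y : Fin q → ℝ}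
    (h : ∀ j, y j = x j ∨ y j = Real.pi - x j) : μ.orbitSum y = μ.orbitSum x := by
  unfold orbitSum
  refine Finset.sum_congr rfl fun σ _ => Finset.prod_congr rfl fun j _ => ?_
  rcases h j with h | h
  · rw [h]
  · obtain ⟨m, hm⟩ := μ.2.1 (σ j)
    rw [h, hm]
    push_cast
    rw [show ((m : ℝ) + m) * (Real.pi - x j) = m * (2 * Real.pi) - (m + m) * x j by ring,
      Real.cos_int_mul_two_pi_sub]

/-- Every point of the cube is equivalent to a point of the alcove. -/
theorem exists_mem_alcove {x : Fin q → ℝ} (hx : x ∈ cube q) : ∃ y ∈ alcove q, ∀ A : Set (PPlus q),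
    ∀ f ∈ Submodule.span ℝ (orbitSum '' A), f y = f x := by
  -- Fold each coordinate into `[0, π/2]` by the reflection at `π/2`, then sort decreasingly.
  set z : Fin q → ℝ := fun j => min (x j) (Real.pi - x j) with hz
  set σ := Tuple.sort fun j => -z j with hσ
  refine ⟨z ∘ σ, ⟨fun i => ⟨?_, ?_⟩, fun i j hij => ?_⟩, fun A f hf => ?_⟩
  · have := hx (σ i) trivial
    exact le_min this.1 (by linarith [this.2])
  · simp only [Function.comp_apply, hz]
    rcases le_total (x (σ i)) (Real.pi / 2) with h | h
    · exact (min_le_left _ _).trans h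
    · exact (min_le_right _ _).trans (by linarith)
  · exact neg_le_neg_iff.1 (Tuple.monotone_sort (fun j => -z j) hij)
  · induction hf using Submodule.span_induction with
    | mem f hf =>
      obtain ⟨μ, -, rfl⟩ := hf
      rw [orbitSum_comp_perm]
      exact orbitSum_congr_abs_cos μ fun j => min_choice _ _
    | zero => rfl
    | add f g _ _ hf hg => simp only [Pi.add_apply, hf, hg]
    | smul c f _ hf => simp only [Pi.smul_apply, hf]

theorem cosCoeff_congr (μ : PPlus q) {A B : Set (PPlus q)} {f g : (Fin q → ℝ) → ℝ}
    (hf : f ∈ Submodule.span ℝ (orbitSum '' A)) (hg : g ∈ Submodule.span ℝ (orbitSum '' B))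
    (h : ∀ x ∈ alcove q, f x = g x) : μ.cosCoeff f = μ.cosCoeff g := by
  refine setIntegral_congr_fun isCompact_cube.measurableSet fun x hx => ?_
  obtain ⟨y, hy, hxy⟩ := exists_mem_alcove hx
  rw [← hxy A f hf, ← hxy B g hg, h y hy]

end PPlus

/-! ### The weight function and the open alcove -/

section Weight

variable {q : ℕ} {k₁ k₂ k₃ : ℝ}

theorem continuous_hoWeight (h₁ : 0 ≤ k₁) (h₂ : 0 ≤ k₂) (h₃ : 0 ≤ k₃) :
    Continuous (hoWeight k₁ k₂ k₃ : (Fin q → ℝ) → ℝ) := by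
  unfold hoWeight
  have hr : ∀ k : ℝ, 0 ≤ k → ∀ f : (Fin q → ℝ) → ℝ, Continuous f →
      Continuous fun x => |2 * Real.sin (f x)| ^ (2 * k) := fun k hk f hf =>
    (by fun_prop : Continuous fun x => |2 * Real.sin (f x)|).rpow_const fun _ => Or.inr (by linarith)
  refine Continuous.mul (continuous_finsetProd _ fun i _ => ?_)
    (continuous_finsetProd _ fun i _ => continuous_finsetProd _ fun j _ => ?_)
  · exact (hr k₁ h₁ _ (by fun_prop)).mul (hr k₂ h₂ _ (by fun_prop))
  · exact (hr k₃ h₃ _ (by fun_prop)).mul (hr k₃ h₃ _ (by fun_prop))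

theorem hoWeight_nonneg (x : Fin q → ℝ) : 0 ≤ hoWeight k₁ k₂ k₃ x := by
  unfold hoWeight
  refine mul_nonneg (Finset.prod_nonneg fun _ _ => by positivity)
    (Finset.prod_nonneg fun _ _ => Finset.prod_nonneg fun _ _ => by positivity)

/-- The interior of the alcove. -/
def openAlcove (q : ℕ) : Set (Fin q → ℝ) :=
  {x | (∀ i, 0 < x i ∧ x i < Real.pi / 2) ∧ ∀ i j, i < j → x j < x i}

theorem openAlcove_subset : openAlcove q ⊆ alcove q := fun x hx =>
  ⟨fun i => ⟨(hx.1 i).1.le, (hx.1 i).2.le⟩, fun i j hij => by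
    rcases hij.lt_or_eq with h | rfl
    · exact (hx.2 i j h).le
    · exact le_rfl⟩

theorem isOpen_openAlcove : IsOpen (openAlcove q) := by
  have : openAlcove q = (⋂ i, {x : Fin q → ℝ | 0 < x i ∧ x i < Real.pi / 2}) ∩
      ⋂ i, ⋂ j, {x : Fin q → ℝ | i < j → x j < x i} := by
    ext x
    simp [openAlcove]
  rw [this]
  refine (isOpen_iInter_of_finite fun i => ?_).inter
    (isOpen_iInter_of_finite fun i => isOpen_iInter_of_finite fun j => ?_)
  · exact (isOpen_lt continuous_const (continuous_apply i)).inter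
      (isOpen_lt (continuous_apply i) continuous_const)
  · by_cases h : i < j
    · simpa [h] using isOpen_lt (continuous_apply j) (continuous_apply i)
    · simp [h]

/-- The points `t (q, q - 1, …, 1)` with small `t > 0` lie in the open alcove. This links vanishing
on the open alcove to the normalization at the origin. -/
theorem zero_mem_closure_openAlcove : (0 : Fin q → ℝ) ∈ closure (openAlcove q) := by
  have hc : Filter.Tendsto (fun t : ℝ => fun i : Fin q => t * ((q : ℝ) - i))
      (nhdsWithin 0 (Set.Ioi 0)) (nhds 0) := by
    have : Continuous fun t : ℝ => fun i : Fin q => t * ((q : ℝ) - i) := by fun_prop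
    have h := this.tendsto 0
    simp only [zero_mul] at h
    exact h.mono_left nhdsWithin_le_nhds
  refine mem_closure_of_tendsto hc ?_
  have hpos : 0 < Real.pi / 2 / (q + 1) := by positivity
  filter_upwards [Ioo_mem_nhdsGT hpos] with t ht
  have hq : t * (q + 1) < Real.pi / 2 := (lt_div_iff₀ (by positivity)).1 ht.2
  have ht0 : 0 < t := ht.1
  refine ⟨fun i => ?_, fun i j hij => ?_⟩
  · have hi : ((i : ℕ) : ℝ) < q := by exact_mod_cast i.2
    have hi' : (0 : ℝ) ≤ (i : ℕ) := by positivity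
    exact ⟨mul_pos ht0 (by linarith), by nlinarith⟩
  · have : ((i : ℕ) : ℝ) < (j : ℕ) := by exact_mod_cast hij
    exact mul_lt_mul_of_pos_left (by linarith) ht0

theorem hoWeight_pos {x : Fin q → ℝ} (hx : x ∈ openAlcove q) : 0 < hoWeight k₁ k₂ k₃ x := by
  have hs : ∀ (k t : ℝ), 0 < t → t < Real.pi → 0 < |2 * Real.sin t| ^ (2 * k) := fun k t h0 h1 =>
    Real.rpow_pos_of_pos (abs_pos.2 (mul_pos two_pos (Real.sin_pos_of_pos_of_lt_pi h0 h1)).ne') _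
  unfold hoWeight
  refine mul_pos (Finset.prod_pos fun i _ => ?_)
    (Finset.prod_pos fun i _ => Finset.prod_pos fun j hj => ?_)
  · have := hx.1 i
    exact mul_pos (hs _ _ this.1 (by linarith)) (hs _ _ (by linarith) (by linarith))
  · have h1 := hx.1 i
    have h2 := hx.1 j
    have h3 := hx.2 i j (Finset.mem_Ioi.1 hj)
    exact mul_pos (hs _ _ (by linarith) (by linarith)) (hs _ _ (by linarith) (by linarith))

end Weight

/-! ### Triangularity of the Jacobi polynomials -/

namespace IsJacobiPoly

open PPlus

variable {q : ℕ} {k₁ k₂ k₃ : ℝ} {lam : PPlus q} {R : (Fin q → ℝ) → ℝ}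

theorem mem_span_image (hR : IsJacobiPoly k₁ k₂ k₃ lam R) :
    R ∈ Submodule.span ℝ (orbitSum '' {μ | μ.Dominated lam}) := by
  convert! hR.mem_span using 2
  ext f
  exact exists_congr fun μ => and_congr_right fun _ => eq_comm

/-- Without a leading term `R` would be orthogonal to itself. As the weight is positive on the open
alcove, `R` would vanish there and, by continuity, at the origin, contrary to `R 0 = 1`. -/
theorem not_mem_span_lower (h₁ : 0 ≤ k₁) (h₂ : 0 ≤ k₂) (h₃ : 0 ≤ k₃)
    (hR : IsJacobiPoly k₁ k₂ k₃ lam R) :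
    R ∉ Submodule.span ℝ (orbitSum '' {μ | μ.Dominated lam ∧ μ ≠ lam}) := by
  intro hlow
  have hRc := continuous_of_mem_span_orbitSum hlow
  have hw := continuous_hoWeight (q := q) h₁ h₂ h₃
  have hzero : ∀ f ∈ Submodule.span ℝ (orbitSum '' {μ | μ.Dominated lam ∧ μ ≠ lam}),
      ∫ x in alcove q, R x * f x * hoWeight k₁ k₂ k₃ x = 0 := by
    intro f hf
    induction hf using Submodule.span_induction with
    | mem f hf =>
      obtain ⟨μ, hμ, rfl⟩ := hf
      exact hR.orthogonal μ hμ.1 hμ.2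
    | zero => simp
    | add f g hf hg hf' hg' =>
      have hfc := continuous_of_mem_span_orbitSum hf
      have hgc := continuous_of_mem_span_orbitSum hg
      simp only [Pi.add_apply, mul_add, add_mul]
      rw [integral_add, hf', hg', add_zero]
      · exact ContinuousOn.integrableOn_compact isCompact_alcove (by fun_prop)
      · exact ContinuousOn.integrableOn_compact isCompact_alcove (by fun_prop)
    | smul c f _ hf =>
      have : ∀ x, R x * (c • f) x * hoWeight k₁ k₂ k₃ x =
          c * (R x * f x * hoWeight k₁ k₂ k₃ x) := fun x => by
        rw [Pi.smul_apply, smul_eq_mul]; ring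
      simp only [this]
      rw [integral_const_mul, hf, mul_zero]
  have hae := (setIntegral_eq_zero_iff_of_nonneg_ae
    (Filter.Eventually.of_forall fun x => mul_nonneg (mul_self_nonneg (R x)) (hoWeight_nonneg x))
    (ContinuousOn.integrableOn_compact isCompact_alcove (by fun_prop))).1 (hzero R hlow)
  have hopen : Set.EqOn (fun x => R x * R x * hoWeight k₁ k₂ k₃ x) 0 (openAlcove q) :=
    Measure.eqOn_open_of_ae_eq (ae_restrict_of_ae_restrict_of_subset openAlcove_subset hae)
      isOpen_openAlcove (by fun_prop) (by fun_prop)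
  have hR0 : Set.EqOn R 0 (openAlcove q) := by
    intro x hx
    have h := hopen hx
    simp only [Pi.zero_apply, mul_eq_zero, (hoWeight_pos hx).ne', or_false, or_self] at h
    exact h
  have h0 := hR0.closure hRc continuous_const zero_mem_closure_openAlcove
  rw [hR.map_zero] at h0
  exact one_ne_zero h0

theorem exists_leading_coeff (h₁ : 0 ≤ k₁) (h₂ : 0 ≤ k₂) (h₃ : 0 ≤ k₃)
    (hR : IsJacobiPoly k₁ k₂ k₃ lam R) : ∃ c : ℝ, c ≠ 0 ∧
      ∃ r ∈ Submodule.span ℝ (orbitSum '' {μ | μ.Dominated lam ∧ μ ≠ lam}),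
        R = c • lam.orbitSum + r := by
  have hset : {μ : PPlus q | μ.Dominated lam} =
      insert lam {μ | μ.Dominated lam ∧ μ ≠ lam} := by
    ext μ
    by_cases h : μ = lam
    · simp [h, Dominated.refl]
    · simp [h]
  have h := hR.mem_span_image
  rw [hset, Set.image_insert_eq, Submodule.mem_span_insert] at h
  obtain ⟨c, r, hr, hRr⟩ := h
  refine ⟨c, ?_, r, hr, hRr⟩
  rintro rfl
  rw [zero_smul, zero_add] at hRr
  exact hR.not_mem_span_lower h₁ h₂ h₃ (hRr ▸ hr)

/-- The weight is determined by the values of the Jacobi polynomial on the alcove. -/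
theorem dominated_of_eqOn (h₁ : 0 ≤ k₁) (h₂ : 0 ≤ k₂) (h₃ : 0 ≤ k₃)
    (hR : IsJacobiPoly k₁ k₂ k₃ lam R) {μ : PPlus q} {R' : (Fin q → ℝ) → ℝ}
    (hR' : IsJacobiPoly k₁ k₂ k₃ μ R') (h : ∀ x ∈ alcove q, R x = R' x) : lam.Dominated μ := by
  obtain ⟨c, hc, r, hr, hRr⟩ := hR.exists_leading_coeff h₁ h₂ h₃
  by_contra hnot
  -- The coefficient at `lam` detects the leading term of `R`, while `R'` involves only weights
  -- dominated by `μ`.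
  have h1 : lam.cosCoeff R' = 0 := cosCoeff_eq_zero hnot hR'.mem_span_image
  rw [← cosCoeff_congr lam hR.mem_span_image hR'.mem_span_image h, hRr,
    cosCoeff_add lam ((continuous_orbitSum lam).const_smul c) (continuous_of_mem_span_orbitSum hr),
    cosCoeff_smul, cosCoeff_eq_zero (fun h => h.2 rfl) hr, add_zero] at h1
  exact (mul_ne_zero hc lam.cosCoeff_orbitSum_self_pos.ne') h1

theorem eq_of_eqOn (h₁ : 0 ≤ k₁) (h₂ : 0 ≤ k₂) (h₃ : 0 ≤ k₃)
    (hR : IsJacobiPoly k₁ k₂ k₃ lam R) {μ : PPlus q} {R' : (Fin q → ℝ) → ℝ}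
    (hR' : IsJacobiPoly k₁ k₂ k₃ μ R') (h : ∀ x ∈ alcove q, R x = R' x) : lam = μ :=
  (hR.dominated_of_eqOn h₁ h₂ h₃ hR' h).antisymm
    (hR'.dominated_of_eqOn h₁ h₂ h₃ hR fun x hx => (h x hx).symm)

/-- The orbit sums are linear combinations of Jacobi polynomials. -/
theorem orbitSum_mem_span (h₁ : 0 ≤ k₁) (h₂ : 0 ≤ k₂) (h₃ : 0 ≤ k₃)
    {R : PPlus q → (Fin q → ℝ) → ℝ} (hR : ∀ μ, IsJacobiPoly k₁ k₂ k₃ μ (R μ)) (μ : PPlus q) :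
    μ.orbitSum ∈ Submodule.span ℝ (Set.range R) := by
  induction hn : μ.height.toNat using Nat.strong_induction_on generalizing μ with
  | _ n ih =>
    obtain ⟨c, hc, r, hr, hRr⟩ := (hR μ).exists_leading_coeff h₁ h₂ h₃
    have hr' : r ∈ Submodule.span ℝ (Set.range R) := by
      refine Submodule.span_le.2 ?_ hr
      rintro _ ⟨ν, hν, rfl⟩
      have h1 := hν.1.height_lt hν.2
      have h2 := ν.height_nonneg
      exact ih ν.height.toNat (by omega) ν rfl
    have : μ.orbitSum = c⁻¹ • (R μ - r) := by
      rw [hRr, add_sub_cancel_right, smul_smul, inv_mul_cancel₀ hc, one_smul]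
    rw [this]
    exact Submodule.smul_mem _ _ (Submodule.sub_mem _ (Submodule.subset_span ⟨μ, rfl⟩) hr')

/-- The Jacobi polynomial of weight zero is constant. -/
theorem eq_one {R : (Fin q → ℝ) → ℝ} (hR : IsJacobiPoly k₁ k₂ k₃ 0 R) : R = 1 := by
  have h := hR.mem_span_image
  have hset : {μ : PPlus q | μ.Dominated 0} = {0} := by
    ext μ
    exact ⟨fun h => h.eq_zero, fun h => by rw [h]; exact Dominated.refl 0⟩
  rw [hset, Set.image_singleton, Submodule.mem_span_singleton] at h
  obtain ⟨c, rfl⟩ := h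
  have h0 : ∀ x, (0 : PPlus q).orbitSum x = (0 : PPlus q).orbitSum 0 := fun x => by
    have : ∀ j, (0 : PPlus q).1 j = 0 := fun _ => rfl
    simp [orbitSum, this]
  ext x
  have := hR.map_zero
  rw [Pi.smul_apply] at this ⊢
  rw [h0, this]
  rfl

end IsJacobiPoly
end

noncomputable section

/-! ### Schur orthogonality by averaging over Haar measure -/

namespace UnitaryRep

section Haar

variable {G : Type} [Group G] [TopologicalSpace G] [IsTopologicalGroup G] [CompactSpace G]
  [MeasurableSpace G] [BorelSpace G] (μ : Measure G) [μ.IsMulLeftInvariant]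
  [IsFiniteMeasureOnCompacts μ] {V V' : UnitaryRep G}

theorem integrable_of_continuous {E : Type*} [NormedAddCommGroup E] {f : G → E}
    (hf : Continuous f) : Integrable f μ :=
  hf.integrable_of_hasCompactSupport (HasCompactSupport.of_compactSpace f)

/-- The averaged operator `∫ ⟨π'(g) u, ·⟩ π(g) v dg`. -/
def averageRankOne (V V' : UnitaryRep G) (v : V.H) (u : V'.H) : V'.H →ₗ[ℂ] V.H where
  toFun x := ∫ g, inner ℂ (V'.ρ g u) x • V.ρ g v ∂μ
  map_add' x y := by
    have hc := V.continuous_apply v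
    have hc' := V'.continuous_apply u
    simp only [inner_add_right, add_smul]
    exact integral_add (integrable_of_continuous μ (by fun_prop))
      (integrable_of_continuous μ (by fun_prop))
  map_smul' c x := by
    simp only [inner_smul_right, mul_smul, RingHom.id_apply]
    exact integral_smul c _

/-- Left invariance of the measure allows the substitution `g ↦ h * g`, and unitarity cancels `h` in
the inner product. -/
theorem intertwines_averageRankOne (v : V.H) (u : V'.H) :
    Intertwines V' V (averageRankOne μ V V' v u) := by
  intro h x
  have : CompleteSpace V.H := FiniteDimensional.complete ℂ V.H
  have h1 : V.ρ h (∫ g, inner ℂ (V'.ρ g u) x • V.ρ g v ∂μ) =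
      ∫ g, V.ρ h (inner ℂ (V'.ρ g u) x • V.ρ g v) ∂μ :=
    ((V.ρ h).toContinuousLinearEquiv.toContinuousLinearMap.integral_comp_comm
      (integrable_of_continuous μ (by
        have hc := V.continuous_apply v
        have hc' := V'.continuous_apply u
        fun_prop))).symm
  change ∫ g, inner ℂ (V'.ρ g u) (V'.ρ h x) • V.ρ g v ∂μ = V.ρ h (∫ g, _ ∂μ)
  rw [h1, ← integral_mul_left_eq_self _ h]
  congr 1
  ext g
  rw [ρ_mul_apply, inner_ρ_ρ, ρ_mul_apply, map_smul]

/-- Schur orthogonality of diagonal matrix coefficients. -/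
theorem integral_inner_mul_inner_eq_zero (hV : V.Irreducible) (hV' : V'.Irreducible)
    (h : ¬ V.EquivSub ⊤ V') (v : V.H) (u : V'.H) :
    ∫ g, inner ℂ (V'.ρ g u) u * inner ℂ v (V.ρ g v) ∂μ = 0 := by
  have : CompleteSpace V.H := FiniteDimensional.complete ℂ V.H
  have hT := intertwines_averageRankOne μ (V := V) (V' := V') v u
  have h0 : averageRankOne μ V V' v u = 0 := by
    by_contra h0
    apply h
    rcases hV.2.2 _ le_top hT.invariant_range with h1 | h1
    · exact absurd (LinearMap.range_eq_bot.1 h1) h0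
    · rw [← h1]
      exact hV'.equivSub_range hT h0
  have h1 : inner ℂ v (averageRankOne μ V V' v u u) = 0 := by
    rw [h0, LinearMap.zero_apply, inner_zero_right]
  have h2 : inner ℂ v (averageRankOne μ V V' v u u) =
      ∫ g, inner ℂ v (inner ℂ (V'.ρ g u) u • V.ρ g v) ∂μ :=
    ((innerSL ℂ v).integral_comp_comm (integrable_of_continuous μ (by
      have hc := V.continuous_apply v
      have hc' := V'.continuous_apply u
      fun_prop))).symm
  rw [h2] at h1
  simpa only [inner_smul_right] using h1

end Haar

theorem EquivSub.of_sub {G : Type} [Group G] [TopologicalSpace G] {V V' : UnitaryRep G}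
    {W : Submodule ℂ V.H} {hW : V.Invariant W} (h : (V.sub W hW).EquivSub ⊤ V') :
    V.EquivSub W V' := by
  obtain ⟨f, hf, hr⟩ := h
  let j : (V.sub W hW).H →ₗᵢ[ℂ] V.H := W.subtypeₗᵢ
  refine ⟨j.comp f, fun g v => congrArg j (hf g v), ?_⟩
  refine le_antisymm ?_ fun w hw => ?_
  · rintro _ ⟨v, rfl⟩
    exact Subtype.property (p := (· ∈ W)) (f v)
  · let w' : (V.sub W hW).H := (⟨w, hw⟩ : W)
    obtain ⟨v, hv⟩ : w' ∈ LinearMap.range f.toLinearMap := hr.symm ▸ Submodule.mem_top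
    exact ⟨v, congrArg j hv⟩

theorem inner_ρ_mul_mul {G : Type} [Group G] [TopologicalSpace G] {V : UnitaryRep G}
    {K : Subgroup G} {v : V.H} (hv : v ∈ V.fixed K) {k l : G} (hk : k ∈ K) (hl : l ∈ K) (g : G) :
    inner ℂ v (V.ρ (k * g * l) v) = inner ℂ v (V.ρ g v) := by
  rw [ρ_mul_apply, hv l hl, ρ_mul_apply]
  nth_rewrite 1 [← hv k hk]
  rw [inner_ρ_ρ]

end UnitaryRep

namespace BaseField

theorem one_le_dim (𝔽 : BaseField) : (1 : ℝ) ≤ 𝔽.dim := by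
  cases 𝔽 <;> norm_num [dim]

end BaseField

/-! ### Uniqueness and completeness of the family of spherical representations -/

namespace SphericalRep

open UnitaryRep

variable {𝔽 : BaseField} {p q : ℕ}

/-- The Jacobi polynomial of a spherical representation. -/
def jacobi {lam : PPlus q} (S : SphericalRep 𝔽 p q lam) : (Fin q → ℝ) → ℝ := S.spherical.choose

theorem isJacobiPoly_jacobi {lam : PPlus q} (S : SphericalRep 𝔽 p q lam) :
    IsJacobiPoly ((𝔽.dim : ℝ) * ((p : ℝ) - q) / 2) (((𝔽.dim : ℝ) - 1) / 2) ((𝔽.dim : ℝ) / 2) lam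
      S.jacobi := S.spherical.choose_spec.1

theorem multiplicity_nonneg (𝔽 : BaseField) (hqp : q ≤ p) :
    0 ≤ (𝔽.dim : ℝ) * ((p : ℝ) - q) / 2 ∧ 0 ≤ ((𝔽.dim : ℝ) - 1) / 2 ∧ 0 ≤ (𝔽.dim : ℝ) / 2 := by
  have h1 := 𝔽.one_le_dim
  have h2 : (q : ℝ) ≤ p := by exact_mod_cast hqp
  exact ⟨div_nonneg (mul_nonneg (by linarith) (by linarith)) two_pos.le, by linarith, by linarith⟩

theorem inner_torusElement {lam : PPlus q} (S : SphericalRep 𝔽 p q lam) (hqp : q ≤ p)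
    {x : Fin q → ℝ} (hx : x ∈ alcove q) :
    inner ℂ S.u (S.rep.ρ (torusElement 𝔽 hqp x) S.u) = (S.jacobi x : ℂ) :=
  S.spherical.choose_spec.2 x hx _ (torusElement_mat hqp x)

theorem inner_mul_torusElement_mul {lam : PPlus q} (S : SphericalRep 𝔽 p q lam) (hqp : q ≤ p)
    {x : Fin q → ℝ} (hx : x ∈ alcove q) {k l : GrassmannG 𝔽 p q} (hk : k ∈ GrassmannK 𝔽 p q)
    (hl : l ∈ GrassmannK 𝔽 p q) :
    inner ℂ S.u (S.rep.ρ (k * torusElement 𝔽 hqp x * l) S.u) = (S.jacobi x : ℂ) := by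
  rw [inner_ρ_mul_mul S.u_mem hk hl, S.inner_torusElement hqp hx]

theorem exists_eq_smul_u {lam : PPlus q} (S : SphericalRep 𝔽 p q lam) {v : S.rep.H}
    (hv : v ∈ S.rep.fixed (GrassmannK 𝔽 p q)) : ∃ c : ℂ, v = c • S.u := by
  have hu : (⟨S.u, S.u_mem⟩ : S.rep.fixed (GrassmannK 𝔽 p q)) ≠ 0 := by
    intro h
    have h1 : S.u = 0 := congrArg Subtype.val h
    have h2 := S.norm_u
    rw [h1, norm_zero] at h2
    exact zero_ne_one h2
  obtain ⟨c, hc⟩ := exists_smul_eq_of_finrank_eq_one S.finrank_fixed hu ⟨v, hv⟩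
  exact ⟨c, (congrArg Subtype.val hc).symm⟩

variable (S : (τ : PPlus q) → SphericalRep 𝔽 p q τ)

/-- Spherical representations of different weights are inequivalent. -/
theorem eq_of_equivSub (hqp : q ≤ p) {V : UnitaryRep (GrassmannG 𝔽 p q)} {W : Submodule ℂ V.H}
    {τ τ' : PPlus q} (h : V.EquivSub W (S τ).rep) (h' : V.EquivSub W (S τ').rep) : τ = τ' := by
  obtain ⟨T, hT⟩ := h.exists_intertwines h'
  have hT' : ∀ g v, T ((S τ).rep.ρ g v) = (S τ').rep.ρ g (T v) := hT
  have hfix : T (S τ).u ∈ (S τ').rep.fixed (GrassmannK 𝔽 p q) := by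
    intro k hk
    rw [← hT', (S τ).u_mem k hk]
  obtain ⟨c, hc⟩ := (S τ').exists_eq_smul_u hfix
  have hc1 : ‖c‖ = 1 := by
    have := congrArg norm hc
    rw [T.norm_map, norm_smul, (S τ).norm_u, (S τ').norm_u, mul_one] at this
    exact this.symm
  obtain ⟨h1, h2, h3⟩ := multiplicity_nonneg (p := p) 𝔽 hqp
  -- `T` maps `u_τ` to a unimodular multiple of `u_τ'`, so the two spherical functions agree, hence
  -- so do the Jacobi polynomials on the alcove.
  refine (S τ).isJacobiPoly_jacobi.eq_of_eqOn h1 h2 h3 (S τ').isJacobiPoly_jacobi fun x hx => ?_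
  have e1 := (S τ).inner_torusElement hqp hx
  rw [← T.inner_map_map, hT', hc, map_smul, inner_smul_left, inner_smul_right, ← mul_assoc,
    (S τ').inner_torusElement hqp hx, Complex.conj_mul', hc1] at e1
  simpa using e1.symm

variable (hq : 1 ≤ q) (hqp : q ≤ p) (hreal : 𝔽 = BaseField.real → q < p)
include hq hqp hreal

/-- An irreducible representation with a nonzero `K`-invariant vector is one of the given
spherical representations. -/
theorem exists_equivSub_top {V : UnitaryRep (GrassmannG 𝔽 p q)} (hV : V.Irreducible) {v : V.H}
    (hv : v ∈ V.fixed (GrassmannK 𝔽 p q)) (hv0 : v ≠ 0) :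
    ∃ τ : PPlus q, V.EquivSub ⊤ (S τ).rep := by
  by_contra! hne
  borelize (GrassmannG 𝔽 p q)
  set μ : Measure (GrassmannG 𝔽 p q) := Measure.haar
  set φ : GrassmannG 𝔽 p q → ℂ := fun g => inner ℂ v (V.ρ g v) with hφ
  have hφc : Continuous φ := by
    have := V.continuous_apply v
    fun_prop
  set a : (Fin q → ℝ) → GrassmannG 𝔽 p q := torusElement 𝔽 hqp
  have hac : Continuous a := continuous_torusElement hqp
  obtain ⟨h1, h2, h3⟩ := multiplicity_nonneg (p := p) 𝔽 hqp
  -- Every combination of orbit sums extends from the alcove to a continuous bi-`K`-invariant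
  -- function on `G` that integrates to zero against `φ`. For Jacobi polynomials the extension is
  -- the conjugate spherical function, with the same values since these are real.
  have hext : ∀ P ∈ Submodule.span ℝ (Set.range (PPlus.orbitSum : PPlus q → (Fin q → ℝ) → ℝ)),
      ∃ ψ : GrassmannG 𝔽 p q → ℂ, Continuous ψ ∧ (∀ x ∈ alcove q, ∀ k ∈ GrassmannK 𝔽 p q,
        ∀ l ∈ GrassmannK 𝔽 p q, ψ (k * a x * l) = (P x : ℂ)) ∧ ∫ g, ψ g * φ g ∂μ = 0 := by
    intro P hP
    have hP' : P ∈ Submodule.span ℝ (Set.range fun τ => (S τ).jacobi) := by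
      refine Submodule.span_le.2 ?_ hP
      rintro _ ⟨τ, rfl⟩
      exact IsJacobiPoly.orbitSum_mem_span h1 h2 h3 (fun τ => (S τ).isJacobiPoly_jacobi) τ
    clear hP
    induction hP' using Submodule.span_induction with
    | mem f hf =>
      obtain ⟨τ, rfl⟩ := hf
      have hc := (S τ).rep.continuous_apply (S τ).u
      refine ⟨fun g => inner ℂ ((S τ).rep.ρ g (S τ).u) (S τ).u, by fun_prop,
        fun x hx k hk l hl => ?_,
        integral_inner_mul_inner_eq_zero μ hV (S τ).irreducible (hne τ) v (S τ).u⟩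
      change inner ℂ ((S τ).rep.ρ (k * a x * l) (S τ).u) (S τ).u = ((S τ).jacobi x : ℂ)
      rw [← inner_conj_symm, (S τ).inner_mul_torusElement_mul hqp hx hk hl, Complex.conj_ofReal]
    | zero => exact ⟨0, continuous_const, by simp, by simp⟩
    | add f g _ _ hf hg =>
      obtain ⟨ψ, hψ, hψ', hψ0⟩ := hf
      obtain ⟨χ, hχ, hχ', hχ0⟩ := hg
      refine ⟨ψ + χ, hψ.add hχ, fun x hx k hk l hl => ?_, ?_⟩
      · rw [Pi.add_apply, hψ' x hx k hk l hl, hχ' x hx k hk l hl, Pi.add_apply, Complex.ofReal_add]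
      · simp only [Pi.add_apply, add_mul]
        rw [integral_add (integrable_of_continuous μ (by fun_prop))
          (integrable_of_continuous μ (by fun_prop)), hψ0, hχ0, add_zero]
    | smul c f _ hf =>
      obtain ⟨ψ, hψ, hψ', hψ0⟩ := hf
      refine ⟨fun g => (c : ℂ) * ψ g, by fun_prop, fun x hx k hk l hl => ?_, ?_⟩
      · simp only
        rw [hψ' x hx k hk l hl, Pi.smul_apply, smul_eq_mul, Complex.ofReal_mul]
      · simp only [mul_assoc]
        rw [integral_const_mul, hψ0, mul_zero]
  have hI : 0 < ∫ g, ‖φ g‖ ^ 2 ∂μ := by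
    refine Continuous.integral_pos_of_hasCompactSupport_nonneg_nonzero (x := 1) (by fun_prop)
      (HasCompactSupport.of_compactSpace _) (fun g => by positivity) ?_
    have h1 : φ 1 = inner ℂ v v := by rw [hφ]; simp only [map_one]; rfl
    rw [h1]
    exact pow_ne_zero 2 (norm_ne_zero_iff.2 (inner_self_ne_zero.2 hv0))
  set I := ∫ g, ‖φ g‖ ^ 2 ∂μ with hIdef
  set A := ∫ g, ‖φ g‖ ∂μ with hAdef
  have hA : 0 ≤ A := integral_nonneg fun g => norm_nonneg _
  -- Chosen so that `2 * ε * A = I * (A / (A + 1)) < I`; the summand `1` avoids dividing by zero.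
  set ε : ℝ := I / (2 * (A + 1)) with hεdef
  have hε : 0 < ε := by positivity
  obtain ⟨P, hP, hPφ⟩ := PPlus.exists_mem_span_orbitSum_near (q := q) (f := fun x => (φ (a x)).re)
    (by fun_prop) hε
  -- The function to approximate is the conjugate of `φ`, hence the minus sign in the imaginary
  -- part.
  obtain ⟨Q, hQ, hQφ⟩ := PPlus.exists_mem_span_orbitSum_near (q := q) (f := fun x => -(φ (a x)).im)
    (by fun_prop) hε
  obtain ⟨ψ, hψ, hψ', hψ0⟩ := hext P hP
  obtain ⟨χ, hχ, hχ', hχ0⟩ := hext Q hQ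
  have hnear : ∀ g, ‖starRingEnd ℂ (φ g) - (ψ g + χ g * Complex.I)‖ ≤ 2 * ε := by
    intro g
    obtain ⟨x, hx, k, hk, l, hl, rfl⟩ := exists_mem_grassmannK_mul_torusElement_mul hq hqp hreal g
    have h1 : φ (k * a x * l) = φ (a x) := inner_ρ_mul_mul hv hk hl _
    have h2 : starRingEnd ℂ (φ (a x)) - ((P x : ℂ) + (Q x : ℂ) * Complex.I) =
        ((((φ (a x)).re - P x : ℝ) : ℂ) + ((-(φ (a x)).im - Q x : ℝ) : ℂ) * Complex.I) := by
      apply Complex.ext <;> simp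
    change ‖starRingEnd ℂ (φ (k * a x * l)) - (ψ (k * a x * l) + χ (k * a x * l) * Complex.I)‖ ≤ _
    rw [h1, hψ' x hx k hk l hl, hχ' x hx k hk l hl, h2]
    refine (norm_add_le _ _).trans ?_
    rw [norm_mul, Complex.norm_I, mul_one, Complex.norm_real, Complex.norm_real, norm_sub_rev,
      norm_sub_rev _ (Q x)]
    linarith [hPφ x hx, hQφ x hx]
  -- The approximant is orthogonal to `φ`, so subtracting it from the conjugate of `φ` leaves the
  -- integral equal to `∫ ‖φ‖²`.
  have hsub : ∫ g, (starRingEnd ℂ (φ g) - (ψ g + χ g * Complex.I)) * φ g ∂μ = (I : ℂ) := by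
    have e : ∀ g, (starRingEnd ℂ (φ g) - (ψ g + χ g * Complex.I)) * φ g =
        ((‖φ g‖ ^ 2 : ℝ) : ℂ) - (ψ g * φ g + Complex.I * (χ g * φ g)) := by
      intro g
      rw [sub_mul, Complex.conj_mul', Complex.ofReal_pow]
      ring
    simp only [e]
    rw [integral_sub (integrable_of_continuous μ (by fun_prop))
      (integrable_of_continuous μ (by fun_prop)), integral_add
      (integrable_of_continuous μ (by fun_prop)) (integrable_of_continuous μ (by fun_prop)),
      integral_const_mul, hψ0, hχ0, mul_zero, add_zero, sub_zero]
    exact integral_ofReal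
  have hle : I ≤ 2 * ε * A := by
    have h1 : I = ‖(I : ℂ)‖ := by rw [Complex.norm_real, Real.norm_of_nonneg hI.le]
    rw [h1, ← hsub, hAdef, ← integral_const_mul]
    refine norm_integral_le_of_norm_le (integrable_of_continuous μ (by fun_prop))
      (Filter.Eventually.of_forall fun g => ?_)
    rw [norm_mul]
    exact mul_le_mul_of_nonneg_right (hnear g) (norm_nonneg _)
  have h4 : 2 * ε * A = I * (A / (A + 1)) := by
    rw [hεdef]
    field_simp
  have h5 : A / (A + 1) < 1 := (div_lt_one (by positivity)).2 (by linarith)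
  rw [h4] at hle
  nlinarith

end SphericalRep
end

noncomputable section

/-! ### Isotypic projections in tensor products -/

namespace UnitaryRep

variable {G : Type} [Group G] [TopologicalSpace G]

theorem tensor_ρ_tmul (V U : UnitaryRep G) (g : G) (v : V.H) (u : U.H) :
    (V.tensor U).ρ g (v ⊗ₜ[ℂ] u : V.H ⊗[ℂ] U.H) = (V.ρ g v ⊗ₜ[ℂ] U.ρ g u : V.H ⊗[ℂ] U.H) := rfl

theorem vpow_mem_fixed {V : UnitaryRep G} {K : Subgroup G} {u : V.H} (hu : u ∈ V.fixed K) (n : ℕ) :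
    V.vpow u n ∈ (V.tpow n).fixed K := by
  induction n with
  | zero => exact fun k _ => rfl
  | succ n ih =>
    intro k hk
    refine (tensor_ρ_tmul (V.tpow n) V k (V.vpow u n) u).trans ?_
    rw [ih k hk, hu k hk]
    rfl

/-- The isometry `f ⊗ id`. -/
def tensorMap {V V' : UnitaryRep G} (f : V.H →ₗᵢ[ℂ] V'.H) (U : UnitaryRep G) :
    (V.tensor U).H →ₗᵢ[ℂ] (V'.tensor U).H := f.rTensor U.H

theorem Intertwines.tensorMap {V V' : UnitaryRep G} {f : V.H →ₗᵢ[ℂ] V'.H}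
    (hf : Intertwines V V' f.toLinearMap) (U : UnitaryRep G) :
    Intertwines (V.tensor U) (V'.tensor U) (tensorMap f U).toLinearMap := by
  intro g x
  let A : V.H ⊗[ℂ] U.H →ₗ[ℂ] V'.H ⊗[ℂ] U.H :=
    (UnitaryRep.tensorMap f U).toLinearMap ∘ₗ ((V.tensor U).ρ g).toLinearIsometry.toLinearMap
  let B : V.H ⊗[ℂ] U.H →ₗ[ℂ] V'.H ⊗[ℂ] U.H :=
    ((V'.tensor U).ρ g).toLinearIsometry.toLinearMap ∘ₗ (UnitaryRep.tensorMap f U).toLinearMap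
  have h : A = B := TensorProduct.ext' fun v u =>
    congrArg (fun w => (w ⊗ₜ[ℂ] U.ρ g u : V'.H ⊗[ℂ] U.H)) (hf g v)
  exact congrArg (fun T : V.H ⊗[ℂ] U.H →ₗ[ℂ] V'.H ⊗[ℂ] U.H => T x) h

theorem inner_rTensor_eq_zero {E E' F H : Type*} [NormedAddCommGroup E] [InnerProductSpace ℂ E]
    [NormedAddCommGroup E'] [InnerProductSpace ℂ E'] [NormedAddCommGroup F] [InnerProductSpace ℂ F]
    [NormedAddCommGroup H] [InnerProductSpace ℂ H] (f : E →ₗᵢ[ℂ] F) (f' : E' →ₗᵢ[ℂ] F)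
    (h : ∀ x y, inner ℂ (f x) (f' y) = 0) (x : E ⊗[ℂ] H) (y : E' ⊗[ℂ] H) :
    inner ℂ (f.rTensor H x) (f'.rTensor H y) = 0 := by
  induction x using TensorProduct.induction_on with
  | zero => rw [map_zero, inner_zero_left]
  | add x x' hx hx' => rw [map_add, inner_add_left, hx, hx', add_zero]
  | tmul v u =>
    induction y using TensorProduct.induction_on with
    | zero => rw [map_zero, inner_zero_right]
    | add x x' hx hx' => rw [map_add, inner_add_right, hx, hx', add_zero]
    | tmul v' u' =>
      change inner ℂ (f v ⊗ₜ[ℂ] u) (f' v' ⊗ₜ[ℂ] u') = 0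
      rw [TensorProduct.inner_tmul, h, zero_mul]

/-- Projections to isotypic components of `V ⊗ U` preserve orthogonality with respect to
decompositions of `V`. -/
theorem IsDecomposition.norm_sq_starProjection_tensor {V U V' : UnitaryRep G} {ι : Type*}
    [Fintype ι] {W : ι → Submodule ℂ V.H} (hW : V.IsDecomposition W) (hV' : V'.Irreducible)
    (v : V.H) (u : U.H) :
    ‖((V.tensor U).isotypic V').starProjection (v ⊗ₜ[ℂ] u : V.H ⊗[ℂ] U.H)‖ ^ 2 =
      ∑ i, ‖((V.tensor U).isotypic V').starProjection
        ((W i).starProjection v ⊗ₜ[ℂ] u : V.H ⊗[ℂ] U.H)‖ ^ 2 := by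
  have h1 : (v ⊗ₜ[ℂ] u : V.H ⊗[ℂ] U.H) = ∑ i, (W i).starProjection v ⊗ₜ[ℂ] u := by
    rw [← TensorProduct.sum_tmul, hW.sum_starProjection]
  let j (i : ι) : (V.sub (W i) (hW.irreducible i).1).H →ₗᵢ[ℂ] V.H := (W i).subtypeₗᵢ
  have hj : ∀ i, Intertwines (V.sub (W i) (hW.irreducible i).1) V (j i).toLinearMap :=
    fun i => intertwines_subtype (hW.irreducible i).1
  -- The projection commutes with the inclusion of `W i ⊗ U`, so it keeps each summand inside `W i ⊗
  -- U`; these subspaces are mutually orthogonal.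
  have h2 : ∀ i, ∃ y, ((V.tensor U).isotypic V').starProjection
      ((W i).starProjection v ⊗ₜ[ℂ] u : V.H ⊗[ℂ] U.H) = tensorMap (j i) U y := by
    intro i
    let w : (V.sub (W i) (hW.irreducible i).1).H :=
      (⟨(W i).starProjection v, (W i).starProjection_apply_mem v⟩ : W i)
    exact ⟨_, hV'.starProjection_isotypic_map _ ((hj i).tensorMap U)
      (w ⊗ₜ[ℂ] u : (V.sub (W i) (hW.irreducible i).1).H ⊗[ℂ] U.H)⟩
  choose y hy using h2
  have h3 : ((V.tensor U).isotypic V').starProjection (v ⊗ₜ[ℂ] u : V.H ⊗[ℂ] U.H) =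
      ∑ i, ((V.tensor U).isotypic V').starProjection
        ((W i).starProjection v ⊗ₜ[ℂ] u : V.H ⊗[ℂ] U.H) := by
    rw [h1]
    exact map_sum _ _ _
  rw [h3]
  refine norm_sum_sq_of_pairwise_inner_eq_zero _ _ fun i i' hi => ?_
  rw [hy, hy]
  refine inner_rTensor_eq_zero _ _ (fun a b => ?_) _ _
  exact hW.inner_eq_zero hi (Subtype.property (p := (· ∈ W i)) a)
    (Subtype.property (p := (· ∈ W i')) b)

theorem isDecomposition_trivial : (trivial G).IsDecomposition fun _ : Unit => ⊤ := by
  refine ⟨fun _ => ⟨fun _ _ _ => Submodule.mem_top, ?_, fun U _ _ => ?_⟩,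
    fun i j h => absurd (Subsingleton.elim i j) h, by simp⟩
  · exact (top_ne_bot : (⊤ : Submodule ℂ ℂ) ≠ ⊥)
  · exact eq_bot_or_eq_top (α := Submodule ℂ ℂ) U

end UnitaryRep

namespace PPlus

instance (q : ℕ) : Countable (PPlus q) := Subtype.countable

end PPlus

/-! ### Masses of the convolution powers -/

namespace SphericalRep

open UnitaryRep

variable {𝔽 : BaseField} {p q : ℕ} (S : (τ : PPlus q) → SphericalRep 𝔽 p q τ)

/-- Pulled back along the equivalence, `v` is `K`-invariant and thus `c • u_σ` with `‖c‖ = ‖v‖`. The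
isotypic projection commutes with the induced isometry of tensor products. -/
theorem norm_sq_starProjection_tensor {V : UnitaryRep (GrassmannG 𝔽 p q)}
    {W : Submodule ℂ V.H} {σ : PPlus q} (h : V.EquivSub W (S σ).rep) {v : V.H} (hv : v ∈ W)
    (hvK : v ∈ V.fixed (GrassmannK 𝔽 p q)) (lam τ : PPlus q) :
    ‖((V.tensor (S lam).rep).isotypic (S τ).rep).starProjection
      (v ⊗ₜ[ℂ] (S lam).u : V.H ⊗[ℂ] (S lam).rep.H)‖ ^ 2 = ‖v‖ ^ 2 * convCoeff S σ lam τ := by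
  obtain ⟨f, hf, hfW⟩ := h
  obtain ⟨w, rfl⟩ : v ∈ LinearMap.range f.toLinearMap := hfW.symm ▸ hv
  have hw : w ∈ (S σ).rep.fixed (GrassmannK 𝔽 p q) := fun k hk =>
    f.injective ((hf k w).trans (hvK k hk))
  obtain ⟨c, rfl⟩ := (S σ).exists_eq_smul_u hw
  let x : ((S σ).rep.tensor (S lam).rep).H :=
    ((S σ).u ⊗ₜ[ℂ] (S lam).u : (S σ).rep.H ⊗[ℂ] (S lam).rep.H)
  have h1 := (S τ).irreducible.starProjection_isotypic_map _
    (Intertwines.tensorMap (f := f) hf (S lam).rep) x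
  have h2 : (f.toLinearMap (c • (S σ).u) ⊗ₜ[ℂ] (S lam).u : V.H ⊗[ℂ] (S lam).rep.H) =
      c • tensorMap f (S lam).rep x := by
    rw [map_smul]
    rfl
  have h3 : ‖f.toLinearMap (c • (S σ).u)‖ = ‖c‖ := by
    refine (f.norm_map _).trans ?_
    rw [norm_smul, (S σ).norm_u, mul_one]
  rw [h2, h3, convCoeff, ← mul_pow]
  refine congrArg (· ^ 2) ?_
  refine (congrArg norm ((map_smul _ c _).trans (congrArg (c • ·) h1))).trans ?_
  rw [norm_smul, LinearIsometry.norm_map]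

theorem ofReal_norm_sq_starProjection_tensor {V : UnitaryRep (GrassmannG 𝔽 p q)} {ι : Type*}
    [Fintype ι] {W : ι → Submodule ℂ V.H} (hW : V.IsDecomposition W) {v : V.H}
    (hv : v ∈ V.fixed (GrassmannK 𝔽 p q)) {t : ι → PPlus q}
    (ht : ∀ i, (W i).starProjection v ≠ 0 → V.EquivSub (W i) (S (t i)).rep) (lam τ : PPlus q) :
    ENNReal.ofReal (‖((V.tensor (S lam).rep).isotypic (S τ).rep).starProjection
      (v ⊗ₜ[ℂ] (S lam).u : V.H ⊗[ℂ] (S lam).rep.H)‖ ^ 2) =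
      ∑ i, ENNReal.ofReal (‖(W i).starProjection v‖ ^ 2) *
        ENNReal.ofReal (convCoeff S (t i) lam τ) := by
  refine (congrArg ENNReal.ofReal
    (hW.norm_sq_starProjection_tensor (S τ).irreducible v (S lam).u)).trans ?_
  refine (ENNReal.ofReal_sum_of_nonneg fun i _ => sq_nonneg _).trans
    (Finset.sum_congr rfl fun i _ => ?_)
  rw [← ENNReal.ofReal_mul (sq_nonneg _)]
  refine congrArg ENNReal.ofReal ?_
  -- Where the projection vanishes, `t i` is arbitrary, but both sides are zero.
  by_cases h0 : (W i).starProjection v = 0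
  · have h1 : ((W i).starProjection v ⊗ₜ[ℂ] (S lam).u : V.H ⊗[ℂ] (S lam).rep.H) = 0 := by
      rw [h0, TensorProduct.zero_tmul]
    have h2 : ((V.tensor (S lam).rep).isotypic (S τ).rep).starProjection
        ((W i).starProjection v ⊗ₜ[ℂ] (S lam).u : V.H ⊗[ℂ] (S lam).rep.H) = 0 :=
      (congrArg _ h1).trans (map_zero _)
    rw [h2, h0, norm_zero, norm_zero, zero_pow two_ne_zero, zero_mul]
  · exact norm_sq_starProjection_tensor S (ht i h0) ((W i).starProjection_apply_mem v)
      ((hW.irreducible i).1.starProjection_mem_fixed hv) lam τ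

theorem conv_sum_smul_dirac_singleton {ι : Type*} [Fintype ι] (a : ι → ENNReal)
    (t : ι → PPlus q) (lam τ : PPlus q) :
    conv S (∑ i, a i • Measure.dirac (t i)) (Measure.dirac lam) {τ} =
      ∑ i, a i * ENNReal.ofReal (convCoeff S (t i) lam τ) := by
  have h : ∀ σ, pointConv S σ lam {τ} = ENNReal.ofReal (convCoeff S σ lam τ) := by
    intro σ
    rw [pointConv, Measure.sum_apply _ (MeasurableSet.singleton τ), tsum_eq_single τ]
    · simp
    · intro b hb
      simp [hb]
  rw [conv, Measure.bind_apply (MeasurableSet.singleton τ) measurable_from_top.aemeasurable,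
    lintegral_finsetSum_measure]
  refine Finset.sum_congr rfl fun i _ => ?_
  rw [lintegral_smul_measure, lintegral_dirac, Measure.dirac_bind measurable_from_top,
    smul_eq_mul, h]

/-- The spherical function of weight zero is constantly one on `G = K A₀ K`, and equality in the
Cauchy-Schwarz inequality for unit vectors forces them to coincide. -/
theorem ρ_u_of_zero (hq : 1 ≤ q) (hqp : q ≤ p) (hreal : 𝔽 = BaseField.real → q < p)
    (S : SphericalRep 𝔽 p q 0) (g : GrassmannG 𝔽 p q) : S.rep.ρ g S.u = S.u := by
  obtain ⟨h1, h2, h3⟩ := multiplicity_nonneg (p := p) 𝔽 hqp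
  obtain ⟨x, hx, k, hk, l, hl, rfl⟩ := exists_mem_grassmannK_mul_torusElement_mul hq hqp hreal g
  have h := S.inner_mul_torusElement_mul hqp hx hk hl
  rw [S.isJacobiPoly_jacobi.eq_one, Pi.one_apply, Complex.ofReal_one,
    inner_eq_one_iff_of_norm_eq_one S.norm_u (by rw [LinearIsometryEquiv.norm_map, S.norm_u])] at h
  exact h.symm

variable (hq : 1 ≤ q) (hqp : q ≤ p) (hreal : 𝔽 = BaseField.real → q < p)
include hq hqp hreal

theorem existsUnique_equivSub {V : UnitaryRep (GrassmannG 𝔽 p q)} {W : Submodule ℂ V.H}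
    (hW : V.IrreducibleSub W) {v : V.H} (hv : v ∈ V.fixed (GrassmannK 𝔽 p q))
    (h0 : W.starProjection v ≠ 0) : ∃! τ : PPlus q, V.EquivSub W (S τ).rep := by
  let w : (V.sub W hW.1).H := (⟨W.starProjection v, W.starProjection_apply_mem v⟩ : W)
  obtain ⟨τ, hτ⟩ := exists_equivSub_top S hq hqp hreal hW.irreducible_sub (v := w)
    (fun k hk => Subtype.ext (hW.1.starProjection_mem_fixed hv k hk))
    (fun h => h0 (congrArg Subtype.val h))
  exact ⟨τ, hτ.of_sub, fun τ' h => eq_of_equivSub S hqp h hτ.of_sub⟩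

/-- Since `u_0` is invariant under all of `G`, the functional `⟨u_0, ·⟩` is a nonzero intertwining
operator from `π_0` to the trivial representation. -/
theorem trivial_equivSub_top :
    (UnitaryRep.trivial (GrassmannG 𝔽 p q)).EquivSub ⊤ (S 0).rep := by
  have hT : Intertwines (S 0).rep (UnitaryRep.trivial _) (innerSL ℂ (S 0).u).toLinearMap := by
    intro g v
    change inner ℂ (S 0).u ((S 0).rep.ρ g v) = inner ℂ (S 0).u v
    nth_rewrite 1 [← (S 0).ρ_u_of_zero hq hqp hreal g]
    exact inner_ρ_ρ _ _ _ _
  have h0 : (innerSL ℂ (S 0).u).toLinearMap ≠ 0 := by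
    intro h
    have h1 : inner ℂ (S 0).u (S 0).u = 0 := congrArg (fun T => T (S 0).u) h
    have h2 := (S 0).norm_u
    rw [inner_self_eq_zero.1 h1, norm_zero] at h2
    exact zero_ne_one h2
  have h1 := (S 0).irreducible.equivSub_range hT h0
  rcases (isDecomposition_trivial.irreducible ()).2.2 _ le_top h1.invariant with h | h
  · exact absurd (LinearMap.range_eq_bot.1 h) h0
  · exact h ▸ h1

/-- The mass at `τ` of the measure belonging to a decomposition. -/
theorem sum_smul_dirac_singleton {V : UnitaryRep (GrassmannG 𝔽 p q)} {ι : Type*} [Fintype ι]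
    {W : ι → Submodule ℂ V.H} (hW : V.IsDecomposition W) (v : V.H) {t : ι → PPlus q}
    (ht : ∀ i, (W i).starProjection v ≠ 0 → V.EquivSub (W i) (S (t i)).rep) (τ : PPlus q) :
    (∑ i, ENNReal.ofReal (‖(W i).starProjection v‖ ^ 2) • Measure.dirac (t i)) {τ} =
      ENNReal.ofReal (‖(V.isotypic (S τ).rep).starProjection v‖ ^ 2) := by
  classical
  rw [hW.norm_sq_starProjection_isotypic (S τ).irreducible,
    ENNReal.ofReal_sum_of_nonneg fun _ _ => by positivity, Finset.sum_filter,
    Measure.finsetSum_apply]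
  refine Finset.sum_congr rfl fun i _ => ?_
  rw [Measure.smul_apply, smul_eq_mul, Measure.dirac_apply]
  rcases eq_or_ne ((W i).starProjection v) 0 with h0 | h0
  · simp [h0]
  · have h := ht i h0
    by_cases hτ : t i = τ
    · rw [hτ] at h
      simp [hτ, h]
    · have h' : ¬ V.EquivSub (W i) (S τ).rep := fun h' => hτ (eq_of_equivSub S hqp h h')
      simp [hτ, h']

/-- The right-hand side involves no chosen decomposition, so in the induction step any decomposition
of the `n`-th power may be used to expand both sides. -/
theorem convPow_singleton (lam : PPlus q) (n : ℕ) (τ : PPlus q) :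
    convPow S lam n {τ} = ENNReal.ofReal
      (‖(((S lam).rep.tpow n).isotypic (S τ).rep).starProjection
        ((S lam).rep.vpow (S lam).u n)‖ ^ 2) := by
  induction n generalizing τ with
  | zero =>
    refine Eq.trans ?_ (sum_smul_dirac_singleton S hq hqp hreal
      (isDecomposition_trivial (G := GrassmannG 𝔽 p q)) (1 : ℂ) (t := fun _ => 0)
      (fun _ _ => trivial_equivSub_top S hq hqp hreal) τ)
    have h1 : ((⊤ : Submodule ℂ ℂ).starProjection (1 : ℂ)) = 1 :=
      Submodule.starProjection_eq_self_iff.2 Submodule.mem_top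
    change Measure.dirac 0 {τ} = (∑ i : Unit, ENNReal.ofReal
      (‖((⊤ : Submodule ℂ ℂ).starProjection (1 : ℂ))‖ ^ 2) • Measure.dirac (0 : PPlus q)) {τ}
    rw [h1]
    simp
  | succ n ih =>
    obtain ⟨s, hW⟩ := ((S lam).rep.tpow n).exists_isDecomposition
    set v := (S lam).rep.vpow (S lam).u n
    have hv : v ∈ ((S lam).rep.tpow n).fixed (GrassmannK 𝔽 p q) := vpow_mem_fixed (S lam).u_mem n
    have ht : ∀ i : s, ∃ τ, (i : Submodule ℂ _).starProjection v ≠ 0 →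
        ((S lam).rep.tpow n).EquivSub (i : Submodule ℂ _) (S τ).rep := by
      intro i
      by_cases h : (i : Submodule ℂ _).starProjection v = 0
      · exact ⟨0, fun h' => absurd h h'⟩
      · obtain ⟨τ, hτ, -⟩ := existsUnique_equivSub S hq hqp hreal (hW.irreducible i) hv h
        exact ⟨τ, fun _ => hτ⟩
    choose t ht using ht
    -- The induction hypothesis at all singletons identifies the whole measure as a finite sum of
    -- point masses, to which the convolution with `δ_λ` applies termwise.
    have h1 : convPow S lam n =
        ∑ i : s, ENNReal.ofReal (‖(i : Submodule ℂ _).starProjection v‖ ^ 2) •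
          Measure.dirac (t i) :=
      Measure.ext_of_singleton fun σ =>
        (ih σ).trans (sum_smul_dirac_singleton S hq hqp hreal hW v ht σ).symm
    rw [convPow, h1, conv_sum_smul_dirac_singleton]
    exact (ofReal_norm_sq_starProjection_tensor S hW hv ht lam τ).symm

end SphericalRep

end

theorem lemma3p2 (𝔽 : BaseField) (p q : ℕ) (hq : 1 ≤ q) (hqp : q ≤ p)
    (hreal : 𝔽 = BaseField.real → q < p)
    (S : (τ : PPlus q) → SphericalRep 𝔽 p q τ)
    (lam : PPlus q) (hlam : lam ≠ 0) (n : ℕ)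
    {ι : Type*} [Fintype ι] (W : ι → Submodule ℂ ((S lam).rep.tpow n).H)
    (hW : ((S lam).rep.tpow n).IsDecomposition W) :
    (∀ i, (W i).starProjection ((S lam).rep.vpow (S lam).u n) ≠ 0 →
      ∃! τ : PPlus q, ((S lam).rep.tpow n).EquivSub (W i) (S τ).rep) ∧
    ∀ t : ι → PPlus q,
      (∀ i, (W i).starProjection ((S lam).rep.vpow (S lam).u n) ≠ 0 →
        ((S lam).rep.tpow n).EquivSub (W i) (S (t i)).rep) →
      convPow S lam n =
        ∑ i, ENNReal.ofReal (‖(W i).starProjection ((S lam).rep.vpow (S lam).u n)‖ ^ 2) •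
          MeasureTheory.Measure.dirac (t i) := by
  refine ⟨fun i => SphericalRep.existsUnique_equivSub S hq hqp hreal (hW.irreducible i)
    (UnitaryRep.vpow_mem_fixed (S lam).u_mem n), fun t ht => ?_⟩
  -- `P₊` is countable, so it suffices to compare masses of points; both equal the squared norm of
  -- the isotypic projection.
  exact Measure.ext_of_singleton fun τ =>
    (SphericalRep.convPow_singleton S hq hqp hreal lam n τ).trans
      (SphericalRep.sum_smul_dirac_singleton S hq hqp hreal hW _ ht τ).symm
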